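/- **Setting.** For each $m\ge 1$ let $\boldsymbol X_{k,j}=(X_{k,1,j},\dots,X_{k,m,j})$, $1\le k\le n_j$, $j=1,2$, be mutually independent random vectors in $\mathbb R^m$, where for each $j$ the vectors $\boldsymbol X_{1,j},\dots,\boldsymbol X_{n_j,j}$ have the law of $\boldsymbol X_j=(X_{1,j},\dots,X_{m,j})$, and $\boldsymbol X_1,\boldsymbol X_2$ are independent; the laws, the sample sizes $n_j$ and the probability space may depend on $m$. Let $\mu_{i,j}=\mathbb E X_{i,j}$, $\sigma_{i,j}^2=\operatorname{Var}(X_{i,j})\in(0,\infty)$, $\mathcal H_0=\{i\le m:\mu_{i,1}=\mu_{i,2}\}$, $\mathcal H_1=\{i\le m:\mu_{i,1}\ne\mu_{i,2}\}$, $\bar X_{i,j}=n_j^{-1}\sum_{k}X_{k,i,j}$. Let $T_i$ be one of the two-sample Student statistics $$T_i=\frac{\bar X_{i,1}-\bar X_{i,2}}{\sqrt{\hat\sigma_{i,1}^2/n_1+\hat\sigma_{i,2}^2/n_2}},\qquad \hat\sigma^2_{i,j}=\frac1{n_j-1}\sum_{k=1}^{n_j}(X_{k,i,j}-\bar X_{i,j})^2,$$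 or, provided that $\sigma^2_{i,1}=\sigma^2_{i,2}$ for all $i\le m$, $$T_i=\sqrt{\frac{n_1n_2}{(n_1+n_2)\hat\sigma^2_{i,pool}}}\,(\bar X_{i,1}-\bar X_{i,2}),\qquad \hat\sigma^2_{i,pool}=\frac1{n_1+n_2-2}\sum_{j=1}^2\sum_{k=1}^{n_j}(X_{k,i,j}-\bar X_{i,j})^2$$ (the same choice for all $i$ and $m$). Let $p_i=2-2\Psi(|T_i|)$, where $\Psi$ is the distribution function of Student's $t$ distribution with $n_1+n_2-2$ degrees of freedom, and let $p_{(1)}\le\dots\le p_{(m)}$ be the ordered p-values. For fixed $0<\alpha<1$, the Benjamini–Hochberg (BH) method rejects $i$ if and only if $p_i\le p_{(\hat k)}$, where $\hat k$ is the largest $1\le k\le m$ with $p_{(k)}\le\alpha k/m$; it rejects nothing if there is no such $k$. Its power is $$\mathrm{power}_{BH}=\frac{|\{i\in\mathcal H_1: i\text{ is rejected}\}|}{|\mathcal H_1|}.$$ **Theorem.** Assume that there are positive constants $K_1,t_0,c_1,c_2,c,K$ and $\zeta>5$, not depending on $m$, such that for all sufficiently large $m$: * $\mathbb E\exp(t_0|X_{i,j}-\mu_{i,j}|/\sigma_{i,j})\le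 K_1$ for all $i\le m$, $j=1,2$; $c_1\le n_1/n_2\le c_2$; $c_1\le\sigma_{i,1}^2/\sigma_{i,2}^2\le c_2$ for all $i\le m$; and $\min(n_1,n_2)\ge c(\log m)^\zeta$; * for every $i\in\mathcal H_0$ there is $\mathcal M_i\subset\mathcal H_0$ with $|\mathcal M_i|\ge|\mathcal H_0|-K$ such that the family $\{(X_{l,1},X_{l,2}):l\in\mathcal M_i\}$ is independent of $(X_{i,1},X_{i,2})$. Let $\theta>0$ and $0<\beta<1$ be constants such that, for all sufficiently large $m$, $$\frac{|\mu_{i,1}-\mu_{i,2}|}{\sqrt{\sigma^2_{i,1}/n_1+\sigma^2_{i,2}/n_2}}=\theta\sqrt{\log m}\quad\text{for all } i\in\mathcal H_1,$$ and $|\mathcal H_1|/m^\beta\to1$ as $m\to\infty$. If $0<\theta<\sqrt{2(1-\beta)}$, then $\mathrm{power}_{BH}\to0$ in probability as $m\to\infty$. If $\theta>\sqrt{2(1-\beta)}$, then $\mathrm{power}_{BH}\to1$ in probability as $m\to\infty$. -/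

import Mathlib

open MeasureTheory ProbabilityTheory Filter Topology

noncomputable section

/-- Two independent i.i.d. samples of random vectors in `ℝ^m`, defined on the probability
space `(Ω, P)`. The populations (indexed by `j : Fin 2`) are given by their laws `pop j` on `ℝ^m`;
the sizes are `n 0`, `n 1`. Nothing is assumed on the dependence between the coordinates. -/
structure TwoSample (m : ℕ) {Ω : Type*} [MeasurableSpace Ω] (P : Measure Ω) where
  /-- sample sizes -/
  n : Fin 2 → ℕ
  /-- population laws -/
  pop : Fin 2 → Measure (Fin m → ℝ)
  isProbabilityMeasure_pop : ∀ j, IsProbabilityMeasure (pop j)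
  /-- means and variances of the coordinates exist -/
  memLp_two : ∀ j i, MemLp (fun x : Fin m → ℝ => x i) 2 (pop j)
  /-- `X j k ω i` is the `i`-th coordinate of the `k`-th observation of sample `j` -/
  X : ∀ j : Fin 2, Fin (n j) → Ω → (Fin m → ℝ)
  hasLaw : ∀ j k, HasLaw (X j k) (pop j) P
  /-- all observations, of both samples together, are mutually independent -/
  indep : iIndepFun (fun q : (Σ j : Fin 2, Fin (n j)) => X q.1 q.2) P

/-- Which of the two versions of the two-sample `t` statistic is used: the pooled one (for equal
variances) or the unpooled one (for variances that are not necessarily equal). -/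
inductive VarianceCase where
  | equal
  | unequal

namespace TwoSample

variable {m : ℕ} {Ω : Type*} [MeasurableSpace Ω] {P : Measure Ω} (D : TwoSample m P)

/-- Population mean of coordinate `i` in population `j`. -/
def mean (j : Fin 2) (i : Fin m) : ℝ := ∫ x, x i ∂(D.pop j)

/-- Population variance of coordinate `i` in population `j`. -/
def var (j : Fin 2) (i : Fin m) : ℝ := variance (fun x : Fin m → ℝ => x i) (D.pop j)

open Classical in
/-- The set of true null hypotheses. -/
def nulls : Finset (Fin m) := Finset.univ.filter fun i => D.mean 0 i = D.mean 1 i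

open Classical in
/-- The set of signals (false null hypotheses). -/
def signals : Finset (Fin m) := Finset.univ.filter fun i => D.mean 0 i ≠ D.mean 1 i

/-- Standardized size of the mean difference of coordinate `i`. -/
def signalSize (i : Fin m) : ℝ :=
  |D.mean 0 i - D.mean 1 i| / √(D.var 0 i / D.n 0 + D.var 1 i / D.n 1)

/-- Sample mean. -/
def sampleMean (j : Fin 2) (i : Fin m) (ω : Ω) : ℝ := (1 / (D.n j : ℝ)) * ∑ k, D.X j k ω i

/-- Sum of squared deviations from the sample mean. -/
def sumSqDev (j : Fin 2) (i : Fin m) (ω : Ω) : ℝ :=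
  ∑ k, (D.X j k ω i - D.sampleMean j i ω) ^ 2

/-- Sample variance. -/
def sampleVar (j : Fin 2) (i : Fin m) (ω : Ω) : ℝ :=
  (1 / ((D.n j : ℝ) - 1)) * D.sumSqDev j i ω

/-- Pooled sample variance. -/
def pooledVar (i : Fin m) (ω : Ω) : ℝ :=
  (1 / ((D.n 0 : ℝ) + D.n 1 - 2)) * (D.sumSqDev 0 i ω + D.sumSqDev 1 i ω)

/-- Two-sample Student `t` statistic of coordinate `i`. -/
def tStat : VarianceCase → Fin m → Ω → ℝ
  | .equal, i, ω =>
      √((D.n 0 * D.n 1 : ℝ) / ((D.n 0 + D.n 1 : ℝ) * D.pooledVar i ω)) *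
        (D.sampleMean 0 i ω - D.sampleMean 1 i ω)
  | .unequal, i, ω =>
      (D.sampleMean 0 i ω - D.sampleMean 1 i ω) /
        √(D.sampleVar 0 i ω / D.n 0 + D.sampleVar 1 i ω / D.n 1)

end TwoSample

/-- Density of Student's `t` distribution with `ν` degrees of freedom. -/
def studentTPDF (ν x : ℝ) : ℝ :=
  Real.Gamma ((ν + 1) / 2) / (√(ν * Real.pi) * Real.Gamma (ν / 2)) *
    (1 + x ^ 2 / ν) ^ (-((ν + 1) / 2))

/-- Distribution function of Student's `t` distribution with `ν` degrees of freedom. -/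
def studentTCDF (ν t : ℝ) : ℝ := ∫ x in Set.Iic t, studentTPDF ν x

/-- The `k`-th smallest (`k = 0, …, m - 1`) of the numbers `p 0, …, p (m - 1)`. -/
def orderStat {m : ℕ} (p : Fin m → ℝ) (k : Fin m) : ℝ := p (Tuple.sort p k)

/-- Rejection set of the Benjamini–Hochberg method at level `α` for the p-values `p`: with `k + 1`
the largest rank such that `p_(k+1) ≤ α (k+1) / m`, reject every `i` with `p i ≤ p_(k+1)`; reject
nothing if there is no such rank. (The `k : Fin m` below has rank `k + 1`.) -/
def bhRejections {m : ℕ} (α : ℝ) (p : Fin m → ℝ) : Set (Fin m) :=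
  {i | ∃ k : Fin m, IsGreatest {l : Fin m | orderStat p l ≤ α * ((l : ℝ) + 1) / m} k ∧
    p i ≤ orderStat p k}

namespace TwoSample

variable {m : ℕ} {Ω : Type*} [MeasurableSpace Ω] {P : Measure Ω} (D : TwoSample m P)

/-- The p-value `2 - 2 Ψ(|T_i|)`, with `Ψ` Student's `t` distribution function with
`n₁ + n₂ - 2` degrees of freedom. -/
def pValue (v : VarianceCase) (ω : Ω) (i : Fin m) : ℝ :=
  2 - 2 * studentTCDF ((D.n 0 : ℝ) + D.n 1 - 2) |D.tStat v i ω|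

open Classical in
/-- Power of the Benjamini–Hochberg method at level `α`: the proportion of rejected signals. -/
def powerBH (v : VarianceCase) (α : ℝ) (ω : Ω) : ℝ :=
  ((D.signals.filter fun i => i ∈ bhRejections α (D.pValue v ω)).card : ℝ) / D.signals.card

end TwoSample

variable {Ω : ℕ → Type*} [∀ m, MeasurableSpace (Ω m)] {P : ∀ m, Measure (Ω m)}

/-- Exponential moments, balanced sample sizes and variances, and growth of the sample sizes;
all constants are independent of the dimension `m` (which tends to infinity). -/
def MomentCondition (D : ∀ m, TwoSample m (P m)) : Prop :=
  ∃ K₁ t₀ c₁ c₂ ζ c : ℝ, 0 < K₁ ∧ 0 < t₀ ∧ 0 < c₁ ∧ 0 < c₂ ∧ 5 < ζ ∧ 0 < c ∧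
    ∀ᶠ m in atTop,
      (∀ j i, 0 < (D m).var j i ∧
        ∫⁻ x, ENNReal.ofReal
            (Real.exp (t₀ * |x i - (D m).mean j i| / √((D m).var j i))) ∂((D m).pop j)
          ≤ ENNReal.ofReal K₁) ∧
      (c₁ ≤ ((D m).n 0 : ℝ) / (D m).n 1 ∧ ((D m).n 0 : ℝ) / (D m).n 1 ≤ c₂) ∧
      (∀ i, c₁ ≤ (D m).var 0 i / (D m).var 1 i ∧ (D m).var 0 i / (D m).var 1 i ≤ c₂) ∧
      c * Real.log m ^ ζ ≤ (min ((D m).n 0) ((D m).n 1) : ℕ)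

/-- Every true null coordinate `i` is independent of the family of all but at most `K` of the true
null coordinates, where `K` is independent of `m`. The pair `(X₁, X₂)` of population vectors has
law `(pop 0).prod (pop 1)`, as the two samples are independent. -/
def WeakDependence (D : ∀ m, TwoSample m (P m)) : Prop :=
  ∃ K : ℝ, 0 < K ∧ ∀ᶠ m in atTop, ∀ i ∈ (D m).nulls, ∃ M ⊆ (D m).nulls,
    ((D m).nulls.card : ℝ) - K ≤ M.card ∧
      IndepFun (fun (x : (Fin m → ℝ) × (Fin m → ℝ)) (l : M) => (x.1 l, x.2 l))
        (fun x : (Fin m → ℝ) × (Fin m → ℝ) => (x.1 i, x.2 i))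
        (((D m).pop 0).prod ((D m).pop 1))

/-- Convergence in probability to a constant, for random variables `Y m` defined on probability
spaces that may depend on `m`. -/
def TendstoInProbability (P : ∀ m, Measure (Ω m)) (Y : ∀ m, Ω m → ℝ) (a : ℝ) : Prop :=
  ∀ ε : ℝ, 0 < ε → Tendsto (fun m => P m {ω | ε ≤ |Y m ω - a|}) atTop (𝓝 0)

end

/-!
By Lindeberg replacement with exponentially weighted smooth test functions, the t statistics satisfy
Cramér-type moderate deviation bounds; together with a comparison of Student and Gaussian tails
they show that null p-values satisfy `P (p ≤ u) ≤ (1 + ε) * u` uniformly over `u ≥ m ^ (-s)` for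
each `s < 1`, whereas a signal of size `θ * √(log m)` has a p-value of order about
`m ^ (-θ ^ 2 / 2)`.

If `1 - β < s < θ ^ 2 / 2`, almost all the `≈ m ^ β` signals have p-values below `m ^ (-s)`. As
`m * m ^ (-s)` is negligible against `m ^ β`, the procedure accepts the threshold `m ^ (-s)`, and
the power tends to `1`.

If `θ ^ 2 / 2 < s < 1 - β`, few signals have p-values below `m ^ (-s)`. Above `m ^ (-s)` the number
of null p-values below `u` is at most about `m * u` uniformly in `u`, by weak dependence,
Chebyshev's inequality and a geometric grid, and all signals together number only
`o(m * m ^ (-s))`. As `α < 1`, no threshold above `m ^ (-s)` is accepted, and the power tends to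
`0`.
-/

/-- Upper tail of the standard Gaussian distribution. -/
noncomputable def gaussTail (x : ℝ) : ℝ := ∫ y in Set.Ioi x, gaussianPDFReal 0 1 y

theorem gaussianPDFReal_std (y : ℝ) :
    gaussianPDFReal 0 1 y = (√(2 * Real.pi))⁻¹ * Real.exp (-y ^ 2 / 2) := by
  simp [gaussianPDFReal]

theorem gaussianPDFReal_std_le_exp_mul {x y c : ℝ} (h : (x ^ 2 - y ^ 2) / 2 ≤ c) :
    gaussianPDFReal 0 1 y ≤ Real.exp c * gaussianPDFReal 0 1 x := by
  rw [gaussianPDFReal_std, gaussianPDFReal_std, mul_left_comm, ← Real.exp_add]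
  gcongr
  linarith

theorem gaussianReal_Ici (x : ℝ) : (gaussianReal 0 1).real (Set.Ici x) = gaussTail x := by
  rw [measureReal_def, gaussianReal_apply_eq_integral _ one_ne_zero, ENNReal.toReal_ofReal
    (setIntegral_nonneg measurableSet_Ici fun y _ => gaussianPDFReal_nonneg _ _ _),
    integral_Ici_eq_integral_Ioi, gaussTail]

theorem gaussTail_pos (x : ℝ) : 0 < gaussTail x := by
  have hsupp : Function.support (gaussianPDFReal 0 1) = Set.univ :=
    Set.eq_univ_of_forall fun y => (gaussianPDFReal_pos 0 1 y one_ne_zero).ne'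
  rw [gaussTail, setIntegral_pos_iff_support_of_nonneg_ae
    (ae_of_all _ (gaussianPDFReal_nonneg 0 1)) (integrable_gaussianPDFReal 0 1).integrableOn, hsupp]
  simp

theorem gaussTail_sub (x d : ℝ) (hd : 0 ≤ d) :
    gaussTail (x - d) = (∫ y in Set.Ioc (x - d) x, gaussianPDFReal 0 1 y) + gaussTail x := by
  have hint := integrable_gaussianPDFReal 0 1
  rw [gaussTail, gaussTail, ← setIntegral_union (Set.Ioc_disjoint_Ioi le_rfl) measurableSet_Ioi
    hint.integrableOn hint.integrableOn, Set.Ioc_union_Ioi_eq_Ioi (by linarith)]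

-- Over the interval `(x, x + 1 / (1 + x)]` the exponent `y ^ 2 / 2` increases by at most `3 / 2`.
theorem gaussianPDFReal_le_gaussTail {x : ℝ} (hx : 0 ≤ x) :
    gaussianPDFReal 0 1 x ≤ Real.exp (3 / 2) * (1 + x) * gaussTail x := by
  set w := (1 + x)⁻¹ with hw
  have hwx : w * (1 + x) = 1 := inv_mul_cancel₀ (by positivity)
  have hw0 : 0 < w := by positivity
  have hsplit := gaussTail_sub (x + w) w hw0.le
  rw [add_sub_cancel_right] at hsplit
  have hlower : ∫ _ in Set.Ioc x (x + w), Real.exp (-(3 / 2)) * gaussianPDFReal 0 1 x ≤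
      ∫ y in Set.Ioc x (x + w), gaussianPDFReal 0 1 y := by
    refine setIntegral_mono_on continuous_const.integrableOn_Ioc
      (integrable_gaussianPDFReal 0 1).integrableOn measurableSet_Ioc fun y hy => ?_
    rw [Real.exp_neg, inv_mul_le_iff₀ (Real.exp_pos _)]
    refine gaussianPDFReal_std_le_exp_mul ?_
    have hw1 : w ≤ 1 := inv_le_one_of_one_le₀ (by linarith)
    nlinarith [hy.1, hy.2, mul_nonneg hw0.le hx]
  simp only [setIntegral_const, Real.volume_real_Ioc, add_sub_cancel_left, smul_eq_mul,
    max_eq_left hw0.le] at hlower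
  have htail : w * (Real.exp (-(3 / 2)) * gaussianPDFReal 0 1 x) ≤ gaussTail x := by
    linarith [gaussTail_pos (x + w)]
  rw [hw, Real.exp_neg, inv_mul_le_iff₀ (by positivity), inv_mul_le_iff₀ (Real.exp_pos _)] at htail
  linarith

theorem gaussTail_sub_le {x d η : ℝ} (hx : 0 ≤ x) (hη : η ≤ 1) (hd : 0 ≤ d)
    (hdx : d * (1 + x) ≤ η) :
    gaussTail (x - d) ≤ (1 + Real.exp (5 / 2) * η) * gaussTail x := by
  have hupper : ∫ y in Set.Ioc (x - d) x, gaussianPDFReal 0 1 y ≤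
      ∫ _ in Set.Ioc (x - d) x, Real.exp 1 * gaussianPDFReal 0 1 x := by
    refine setIntegral_mono_on (integrable_gaussianPDFReal 0 1).integrableOn
      continuous_const.integrableOn_Ioc measurableSet_Ioc fun y hy =>
        gaussianPDFReal_std_le_exp_mul ?_
    have hy' := hy.1
    rcases le_total d x with h | h <;> nlinarith [sq_nonneg y, sq_nonneg d]
  simp only [setIntegral_const, Real.volume_real_Ioc, sub_sub_cancel, smul_eq_mul,
    max_eq_left hd] at hupper
  have htail := gaussTail_pos x
  calc gaussTail (x - d) ≤ d * (Real.exp 1 * gaussianPDFReal 0 1 x) + gaussTail x := by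
        rw [gaussTail_sub x d hd]; gcongr
    _ ≤ d * (Real.exp 1 * (Real.exp (3 / 2) * (1 + x) * gaussTail x)) + gaussTail x := by
        gcongr; exact gaussianPDFReal_le_gaussTail hx
    _ = (1 + Real.exp (5 / 2) * (d * (1 + x))) * gaussTail x := by
        rw [show (5 / 2 : ℝ) = 1 + 3 / 2 by norm_num, Real.exp_add]; ring
    _ ≤ _ := by gcongr

theorem Gamma_add_half_sq_le {x : ℝ} (hx : 0 < x) :
    Real.Gamma (x + 1 / 2) ^ 2 ≤ x * Real.Gamma x ^ 2 := by
  have hΓ := Real.Gamma_pos_of_pos hx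
  have hconvex := Real.Gamma_mul_add_mul_le_rpow_Gamma_mul_rpow_Gamma hx (by linarith : 0 < x + 1)
    (by norm_num : (0 : ℝ) < 1 / 2) (by norm_num : (0 : ℝ) < 1 / 2) (by norm_num)
  rw [show 1 / 2 * x + 1 / 2 * (x + 1) = x + 1 / 2 by ring, ← Real.sqrt_eq_rpow,
    ← Real.sqrt_eq_rpow, ← Real.sqrt_mul hΓ.le, Real.Gamma_add_one hx.ne'] at hconvex
  calc Real.Gamma (x + 1 / 2) ^ 2 ≤ √(Real.Gamma x * (x * Real.Gamma x)) ^ 2 := by gcongr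
    _ = x * Real.Gamma x ^ 2 := by rw [Real.sq_sqrt (by positivity)]; ring

theorem lintegral_rpow_mul_exp_neg_mul_Ioi {a r : ℝ} (ha : 0 < a) (hr : 0 < r) :
    ∫⁻ s in Set.Ioi (0 : ℝ), ENNReal.ofReal (s ^ (a - 1) * Real.exp (-(r * s))) =
      ENNReal.ofReal (r ^ (-a) * Real.Gamma a) := by
  have hval := Real.integral_rpow_mul_exp_neg_mul_Ioi ha hr
  have hint : IntegrableOn (fun s : ℝ => s ^ (a - 1) * Real.exp (-(r * s))) (Set.Ioi 0) := by
    refine not_imp_comm.1 integral_undef ?_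
    rw [hval]
    positivity
  rw [← ofReal_integral_eq_lintegral_ofReal hint, hval, Real.rpow_neg hr.le, one_div,
    Real.inv_rpow hr.le]
  filter_upwards [ae_restrict_mem measurableSet_Ioi] with s (hs : 0 < s)
  exact mul_nonneg (Real.rpow_nonneg hs.le _) (Real.exp_nonneg _)

theorem lintegral_exp_neg_mul_sq {b : ℝ} (hb : 0 < b) :
    ∫⁻ x : ℝ, ENNReal.ofReal (Real.exp (-b * x ^ 2)) = ENNReal.ofReal √(Real.pi / b) := by
  rw [← ofReal_integral_eq_lintegral_ofReal (integrable_exp_neg_mul_sq hb)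
    (ae_of_all _ fun x => (Real.exp_pos _).le), integral_gaussian]

-- Student's density is a Gamma mixture of centred Gaussian densities.
theorem lintegral_one_add_sq_div_rpow {ν a : ℝ} (hν : 0 < ν) (ha : 1 / 2 < a) :
    ∫⁻ x : ℝ, ENNReal.ofReal ((1 + x ^ 2 / ν) ^ (-a) * Real.Gamma a) =
      ENNReal.ofReal (√(ν * Real.pi) * Real.Gamma (a - 1 / 2)) := by
  have hgauss : ∀ s ∈ Set.Ioi (0 : ℝ),
      ∫⁻ x : ℝ, ENNReal.ofReal (s ^ (a - 1) * Real.exp (-((1 + x ^ 2 / ν) * s))) =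
        ENNReal.ofReal √(ν * Real.pi) *
          ENNReal.ofReal (s ^ ((a - 1 / 2) - 1) * Real.exp (-(1 * s))) := by
    intro s (hs : 0 < s)
    have hsplit : ∀ x : ℝ, s ^ (a - 1) * Real.exp (-((1 + x ^ 2 / ν) * s)) =
        s ^ (a - 1) * Real.exp (-s) * Real.exp (-(s / ν) * x ^ 2) := fun x => by
      rw [mul_assoc, ← Real.exp_add]; ring_nf
    simp_rw [hsplit, ENNReal.ofReal_mul (show 0 ≤ s ^ (a - 1) * Real.exp (-s) by positivity)]
    rw [lintegral_const_mul _ (by fun_prop), lintegral_exp_neg_mul_sq (by positivity),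
      ← ENNReal.ofReal_mul (by positivity), ← ENNReal.ofReal_mul (by positivity)]
    rw [show Real.pi / (s / ν) = ν * Real.pi / s by field_simp, Real.sqrt_div (by positivity),
      show a - 1 / 2 - 1 = (a - 1) - 1 / 2 by ring, Real.rpow_sub hs (a - 1), ← Real.sqrt_eq_rpow,
      one_mul]
    congr 1
    ring
  have hmix : ∀ x : ℝ, ENNReal.ofReal ((1 + x ^ 2 / ν) ^ (-a) * Real.Gamma a) =
      ∫⁻ s in Set.Ioi 0, ENNReal.ofReal (s ^ (a - 1) * Real.exp (-((1 + x ^ 2 / ν) * s))) :=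
    fun x => (lintegral_rpow_mul_exp_neg_mul_Ioi (by linarith) (by positivity)).symm
  simp_rw [hmix]
  rw [lintegral_lintegral_swap (by fun_prop), setLIntegral_congr_fun measurableSet_Ioi hgauss,
    lintegral_const_mul _ (by fun_prop), lintegral_rpow_mul_exp_neg_mul_Ioi (by linarith) one_pos,
    Real.one_rpow, one_mul, ← ENNReal.ofReal_mul (by positivity)]

/-- Normalising constant of Student's density. -/
noncomputable def studentConst (ν : ℝ) : ℝ :=
  Real.Gamma ((ν + 1) / 2) / (√(ν * Real.pi) * Real.Gamma (ν / 2))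

section Student

variable {ν : ℝ}

theorem studentConst_pos (hν : 0 < ν) : 0 < studentConst ν := by
  have := Real.Gamma_pos_of_pos (show 0 < (ν + 1) / 2 by positivity)
  have := Real.Gamma_pos_of_pos (show 0 < ν / 2 by positivity)
  unfold studentConst
  positivity

theorem studentConst_sq_le (hν : 0 < ν) : studentConst ν ^ 2 ≤ 1 / (2 * Real.pi) := by
  have := Real.Gamma_pos_of_pos (half_pos hν)
  have hratio := Gamma_add_half_sq_le (half_pos hν)
  rw [show ν / 2 + 1 / 2 = (ν + 1) / 2 by ring] at hratio
  unfold studentConst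
  rw [div_pow, mul_pow, Real.sq_sqrt (by positivity),
    div_le_div_iff₀ (by positivity) (by positivity)]
  nlinarith [Real.pi_pos]

theorem le_studentConst_sq (hν : 1 < ν) :
    (1 - 1 / ν) * (1 / (2 * Real.pi)) ≤ studentConst ν ^ 2 := by
  have := Real.Gamma_pos_of_pos (show 0 < ν / 2 by linarith)
  have := Real.Gamma_pos_of_pos (show 0 < (ν - 1) / 2 by linarith)
  have hratio := Gamma_add_half_sq_le (show 0 < (ν - 1) / 2 by linarith)
  rw [show (ν - 1) / 2 + 1 / 2 = ν / 2 by ring] at hratio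
  have hrec : Real.Gamma ((ν + 1) / 2) = (ν - 1) / 2 * Real.Gamma ((ν - 1) / 2) := by
    rw [← Real.Gamma_add_one (by linarith : (ν - 1) / 2 ≠ 0)]
    ring_nf
  have hmul : ((ν - 1) * Real.Gamma (ν / 2) ^ 2) * (ν * Real.pi) ≤
      ((ν - 1) * ((ν - 1) / 2 * Real.Gamma ((ν - 1) / 2) ^ 2)) * (ν * Real.pi) := by
    gcongr
  have := Real.pi_pos
  unfold studentConst
  rw [hrec, div_pow, mul_pow (√_), Real.sq_sqrt (by positivity), one_sub_div (by positivity),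
    div_mul_div_comm, div_le_div_iff₀ (by positivity) (by positivity)]
  linarith

theorem studentConst_le_half (hν : 0 < ν) : studentConst ν ≤ 1 / 2 := by
  refine (abs_le_of_sq_le_sq' ((studentConst_sq_le hν).trans ?_) (by norm_num)).2
  rw [div_le_iff₀ (by positivity)]
  linarith [Real.pi_gt_three]

theorem studentTPDF_eq (ν x : ℝ) :
    studentTPDF ν x = studentConst ν * (1 + x ^ 2 / ν) ^ (-((ν + 1) / 2)) := rfl

theorem studentTPDF_pos (hν : 0 < ν) (x : ℝ) : 0 < studentTPDF ν x := by
  rw [studentTPDF_eq]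
  have := studentConst_pos hν
  positivity

theorem measurable_studentTPDF (ν : ℝ) : Measurable (studentTPDF ν) := by
  unfold studentTPDF
  fun_prop

theorem lintegral_studentTPDF (hν : 0 < ν) : ∫⁻ x, ENNReal.ofReal (studentTPDF ν x) = 1 := by
  have := Real.Gamma_pos_of_pos (show 0 < (ν + 1) / 2 by positivity)
  have := Real.Gamma_pos_of_pos (show 0 < ν / 2 by positivity)
  have hsplit : ∀ x, studentTPDF ν x = (√(ν * Real.pi) * Real.Gamma (ν / 2))⁻¹ *
      ((1 + x ^ 2 / ν) ^ (-((ν + 1) / 2)) * Real.Gamma ((ν + 1) / 2)) := fun x => by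
    unfold studentTPDF
    ring
  simp_rw [hsplit, ENNReal.ofReal_mul
    (show 0 ≤ (√(ν * Real.pi) * Real.Gamma (ν / 2))⁻¹ by positivity)]
  rw [lintegral_const_mul _ (by fun_prop), lintegral_one_add_sq_div_rpow hν (by linarith),
    ← ENNReal.ofReal_mul (by positivity), show (ν + 1) / 2 - 1 / 2 = ν / 2 by ring,
    inv_mul_cancel₀ (by positivity), ENNReal.ofReal_one]

theorem integrable_studentTPDF (hν : 0 < ν) : Integrable (studentTPDF ν) := by
  refine ⟨(measurable_studentTPDF ν).aestronglyMeasurable, ?_⟩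
  rw [hasFiniteIntegral_iff_ofReal (ae_of_all _ fun x => (studentTPDF_pos hν x).le),
    lintegral_studentTPDF hν]
  exact ENNReal.one_lt_top

theorem integral_studentTPDF (hν : 0 < ν) : ∫ x, studentTPDF ν x = 1 := by
  rw [integral_eq_lintegral_of_nonneg_ae (ae_of_all _ fun x => (studentTPDF_pos hν x).le)
    (measurable_studentTPDF ν).aestronglyMeasurable, lintegral_studentTPDF hν, ENNReal.toReal_one]

/-- Two-sided tail of Student's `t` distribution; the p-value of a statistic `T` is
`studentTail ν |T|`. -/
noncomputable def studentTail (ν t : ℝ) : ℝ := 2 - 2 * studentTCDF ν t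

theorem studentTail_eq (hν : 0 < ν) (t : ℝ) :
    studentTail ν t = 2 * ∫ x in Set.Ioi t, studentTPDF ν x := by
  have htotal := integral_add_compl (measurableSet_Iic (a := t)) (integrable_studentTPDF hν)
  rw [integral_studentTPDF hν, Set.compl_Iic] at htotal
  rw [studentTail, studentTCDF]
  linarith

theorem studentTail_zero (hν : 0 < ν) : studentTail ν 0 = 1 := by
  have htotal := integral_add_compl (measurableSet_Iic (a := (0 : ℝ))) (integrable_studentTPDF hν)
  have hreflect := integral_comp_neg_Iic (0 : ℝ) (studentTPDF ν)
  have heven : ∀ x, studentTPDF ν (-x) = studentTPDF ν x := fun x => by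
    simp only [studentTPDF, neg_sq]
  simp_rw [heven, neg_zero] at hreflect
  rw [integral_studentTPDF hν, Set.compl_Iic, ← hreflect] at htotal
  rw [studentTail, studentTCDF]
  linarith

theorem studentTail_strictAnti (hν : 0 < ν) : StrictAnti (studentTail ν) := by
  intro s t hst
  have hint := integrable_studentTPDF hν
  have hsupp : Function.support (studentTPDF ν) = Set.univ :=
    Set.eq_univ_of_forall fun y => (studentTPDF_pos hν y).ne'
  have hsplit : ∫ x in Set.Ioi s, studentTPDF ν x =
      (∫ x in Set.Ioc s t, studentTPDF ν x) + ∫ x in Set.Ioi t, studentTPDF ν x := by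
    rw [← setIntegral_union (Set.Ioc_disjoint_Ioi le_rfl) measurableSet_Ioi
      hint.integrableOn hint.integrableOn, Set.Ioc_union_Ioi_eq_Ioi hst.le]
  have hpos : 0 < ∫ x in Set.Ioc s t, studentTPDF ν x := by
    rw [setIntegral_pos_iff_support_of_nonneg_ae
      (ae_of_all _ fun y => (studentTPDF_pos hν y).le) hint.integrableOn, hsupp]
    simpa using hst
  rw [studentTail_eq hν, studentTail_eq hν]
  linarith

theorem continuous_studentTail (hν : 0 < ν) : Continuous (studentTail ν) := by
  have hint := integrable_studentTPDF hν
  have hprim : studentTail ν =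
      fun t => 2 - 2 * (studentTCDF ν 0 + ∫ x in (0 : ℝ)..t, studentTPDF ν x) := by
    ext t
    rw [← intervalIntegral.integral_Iic_sub_Iic hint.integrableOn hint.integrableOn, studentTail,
      studentTCDF, studentTCDF]
    ring
  have := intervalIntegral.continuous_primitive (fun a b => hint.intervalIntegrable) 0
    (f := studentTPDF ν) (μ := volume)
  rw [hprim]
  fun_prop

theorem hasDerivAt_one_add_sq_div_rpow (hν : 1 < ν) (x : ℝ) :
    HasDerivAt (fun x : ℝ => -(ν / (ν - 1)) * (1 + x ^ 2 / ν) ^ (-((ν - 1) / 2)))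
      (x * (1 + x ^ 2 / ν) ^ (-((ν + 1) / 2))) x := by
  have hbase : HasDerivAt (fun x : ℝ => 1 + x ^ 2 / ν) (2 * x / ν) x := by
    simpa using ((hasDerivAt_pow 2 x).div_const ν).const_add 1
  have hpow := (hbase.rpow_const (p := -((ν - 1) / 2))
    (Or.inl (by positivity : 0 < 1 + x ^ 2 / ν).ne')).const_mul (-(ν / (ν - 1)))
  refine hpow.congr_deriv ?_
  rw [show -((ν - 1) / 2) - 1 = -((ν + 1) / 2) by ring]
  have : ν - 1 ≠ 0 := by linarith
  field_simp

theorem tendsto_one_add_sq_div_rpow (hν : 1 < ν) :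
    Tendsto (fun x : ℝ => -(ν / (ν - 1)) * (1 + x ^ 2 / ν) ^ (-((ν - 1) / 2))) atTop (𝓝 0) := by
  have hbase : Tendsto (fun x : ℝ => 1 + x ^ 2 / ν) atTop atTop :=
    tendsto_atTop_add_const_left _ _
      ((tendsto_pow_atTop two_ne_zero).atTop_div_const (by linarith))
  simpa [Function.comp_def] using
    ((tendsto_rpow_neg_atTop (show 0 < (ν - 1) / 2 by linarith)).comp hbase).const_mul
      (-(ν / (ν - 1)))

-- On `(t, ∞)` the density is at most `x / t` times itself, which has an explicit primitive.
theorem studentTail_le_rpow (hν : 1 < ν) {t : ℝ} (ht : 0 < t) :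
    studentTail ν t ≤
      2 * (studentConst ν / t * (ν / (ν - 1) * (1 + t ^ 2 / ν) ^ (-((ν - 1) / 2)))) := by
  have hν0 : 0 < ν := by linarith
  have := studentConst_pos hν0
  have hnonneg : ∀ x ∈ Set.Ioi t, 0 ≤ x * (1 + x ^ 2 / ν) ^ (-((ν + 1) / 2)) := fun x hx => by
    have : 0 < x := ht.trans hx
    positivity
  have hint := integrableOn_Ioi_deriv_of_nonneg'
    (fun x _ => hasDerivAt_one_add_sq_div_rpow hν x) hnonneg (tendsto_one_add_sq_div_rpow hν)
  have hval := integral_Ioi_of_hasDerivAt_of_nonneg'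
    (fun x _ => hasDerivAt_one_add_sq_div_rpow hν x) hnonneg (tendsto_one_add_sq_div_rpow hν)
  have hmono : ∫ x in Set.Ioi t, studentTPDF ν x ≤
      ∫ x in Set.Ioi t, studentConst ν / t * (x * (1 + x ^ 2 / ν) ^ (-((ν + 1) / 2))) := by
    refine setIntegral_mono_on (integrable_studentTPDF hν0).integrableOn (hint.const_mul _)
      measurableSet_Ioi fun x (hx : t < x) => ?_
    calc studentTPDF ν x ≤ studentTPDF ν x * (x / t) :=
          le_mul_of_one_le_right (studentTPDF_pos hν0 x).le ((one_le_div ht).2 hx.le)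
      _ = _ := by rw [studentTPDF_eq]; ring
  rw [integral_const_mul, hval, zero_sub, neg_mul, neg_neg] at hmono
  rw [studentTail_eq hν0]
  gcongr

theorem sub_sq_div_two_le_log_one_add {y : ℝ} (hy : 0 ≤ y) : y - y ^ 2 / 2 ≤ Real.log (1 + y) := by
  refine le_trans ?_ (Real.le_log_one_add_of_nonneg hy)
  rw [le_div_iff₀ (by positivity)]
  nlinarith [pow_nonneg hy 3]

theorem one_add_sq_div_rpow_le_exp (hν : 1 ≤ ν) (t : ℝ) :
    (1 + t ^ 2 / ν) ^ (-((ν - 1) / 2)) ≤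
      Real.exp (-t ^ 2 / 2 + t ^ 2 / (2 * ν) + t ^ 4 / (4 * ν)) := by
  set y := t ^ 2 / ν with hy
  have hy0 : 0 ≤ y := by positivity
  have hlog : (ν - 1) / 2 * (y - y ^ 2 / 2) ≤ (ν - 1) / 2 * Real.log (1 + y) :=
    mul_le_mul_of_nonneg_left (sub_sq_div_two_le_log_one_add hy0) (by linarith)
  have hexponent : -t ^ 2 / 2 + t ^ 2 / (2 * ν) + t ^ 4 / (4 * ν) =
      -((ν - 1) / 2 * (y - y ^ 2 / 2)) + y ^ 2 / 4 := by
    rw [hy]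
    field_simp
    ring
  rw [Real.rpow_def_of_pos (by positivity), Real.exp_le_exp, hexponent]
  nlinarith [sq_nonneg y]

theorem studentTail_le (hν : 2 ≤ ν) {t : ℝ} (ht : 0 < t) :
    studentTail ν t ≤ 2 / t * Real.exp (-t ^ 2 / 2 + t ^ 2 / (2 * ν) + t ^ 4 / (4 * ν)) := by
  have hν1 : 0 < ν - 1 := by linarith
  have hratio : ν / (ν - 1) ≤ 2 := by
    rw [div_le_iff₀ hν1]
    linarith
  calc studentTail ν t ≤
        2 * (studentConst ν / t * (ν / (ν - 1) * (1 + t ^ 2 / ν) ^ (-((ν - 1) / 2)))) :=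
        studentTail_le_rpow (by linarith) ht
    _ ≤ 2 * (1 / 2 / t *
          (2 * Real.exp (-t ^ 2 / 2 + t ^ 2 / (2 * ν) + t ^ 4 / (4 * ν)))) := by
        gcongr
        · exact studentConst_le_half (by linarith)
        · exact one_add_sq_div_rpow_le_exp (by linarith) t
    _ = _ := by ring

theorem exp_le_one_add_sq_div_rpow (hν : 0 < ν) (x : ℝ) :
    Real.exp (-(√(1 + 1 / ν) * x) ^ 2 / 2) ≤ (1 + x ^ 2 / ν) ^ (-((ν + 1) / 2)) := by
  have hbase : 0 < 1 + x ^ 2 / ν := by positivity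
  have hlog : Real.log (1 + x ^ 2 / ν) * ((ν + 1) / 2) ≤ (x ^ 2 / ν) * ((ν + 1) / 2) := by
    gcongr
    linarith [Real.log_le_sub_one_of_pos hbase]
  have hexponent : (x ^ 2 / ν) * ((ν + 1) / 2) = (1 + 1 / ν) * x ^ 2 / 2 := by field_simp
  rw [Real.rpow_def_of_pos hbase, Real.exp_le_exp, mul_pow, Real.sq_sqrt (by positivity)]
  linarith

theorem gaussianPDFReal_le_studentTPDF (hν : 1 < ν) (x : ℝ) :
    (1 - 1 / ν) * gaussianPDFReal 0 1 (√(1 + 1 / ν) * x) ≤ studentTPDF ν x := by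
  have hν0 : 0 < ν := by linarith
  have hinv : 1 / ν ≤ 1 := (div_le_one hν0).2 hν.le
  have hinv0 : 0 < 1 / ν := by positivity
  have hconst : (1 - 1 / ν) * (√(2 * Real.pi))⁻¹ ≤ studentConst ν := by
    refine (abs_le_of_sq_le_sq' (le_trans ?_ (le_studentConst_sq hν)) (studentConst_pos hν0).le).2
    rw [mul_pow, inv_pow, Real.sq_sqrt (by positivity), one_div (2 * Real.pi)]
    gcongr
    nlinarith
  have := studentConst_pos hν0
  rw [gaussianPDFReal_std, ← mul_assoc, studentTPDF_eq]
  gcongr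
  exact exp_le_one_add_sq_div_rpow hν0 x

theorem gaussTail_le_studentTail (hν : 1 < ν) (t : ℝ) :
    (1 - 1 / ν) * (2 * gaussTail (√(1 + 1 / ν) * t)) ≤ √(1 + 1 / ν) * studentTail ν t := by
  have hν0 : 0 < ν := by linarith
  have hκ : 0 < √(1 + 1 / ν) := by positivity
  have hint := (integrable_gaussianPDFReal 0 1).comp_mul_left' hκ.ne'
  have hchange := integral_comp_mul_left_Ioi (gaussianPDFReal 0 1) t hκ
  have hmono : ∫ x in Set.Ioi t, (1 - 1 / ν) * gaussianPDFReal 0 1 (√(1 + 1 / ν) * x) ≤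
      ∫ x in Set.Ioi t, studentTPDF ν x :=
    setIntegral_mono (hint.const_mul _).integrableOn (integrable_studentTPDF hν0).integrableOn
      (gaussianPDFReal_le_studentTPDF hν)
  rw [integral_const_mul, hchange, smul_eq_mul, ← gaussTail] at hmono
  rw [studentTail_eq hν0]
  calc (1 - 1 / ν) * (2 * gaussTail (√(1 + 1 / ν) * t))
      = √(1 + 1 / ν) * (2 *
          ((1 - 1 / ν) * ((√(1 + 1 / ν))⁻¹ * gaussTail (√(1 + 1 / ν) * t)))) := by
        field_simp
    _ ≤ _ := by gcongr

theorem gaussTail_le_gaussTail_sqrt_mul {t η : ℝ} (hν : 1 ≤ ν) (ht : 0 ≤ t) (hη : η ≤ 1)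
    (htν : (1 + t) ^ 2 ≤ η * ν) :
    gaussTail t ≤ (1 + Real.exp (5 / 2) * η) * gaussTail (√(1 + 1 / ν) * t) := by
  set κ := √(1 + 1 / ν)
  have hinv : 0 < 1 / ν := by positivity
  have hinv1 : 1 / ν ≤ 1 := (div_le_one (by positivity)).2 hν
  have hκsq : κ ^ 2 = 1 + 1 / ν := Real.sq_sqrt (by positivity)
  have hκ0 : 0 ≤ κ := Real.sqrt_nonneg _
  have hκ1 : 1 ≤ κ := by nlinarith
  have hκ : κ - 1 ≤ 1 / ν / 2 := by nlinarith
  have hshift : (κ * t - t) * (1 + κ * t) ≤ η := by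
    calc (κ * t - t) * (1 + κ * t) = ((κ - 1) * t) * (1 + κ * t) := by ring
      _ ≤ (1 / ν / 2 * t) * (2 * (1 + t)) := by gcongr; nlinarith
      _ = (t * (1 + t)) / ν := by field_simp
      _ ≤ (1 + t) ^ 2 / ν := by gcongr; nlinarith
      _ ≤ η := by rwa [div_le_iff₀ (by positivity)]
  simpa using
    gaussTail_sub_le (x := κ * t) (d := κ * t - t) (by positivity) hη (by nlinarith) hshift

theorem exists_gaussTail_le_studentTail {ε : ℝ} (hε : 0 < ε) :
    ∃ δ > 0, ∀ ν t : ℝ, 2 ≤ ν → 0 ≤ t → (1 + t) ^ 2 ≤ δ * ν →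
      2 * gaussTail t ≤ (1 + ε) * studentTail ν t := by
  obtain ⟨η, ⟨hη0, hη1⟩, hη⟩ : ∃ η ∈ Set.Ioc (0 : ℝ) (1 / 2),
      (1 + Real.exp (5 / 2) * η) * (1 + η) / (1 - η) < 1 + ε := by
    have hlim : ContinuousAt (fun η : ℝ => (1 + Real.exp (5 / 2) * η) * (1 + η) / (1 - η)) 0 := by
      fun_prop (disch := norm_num)
    have hlt := (tendsto_nhdsWithin_of_tendsto_nhds (s := Set.Ioi 0) hlim.tendsto).eventually
      (Iio_mem_nhds (show _ < 1 + ε by norm_num [hε]))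
    have hmem : ∀ᶠ η : ℝ in 𝓝[>] 0, η ∈ Set.Ioc 0 (1 / 2) := Ioc_mem_nhdsGT (by norm_num)
    exact (hmem.and hlt).exists
  refine ⟨η, hη0, fun ν t hν ht htν => ?_⟩
  set κ := √(1 + 1 / ν)
  have hinv : 1 / ν ≤ η := by
    rw [div_le_iff₀ (by linarith)]
    nlinarith
  have : 0 < 1 / ν := one_div_pos.2 (by linarith)
  have hκη : κ ≤ 1 + η := Real.sqrt_le_iff.2 ⟨by positivity, by nlinarith⟩
  have hν1 : 0 < 1 - 1 / ν := by linarith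
  have hη2 : 0 < 1 - η := by linarith
  have hstudent : 0 ≤ studentTail ν t := by
    have h := gaussTail_le_studentTail (by linarith : 1 < ν) t
    have := gaussTail_pos (κ * t)
    exact nonneg_of_mul_nonneg_right (le_trans (by positivity) h) (by positivity)
  calc 2 * gaussTail t ≤ 2 * ((1 + Real.exp (5 / 2) * η) * gaussTail (κ * t)) := by
        gcongr
        exact gaussTail_le_gaussTail_sqrt_mul (by linarith) ht (by linarith) htν
    _ = (1 + Real.exp (5 / 2) * η) * ((1 - 1 / ν) * (2 * gaussTail (κ * t))) / (1 - 1 / ν) := by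
        rw [eq_div_iff hν1.ne']
        ring
    _ ≤ (1 + Real.exp (5 / 2) * η) * (κ * studentTail ν t) / (1 - 1 / ν) := by
        gcongr _ * ?_ / _
        exact gaussTail_le_studentTail (by linarith) t
    _ ≤ (1 + Real.exp (5 / 2) * η) * ((1 + η) * studentTail ν t) / (1 - η) := by gcongr
    _ = (1 + Real.exp (5 / 2) * η) * (1 + η) / (1 - η) * studentTail ν t := by ring
    _ ≤ (1 + ε) * studentTail ν t := by gcongr

end Student

/-- A standardised law on `ℝ` (mean `0`, variance `1`) with exponential tails, in the quantitative
form `∫ exp (t |x|) ≤ K`. -/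
structure IsStdSubexp (t K : ℝ) (μ : Measure ℝ) : Prop where
  t_pos : 0 < t
  prob : IsProbabilityMeasure μ
  mean : ∫ x, x ∂μ = 0
  sq : ∫ x, x ^ 2 ∂μ = 1
  integrable_exp : Integrable (fun x => Real.exp (t * |x|)) μ
  exp_le : ∫ x, Real.exp (t * |x|) ∂μ ≤ K

theorem pow_le_factorial_mul_exp {t : ℝ} (ht : 0 < t) (x : ℝ) (k : ℕ) :
    |x| ^ k ≤ k.factorial / t ^ k * Real.exp (t * |x|) := by
  have hexp := Real.pow_div_factorial_le_exp (t * |x|) (by positivity) k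
  rw [div_le_iff₀ (by positivity), mul_pow] at hexp
  rw [div_mul_eq_mul_div, le_div_iff₀ (by positivity)]
  linarith

theorem cube_mul_exp_le {t l : ℝ} (ht : 0 < t) (hl : l ≤ t / 2) (x : ℝ) :
    |x| ^ 3 * Real.exp (l * |x|) ≤ 48 / t ^ 3 * Real.exp (t * |x|) := by
  calc |x| ^ 3 * Real.exp (l * |x|) ≤
        ((3 : ℕ).factorial / (t / 2) ^ 3 * Real.exp (t / 2 * |x|)) * Real.exp (t / 2 * |x|) := by
        gcongr
        exact pow_le_factorial_mul_exp (half_pos ht) x 3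
    _ = 48 / t ^ 3 * (Real.exp (t / 2 * |x|) * Real.exp (t / 2 * |x|)) := by
        norm_num [Nat.factorial]
        field_simp
        norm_num
    _ = 48 / t ^ 3 * Real.exp (t * |x|) := by
        rw [← Real.exp_add]
        ring_nf

theorem exp_le_taylor_two (y : ℝ) :
    Real.exp y ≤ 1 + y + y ^ 2 / 2 + |y| ^ 3 * Real.exp |y| := by
  have hbound := Complex.norm_exp_sub_sum_le_norm_mul_exp (y : ℂ) 3
  have hreal : Complex.exp y - ∑ m ∈ Finset.range 3, (y : ℂ) ^ m / m.factorial =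
      ((Real.exp y - (1 + y + y ^ 2 / 2) : ℝ) : ℂ) := by
    simp [Finset.sum_range_succ, Nat.factorial]
  rw [hreal, Complex.norm_real, Complex.norm_real, Real.norm_eq_abs, Real.norm_eq_abs] at hbound
  linarith [le_abs_self (Real.exp y - (1 + y + y ^ 2 / 2))]

theorem exp_neg_le_quadratic {y : ℝ} (hy : 0 ≤ y) : Real.exp (-y) ≤ 1 - y + y ^ 2 / 2 := by
  have hpos : 0 < 1 - y + y ^ 2 / 2 := by nlinarith [sq_nonneg (y - 1)]
  rw [Real.exp_neg, inv_le_comm₀ (Real.exp_pos _) hpos]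
  refine le_trans ?_ (Real.quadratic_le_exp_of_nonneg hy)
  rw [inv_le_iff_one_le_mul₀ hpos]
  nlinarith [pow_nonneg hy 4]

namespace IsStdSubexp

variable {t K : ℝ} {μ : Measure ℝ}

theorem K_pos (h : IsStdSubexp t K μ) : 0 < K := by
  have := h.prob
  exact (integral_exp_pos h.integrable_exp).trans_le h.exp_le

theorem mono {K' : ℝ} (h : IsStdSubexp t K μ) (hK : K ≤ K') : IsStdSubexp t K' μ :=
  { h with exp_le := h.exp_le.trans hK }

theorem neg (h : IsStdSubexp t K μ) : IsStdSubexp t K (μ.map fun x => -x) where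
  t_pos := h.t_pos
  prob := have := h.prob; Measure.isProbabilityMeasure_map (by fun_prop)
  mean := by rw [integral_map (by fun_prop) (by fun_prop), integral_neg, h.mean, neg_zero]
  sq := by
    rw [integral_map (by fun_prop) (by fun_prop)]
    simpa only [neg_sq] using h.sq
  integrable_exp := by
    rw [integrable_map_measure (by fun_prop) (by fun_prop)]
    simpa only [Function.comp_def, abs_neg] using h.integrable_exp
  exp_le := by
    rw [integral_map (by fun_prop) (by fun_prop)]
    simpa only [abs_neg] using h.exp_le

theorem integrable_of_le (h : IsStdSubexp t K μ) {f : ℝ → ℝ} (hf : Measurable f) {c : ℝ}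
    (hle : ∀ x, |f x| ≤ c * Real.exp (t * |x|)) : Integrable f μ :=
  (h.integrable_exp.const_mul c).mono' hf.aestronglyMeasurable (ae_of_all _ hle)

theorem integral_le_of_le (h : IsStdSubexp t K μ) {f : ℝ → ℝ} (hf : Measurable f) {c : ℝ}
    (hf0 : ∀ x, 0 ≤ f x) (hle : ∀ x, f x ≤ c * Real.exp (t * |x|)) : ∫ x, f x ∂μ ≤ c * K := by
  have hint : Integrable f μ := h.integrable_of_le hf fun x => by
    rw [abs_of_nonneg (hf0 x)]
    exact hle x
  have hc : 0 ≤ c := nonneg_of_mul_nonneg_left ((hf0 0).trans (hle 0)) (Real.exp_pos _)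
  calc ∫ x, f x ∂μ ≤ ∫ x, c * Real.exp (t * |x|) ∂μ :=
        integral_mono hint (h.integrable_exp.const_mul c) hle
    _ ≤ c * K := by
        rw [integral_const_mul]
        exact mul_le_mul_of_nonneg_left h.exp_le hc

theorem integrable_pow (h : IsStdSubexp t K μ) (k : ℕ) : Integrable (fun x => x ^ k) μ :=
  h.integrable_of_le (by fun_prop) fun x => by
    rw [abs_pow]
    exact pow_le_factorial_mul_exp h.t_pos x k

theorem integral_pow_four_le (h : IsStdSubexp t K μ) : ∫ x, x ^ 4 ∂μ ≤ 24 / t ^ 4 * K :=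
  h.integral_le_of_le (by fun_prop) (fun x => by positivity) fun x => by
    have hpow := pow_le_factorial_mul_exp h.t_pos x 4
    rwa [(by decide : Even 4).pow_abs, (by decide : Nat.factorial 4 = 24), Nat.cast_ofNat] at hpow

theorem integrable_cube_mul_exp (h : IsStdSubexp t K μ) {l : ℝ} (hl : l ≤ t / 2) :
    Integrable (fun x => |x| ^ 3 * Real.exp (l * |x|)) μ :=
  h.integrable_of_le (by fun_prop) fun x => by
    rw [abs_of_nonneg (by positivity)]
    exact cube_mul_exp_le h.t_pos hl x

theorem integral_cube_mul_exp_le (h : IsStdSubexp t K μ) {l : ℝ} (hl : l ≤ t / 2) :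
    ∫ x, |x| ^ 3 * Real.exp (l * |x|) ∂μ ≤ 48 / t ^ 3 * K :=
  h.integral_le_of_le (by fun_prop) (fun x => by positivity) (cube_mul_exp_le h.t_pos hl)

theorem integrable_exp_mul (h : IsStdSubexp t K μ) {l : ℝ} (hl : |l| ≤ t) :
    Integrable (fun x => Real.exp (l * x)) μ :=
  h.integrable_of_le (by fun_prop) (c := 1) fun x => by
    rw [abs_of_pos (Real.exp_pos _), one_mul, Real.exp_le_exp]
    calc l * x ≤ |l| * |x| := by rw [← abs_mul]; exact le_abs_self _
      _ ≤ t * |x| := by gcongr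

theorem integrable_quadratic (h : IsStdSubexp t K μ) (c₀ c₁ c₂ : ℝ) :
    Integrable (fun x => c₀ + c₁ * x + c₂ * x ^ 2) μ := by
  have := h.prob
  have hid : Integrable (fun x => x) μ := by simpa using h.integrable_pow 1
  exact ((integrable_const _).add (hid.const_mul _)).add ((h.integrable_pow 2).const_mul _)

theorem integral_quadratic (h : IsStdSubexp t K μ) (c₀ c₁ c₂ : ℝ) :
    ∫ x, (c₀ + c₁ * x + c₂ * x ^ 2) ∂μ = c₀ + c₂ := by
  have := h.prob
  have hid : Integrable (fun x => x) μ := by simpa using h.integrable_pow 1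
  have haffine : Integrable (fun x => c₀ + c₁ * x) μ := (integrable_const _).add (hid.const_mul _)
  rw [integral_add haffine ((h.integrable_pow 2).const_mul _),
    integral_add (integrable_const _) (hid.const_mul _), integral_const_mul, integral_const_mul,
    h.mean, h.sq]
  simp

theorem integral_exp_mul_le (h : IsStdSubexp t K μ) {l : ℝ} (hl : |l| ≤ t / 2) :
    ∫ x, Real.exp (l * x) ∂μ ≤ Real.exp (l ^ 2 / 2 + 48 / t ^ 3 * K * |l| ^ 3) := by
  have hquad := h.integrable_quadratic 1 l (l ^ 2 / 2)
  have hcube := (h.integrable_cube_mul_exp hl).const_mul (|l| ^ 3)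
  calc ∫ x, Real.exp (l * x) ∂μ
      ≤ ∫ x, (1 + l * x + l ^ 2 / 2 * x ^ 2 + |l| ^ 3 * (|x| ^ 3 * Real.exp (|l| * |x|))) ∂μ := by
        refine integral_mono (h.integrable_exp_mul (by linarith [h.t_pos])) (hquad.add hcube)
          fun x => (exp_le_taylor_two (l * x)).trans_eq ?_
        rw [abs_mul]
        ring
    _ = 1 + l ^ 2 / 2 + |l| ^ 3 * ∫ x, |x| ^ 3 * Real.exp (|l| * |x|) ∂μ := by
        rw [integral_add hquad hcube, h.integral_quadratic, integral_const_mul]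
    _ ≤ 1 + l ^ 2 / 2 + |l| ^ 3 * (48 / t ^ 3 * K) := by
        gcongr
        exact h.integral_cube_mul_exp_le hl
    _ = l ^ 2 / 2 + 48 / t ^ 3 * K * |l| ^ 3 + 1 := by ring
    _ ≤ _ := Real.add_one_le_exp _

theorem integral_exp_neg_mul_sq_le (h : IsStdSubexp t K μ) {l : ℝ} (hl : 0 ≤ l) :
    ∫ x, Real.exp (-l * x ^ 2) ∂μ ≤ Real.exp (-l + l ^ 2 * (24 / t ^ 4 * K) / 2) := by
  have hquad := h.integrable_quadratic 1 0 (-l)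
  have hfour := (h.integrable_pow 4).const_mul (l ^ 2 / 2)
  calc ∫ x, Real.exp (-l * x ^ 2) ∂μ
      ≤ ∫ x, (1 + 0 * x + -l * x ^ 2 + l ^ 2 / 2 * x ^ 4) ∂μ := by
        refine integral_mono_of_nonneg (ae_of_all _ fun x => (Real.exp_pos _).le)
          (hquad.add hfour) (ae_of_all _ fun x => ?_)
        simp only [neg_mul]
        refine (exp_neg_le_quadratic (by positivity : 0 ≤ l * x ^ 2)).trans_eq ?_
        ring
    _ = 1 + -l + l ^ 2 / 2 * ∫ x, x ^ 4 ∂μ := by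
        rw [integral_add hquad hfour, h.integral_quadratic, integral_const_mul]
    _ ≤ 1 + -l + l ^ 2 / 2 * (24 / t ^ 4 * K) := by
        gcongr
        exact h.integral_pow_four_le
    _ = -l + l ^ 2 * (24 / t ^ 4 * K) / 2 + 1 := by ring
    _ ≤ _ := Real.add_one_le_exp _

end IsStdSubexp

theorem integral_exp_mul_gaussianReal (v : NNReal) (l : ℝ) :
    ∫ x, Real.exp (l * x) ∂(gaussianReal 0 v) = Real.exp (l ^ 2 * v / 2) := by
  have hmgf := congrFun (mgf_id_gaussianReal (μ := 0) (v := v)) l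
  simp only [mgf, id] at hmgf
  rw [hmgf]
  ring_nf

theorem isStdSubexp_gaussianReal {t : ℝ} (ht : 0 < t) :
    IsStdSubexp t (2 * Real.exp (t ^ 2 / 2)) (gaussianReal 0 1) := by
  have hle : ∀ x : ℝ, Real.exp (t * |x|) ≤ Real.exp (t * x) + Real.exp (-t * x) := fun x => by
    simpa only [abs_mul, abs_of_pos ht, neg_mul] using Real.exp_abs_le (t * x)
  have hplus : Integrable (fun x => Real.exp (t * x)) (gaussianReal 0 1) :=
    integrable_exp_mul_gaussianReal t
  have hminus : Integrable (fun x => Real.exp (-t * x)) (gaussianReal 0 1) :=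
    integrable_exp_mul_gaussianReal (-t)
  have hint : Integrable (fun x : ℝ => Real.exp (t * |x|)) (gaussianReal 0 1) :=
    (hplus.add hminus).mono' (by fun_prop) (ae_of_all _ fun x => by
      rw [Real.norm_eq_abs, Real.abs_exp]
      exact hle x)
  refine ⟨ht, inferInstance, integral_id_gaussianReal, ?_, hint, ?_⟩
  · have hvar := variance_fun_id_gaussianReal (μ := 0) (v := 1)
    rw [variance_of_integral_eq_zero (by fun_prop) integral_id_gaussianReal] at hvar
    simpa using hvar
  · refine (integral_mono hint (hplus.add hminus) hle).trans_eq ?_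
    simp only [Pi.add_apply]
    rw [integral_add hplus hminus, integral_exp_mul_gaussianReal, integral_exp_mul_gaussianReal]
    simp only [even_two.neg_pow, NNReal.coe_one, mul_one]
    ring

section Concentration

variable {Ω ι : Type*} [MeasurableSpace Ω] {P : Measure Ω} {t K : ℝ}

namespace IsStdSubexp

variable {Z : Ω → ℝ}

theorem memLp_comp_pow (h : IsStdSubexp t K (P.map Z)) (hZ : Measurable Z) (k : ℕ) :
    MemLp (fun ω => Z ω ^ k) 2 P := by
  rw [memLp_two_iff_integrable_sq (by fun_prop)]
  simpa only [Function.comp_def, pow_mul] using (h.integrable_pow (k * 2)).comp_measurable hZ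

theorem integral_comp (h : IsStdSubexp t K (P.map Z)) (hZ : Measurable Z) : ∫ ω, Z ω ∂P = 0 := by
  rw [← h.mean, integral_map hZ.aemeasurable (by fun_prop)]

theorem integral_comp_sq (h : IsStdSubexp t K (P.map Z)) (hZ : Measurable Z) :
    ∫ ω, Z ω ^ 2 ∂P = 1 := by
  rw [← h.sq, integral_map hZ.aemeasurable (by fun_prop)]

theorem variance_comp (h : IsStdSubexp t K (P.map Z)) (hZ : Measurable Z) : variance Z P = 1 := by
  rw [variance_of_integral_eq_zero hZ.aemeasurable (h.integral_comp hZ), h.integral_comp_sq hZ]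

theorem variance_comp_sq_le [IsProbabilityMeasure P] (h : IsStdSubexp t K (P.map Z))
    (hZ : Measurable Z) : variance (fun ω => Z ω ^ 2) P ≤ 24 / t ^ 4 * K := by
  refine (variance_le_expectation_sq (by fun_prop)).trans ?_
  have hfour := h.integral_pow_four_le
  rw [integral_map hZ.aemeasurable (by fun_prop)] at hfour
  simpa only [Pi.pow_apply, ← pow_mul] using hfour

end IsStdSubexp

theorem chebyshev_weighted_sum [IsProbabilityMeasure P] [Fintype ι] {W : ι → Ω → ℝ}
    (hW : ∀ q, MemLp (W q) 2 P) (hind : iIndepFun W P) {μ M : ℝ} (hμ : ∀ q, ∫ ω, W q ω ∂P = μ)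
    (hM : ∀ q, variance (W q) P ≤ M) (a : ι → ℝ) {r : ℝ} (hr : 0 < r) :
    P.real {ω | r ≤ |∑ q, a q * W q ω - μ * ∑ q, a q|} ≤ M * (∑ q, a q ^ 2) / r ^ 2 := by
  have hmemLp : ∀ q, MemLp (fun ω => a q * W q ω) 2 P := fun q => (hW q).const_mul _
  have hind' : iIndepFun (fun q ω => a q * W q ω) P :=
    hind.comp (fun q x => a q * x) (fun _ => by fun_prop)
  have hmean : ∫ ω, (∑ q, fun ω => a q * W q ω) ω ∂P = μ * ∑ q, a q := by
    simp only [Finset.sum_apply]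
    rw [integral_finsetSum _ fun q _ => (hmemLp q).integrable one_le_two]
    simp_rw [integral_const_mul, hμ, Finset.mul_sum, mul_comm]
  have hvar : variance (∑ q, fun ω => a q * W q ω) P ≤ M * ∑ q, a q ^ 2 := by
    rw [IndepFun.variance_sum (fun q _ => hmemLp q) (fun i _ j _ hij => hind'.indepFun hij),
      Finset.mul_sum]
    refine Finset.sum_le_sum fun q _ => ?_
    rw [variance_const_mul, mul_comm]
    gcongr
    exact hM q
  have hchebyshev :=
    meas_ge_le_variance_div_sq (memLp_finsetSum' Finset.univ fun q _ => hmemLp q) hr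
  rw [hmean] at hchebyshev
  simp only [Finset.sum_apply] at hchebyshev
  have hvar0 : 0 ≤ M * ∑ q, a q ^ 2 := (variance_nonneg _ _).trans hvar
  exact ENNReal.toReal_le_of_le_ofReal (by positivity)
    (hchebyshev.trans (ENNReal.ofReal_le_ofReal (by gcongr)))

theorem mgf_sum_le_pow [Fintype ι] {Y : ι → Ω → ℝ} (hY : ∀ q, Measurable (Y q))
    (hind : iIndepFun Y P) {l M : ℝ} (hM : ∀ q, mgf (Y q) P l ≤ M) :
    mgf (∑ q, Y q) P l ≤ M ^ Fintype.card ι := by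
  rw [hind.mgf_sum hY]
  exact (Finset.prod_le_prod (fun q _ => mgf_nonneg) fun q _ => hM q).trans_eq (by simp)

-- Chernoff's bound with the parameter `l = ε / M`, where `M` bounds the fourth moments.
theorem sum_sq_lower_tail [IsProbabilityMeasure P] [Fintype ι] {Z : ι → Ω → ℝ}
    (hZ : ∀ q, Measurable (Z q)) (hind : iIndepFun Z P)
    (hlaw : ∀ q, IsStdSubexp t K (P.map (Z q))) (ht : 0 < t) (hK : 0 < K) {ε : ℝ} (hε : 0 ≤ ε) :
    P.real {ω | ∑ q, Z q ω ^ 2 ≤ Fintype.card ι * (1 - ε)} ≤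
      Real.exp (-(Fintype.card ι * ε ^ 2 * t ^ 4 / (48 * K))) := by
  set M := 24 / t ^ 4 * K with hM
  set l := ε / M with hl
  have hl0 : 0 ≤ l := by positivity
  have hmgf : ∀ q, mgf (fun ω => Z q ω ^ 2) P (-l) ≤ Real.exp (-l + l ^ 2 * M / 2) := fun q => by
    refine le_trans (le_of_eq ?_) ((hlaw q).integral_exp_neg_mul_sq_le hl0)
    rw [integral_map (hZ q).aemeasurable (by fun_prop), mgf]
  have hsum : mgf (∑ q, fun ω => Z q ω ^ 2) P (-l) ≤
      Real.exp (-l + l ^ 2 * M / 2) ^ Fintype.card ι :=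
    mgf_sum_le_pow (fun q => by fun_prop)
      (hind.comp (fun _ x => x ^ 2) (fun _ => by fun_prop)) hmgf
  have hint : Integrable (fun ω => Real.exp (-l * (∑ q, fun ω => Z q ω ^ 2) ω)) P := by
    refine Integrable.of_bound (C := 1) (by simp only [Finset.sum_apply]; fun_prop)
      (ae_of_all _ fun ω => ?_)
    rw [Real.norm_eq_abs, Real.abs_exp, Finset.sum_apply, Real.exp_le_one_iff, neg_mul,
      neg_nonpos]
    positivity
  have hchernoff := measure_le_le_exp_mul_mgf (Fintype.card ι * (1 - ε)) (neg_nonpos.2 hl0) hint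
  simp only [Finset.sum_apply, neg_neg] at hchernoff
  calc P.real {ω | ∑ q, Z q ω ^ 2 ≤ Fintype.card ι * (1 - ε)}
      ≤ Real.exp (l * (Fintype.card ι * (1 - ε))) *
        Real.exp (-l + l ^ 2 * M / 2) ^ Fintype.card ι := hchernoff.trans (by gcongr)
    _ = _ := by
        rw [← Real.exp_nat_mul, ← Real.exp_add, hl, hM]
        congr 1
        field_simp
        ring

theorem sum_upper_tail [IsProbabilityMeasure P] [Fintype ι] {Z : ι → Ω → ℝ}
    (hZ : ∀ q, Measurable (Z q)) (hind : iIndepFun Z P)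
    (hlaw : ∀ q, IsStdSubexp t K (P.map (Z q))) {r : ℝ} (hr : 0 ≤ r)
    (hrt : r ≤ t / 2) (hrK : 48 / t ^ 3 * K * r ≤ 1 / 4) :
    P.real {ω | Fintype.card ι * r ≤ ∑ q, Z q ω} ≤ Real.exp (-(Fintype.card ι * r ^ 2 / 4)) := by
  have hrabs : |r| ≤ t / 2 := by rwa [abs_of_nonneg hr]
  have hmgf : ∀ q, mgf (Z q) P r ≤ Real.exp (r ^ 2 * (3 / 4)) := fun q => by
    calc mgf (Z q) P r = ∫ x, Real.exp (r * x) ∂(P.map (Z q)) := by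
          rw [integral_map (hZ q).aemeasurable (by fun_prop), mgf]
      _ ≤ _ := (hlaw q).integral_exp_mul_le hrabs
      _ ≤ _ := by
          rw [abs_of_nonneg hr, Real.exp_le_exp]
          nlinarith [sq_nonneg r]
  have hsum := mgf_sum_le_pow hZ hind hmgf
  have hint : Integrable (fun ω => Real.exp (r * (∑ q, Z q) ω)) P :=
    hind.integrable_exp_mul_sum hZ fun q _ =>
      ((hlaw q).integrable_exp_mul (by linarith [(hlaw q).t_pos])).comp_measurable (hZ q)
  have hchernoff := measure_ge_le_exp_mul_mgf (Fintype.card ι * r) hr hint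
  simp only [Finset.sum_apply] at hchernoff
  calc P.real {ω | Fintype.card ι * r ≤ ∑ q, Z q ω}
      ≤ Real.exp (-r * (Fintype.card ι * r)) *
          Real.exp (r ^ 2 * (3 / 4)) ^ Fintype.card ι := hchernoff.trans (by gcongr)
    _ = _ := by
        rw [← Real.exp_nat_mul, ← Real.exp_add]
        ring_nf

theorem abs_sum_tail [IsProbabilityMeasure P] [Fintype ι] {Z : ι → Ω → ℝ}
    (hZ : ∀ q, Measurable (Z q)) (hind : iIndepFun Z P)
    (hlaw : ∀ q, IsStdSubexp t K (P.map (Z q))) {r : ℝ} (hr : 0 ≤ r)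
    (hrt : r ≤ t / 2) (hrK : 48 / t ^ 3 * K * r ≤ 1 / 4) :
    P.real {ω | Fintype.card ι * r ≤ |∑ q, Z q ω|} ≤
      2 * Real.exp (-(Fintype.card ι * r ^ 2 / 4)) := by
  have hupper := sum_upper_tail hZ hind hlaw hr hrt hrK
  have hlower := sum_upper_tail (Z := fun q ω => -Z q ω) (fun q => (hZ q).neg)
    (hind.comp (fun _ x => -x) fun _ => measurable_neg)
    (fun q => by
      have hneg := (hlaw q).neg
      rwa [Measure.map_map measurable_neg (hZ q)] at hneg) hr hrt hrK
  have hsub : {ω | Fintype.card ι * r ≤ |∑ q, Z q ω|} ⊆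
      {ω | Fintype.card ι * r ≤ ∑ q, Z q ω} ∪ {ω | Fintype.card ι * r ≤ ∑ q, -Z q ω} := by
    intro ω hω
    simpa only [Set.mem_union, Set.mem_ofPred_eq, Finset.sum_neg_distrib] using le_abs.1 hω
  linarith [(measureReal_mono (μ := P) hsub).trans (measureReal_union_le _ _)]

end Concentration

/-- A bounded function whose second order Taylor remainder is exponentially small to the left. -/
structure TaylorBound (A l : ℝ) (g g₁ g₂ : ℝ → ℝ) : Prop where
  measurable : Measurable g
  abs_le_one : ∀ x, |g x| ≤ 1
  remainder : ∀ s y, |g (s + y) - (g s + g₁ s * y + g₂ s * (y ^ 2 / 2))| ≤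
    A * (|y| ^ 3 * Real.exp (l * (s + |y|)))

/-- The laws `ρ` and `ρ'` give nearly the same mean to every translate of the test function `g`;
the error allowed for the translate by `s` is `E * exp (l * s)`. -/
def ShiftClose (g : ℝ → ℝ) (l E : ℝ) (ρ ρ' : Measure ℝ) : Prop :=
  ∀ s, |∫ x, g (s + x) ∂ρ - ∫ x, g (s + x) ∂ρ'| ≤ E * Real.exp (l * s)

theorem integrable_comp_of_abs_le_one {α : Type*} [MeasurableSpace α] {μ : Measure α}
    [IsFiniteMeasure μ] {g : ℝ → ℝ} (hg : Measurable g) (hg1 : ∀ x, |g x| ≤ 1) {f : α → ℝ}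
    (hf : Measurable f) : Integrable (fun x => g (f x)) μ :=
  Integrable.of_bound (hg.comp hf).aestronglyMeasurable 1 (ae_of_all _ fun x => hg1 (f x))

namespace ShiftClose

variable {g : ℝ → ℝ} {l E E' : ℝ} {ρ ρ' ρ'' : Measure ℝ}

theorem mono (h : ShiftClose g l E ρ ρ') (hE : E ≤ E') : ShiftClose g l E' ρ ρ' :=
  fun s => (h s).trans (by gcongr)

theorem trans (h : ShiftClose g l E ρ ρ') (h' : ShiftClose g l E' ρ' ρ'') :
    ShiftClose g l (E + E') ρ ρ'' := fun s => by
  rw [add_mul]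
  exact (abs_sub_le _ _ _).trans (add_le_add (h s) (h' s))

theorem conv_left [IsFiniteMeasure ρ] [IsFiniteMeasure ρ'] {γ : Measure ℝ} [IsFiniteMeasure γ]
    (h : ShiftClose g l E ρ ρ') (hg : Measurable g) (hg1 : ∀ x, |g x| ≤ 1)
    (hγ : Integrable (fun y => Real.exp (l * y)) γ) :
    ShiftClose g l (E * ∫ y, Real.exp (l * y) ∂γ) (γ ∗ ρ) (γ ∗ ρ') := fun s => by
  have hint : ∀ (τ : Measure ℝ) [IsFiniteMeasure τ],
      Integrable (fun y => ∫ x, g (s + (y + x)) ∂τ) γ := fun τ _ =>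
    (integrable_comp_of_abs_le_one (f := fun p : ℝ × ℝ => s + (p.1 + p.2)) (μ := γ.prod τ) hg hg1
      (by fun_prop)).integral_prod_left
  rw [integral_conv (integrable_comp_of_abs_le_one hg hg1 (by fun_prop)),
    integral_conv (integrable_comp_of_abs_le_one hg hg1 (by fun_prop)),
    ← integral_sub (hint ρ) (hint ρ')]
  calc |∫ y, (∫ x, g (s + (y + x)) ∂ρ - ∫ x, g (s + (y + x)) ∂ρ') ∂γ|
      ≤ ∫ y, |∫ x, g (s + (y + x)) ∂ρ - ∫ x, g (s + (y + x)) ∂ρ'| ∂γ :=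
        abs_integral_le_integral_abs
    _ ≤ ∫ y, E * Real.exp (l * s) * Real.exp (l * y) ∂γ := by
        refine integral_mono ((hint ρ).sub (hint ρ')).abs (hγ.const_mul _) fun y => ?_
        simp only [← add_assoc]
        refine (h (s + y)).trans_eq ?_
        rw [mul_add, Real.exp_add, mul_assoc]
    _ = E * (∫ y, Real.exp (l * y) ∂γ) * Real.exp (l * s) := by
        rw [integral_const_mul]
        ring

end ShiftClose

namespace TaylorBound

variable {A l t K : ℝ} {g g₁ g₂ : ℝ → ℝ}

theorem A_nonneg (hg : TaylorBound A l g g₁ g₂) : 0 ≤ A := by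
  have hle := (abs_nonneg _).trans (hg.remainder 0 1)
  exact nonneg_of_mul_nonneg_left hle (by positivity)

theorem abs_integral_sub_le (hg : TaylorBound A l g g₁ g₂) {μ : Measure ℝ}
    (h : IsStdSubexp t K μ) {a : ℝ} (hl : l * |a| ≤ t / 2) (s : ℝ) :
    |(∫ x, g (s + a * x) ∂μ) - (g s + g₂ s * (a ^ 2 / 2))| ≤
      A * (48 / t ^ 3 * K) * |a| ^ 3 * Real.exp (l * s) := by
  have := h.prob
  have hA := hg.A_nonneg
  have hcube := h.integrable_cube_mul_exp hl
  have hint : Integrable (fun x => g (s + a * x)) μ :=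
    integrable_comp_of_abs_le_one hg.measurable hg.abs_le_one (by fun_prop)
  have hquad := h.integrable_quadratic (g s) (g₁ s * a) (g₂ s * (a ^ 2 / 2))
  rw [← h.integral_quadratic (g s) (g₁ s * a) (g₂ s * (a ^ 2 / 2)), ← integral_sub hint hquad]
  calc |∫ x, (g (s + a * x) - (g s + g₁ s * a * x + g₂ s * (a ^ 2 / 2) * x ^ 2)) ∂μ|
      ≤ ∫ x, |g (s + a * x) - (g s + g₁ s * a * x + g₂ s * (a ^ 2 / 2) * x ^ 2)| ∂μ :=
        abs_integral_le_integral_abs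
    _ ≤ ∫ x, A * Real.exp (l * s) * |a| ^ 3 * (|x| ^ 3 * Real.exp (l * |a| * |x|)) ∂μ := by
        refine integral_mono (hint.sub hquad).abs (hcube.const_mul _) fun x => ?_
        refine (le_of_eq ?_).trans ((hg.remainder s (a * x)).trans_eq ?_)
        · ring_nf
        · rw [abs_mul, mul_add, Real.exp_add]
          ring_nf
    _ ≤ A * Real.exp (l * s) * |a| ^ 3 * (48 / t ^ 3 * K) := by
        rw [integral_const_mul]
        gcongr
        exact h.integral_cube_mul_exp_le hl
    _ = _ := by ring

theorem shiftClose_map_mul (hg : TaylorBound A l g g₁ g₂) {μ ν : Measure ℝ}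
    (hμ : IsStdSubexp t K μ) (hν : IsStdSubexp t K ν) {a : ℝ} (hl : l * |a| ≤ t / 2) :
    ShiftClose g l (2 * A * (48 / t ^ 3 * K) * |a| ^ 3) (μ.map (a * ·)) (ν.map (a * ·)) :=
  fun s => by
  have hmap : ∀ τ : Measure ℝ, ∫ x, g (s + x) ∂(τ.map (a * ·)) = ∫ x, g (s + a * x) ∂τ :=
    fun τ => integral_map (by fun_prop) (hg.measurable.comp (by fun_prop)).aestronglyMeasurable
  rw [hmap, hmap]
  refine (abs_sub_le _ (g s + g₂ s * (a ^ 2 / 2)) _).trans ?_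
  rw [abs_sub_comm _ (∫ x, g (s + a * x) ∂ν)]
  linarith [hg.abs_integral_sub_le hμ hl s, hg.abs_integral_sub_le hν hl s]

end TaylorBound

theorem gaussianReal_map_mul_std (a : ℝ) :
    (gaussianReal 0 1).map (a * ·) = gaussianReal 0 (a ^ 2).toNNReal := by
  rw [gaussianReal_map_const_mul, mul_zero, mul_one, Real.toNNReal_of_nonneg (sq_nonneg a)]

theorem IsStdSubexp.integral_exp_mul_map_mul_le {t K : ℝ} {μ : Measure ℝ}
    (h : IsStdSubexp t K μ) {l a : ℝ} (hl : |l * a| ≤ t / 2) :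
    ∫ y, Real.exp (l * y) ∂(μ.map (a * ·)) ≤
      Real.exp (l ^ 2 * a ^ 2 / 2 + 48 / t ^ 3 * K * |l * a| ^ 3) := by
  rw [integral_map (by fun_prop) (by fun_prop), ← mul_pow]
  simpa only [mul_assoc] using h.integral_exp_mul_le hl

theorem IsStdSubexp.integrable_exp_mul_map_mul {t K : ℝ} {μ : Measure ℝ}
    (h : IsStdSubexp t K μ) {l a : ℝ} (hl : |l * a| ≤ t) :
    Integrable (fun y => Real.exp (l * y)) (μ.map (a * ·)) := by
  rw [integrable_map_measure (by fun_prop) (by fun_prop)]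
  simpa only [Function.comp_def, mul_assoc] using h.integrable_exp_mul hl

-- Two exchanges: first `ρ` for the Gaussian, then the summand with law `μ` for a Gaussian one.
theorem TaylorBound.shiftClose_conv {A l t K : ℝ} {g g₁ g₂ : ℝ → ℝ}
    (hg : TaylorBound A l g g₁ g₂) (hG : IsStdSubexp t K (gaussianReal 0 1)) {μ ρ : Measure ℝ}
    (hμ : IsStdSubexp t K μ) [IsFiniteMeasure ρ] {a : ℝ} (ha : |l * a| ≤ t / 2) {E : ℝ}
    (hE : 0 ≤ E) {W : NNReal} (hρ : ShiftClose g l E ρ (gaussianReal 0 W)) :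
    ShiftClose g l
      (E * Real.exp (l ^ 2 * a ^ 2 / 2 + 48 / t ^ 3 * K * |l * a| ^ 3) +
        2 * A * (48 / t ^ 3 * K) * |a| ^ 3 * Real.exp (l ^ 2 * W / 2))
      (μ.map (a * ·) ∗ ρ) (gaussianReal 0 ((a ^ 2).toNNReal + W)) := by
  have := hμ.prob
  have : IsProbabilityMeasure (μ.map (a * ·)) := Measure.isProbabilityMeasure_map (by fun_prop)
  have ht := hG.t_pos
  have hgauss : gaussianReal 0 ((a ^ 2).toNNReal + W) =
      gaussianReal 0 W ∗ (gaussianReal 0 1).map (a * ·) := by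
    rw [gaussianReal_map_mul_std, gaussianReal_conv_gaussianReal, add_zero, add_comm W]
  have hrest := (hρ.conv_left hg.measurable hg.abs_le_one
    (hμ.integrable_exp_mul_map_mul (a := a) (by linarith))).mono
      (mul_le_mul_of_nonneg_left (hμ.integral_exp_mul_map_mul_le ha) hE)
  have hla : l * |a| ≤ t / 2 := by
    refine le_trans ?_ ha
    rw [abs_mul]
    gcongr
    exact le_abs_self l
  have hnew := (hg.shiftClose_map_mul hμ hG hla).conv_left hg.measurable hg.abs_le_one
    (integrable_exp_mul_gaussianReal (μ := 0) (v := W) l)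
  rw [integral_exp_mul_gaussianReal, Measure.conv_comm _ (μ.map _)] at hnew
  rw [hgauss]
  exact hrest.trans hnew

theorem map_sum_insert_of_iIndepFun {Ω ι : Type*} [MeasurableSpace Ω] [DecidableEq ι]
    {P : Measure Ω} [IsProbabilityMeasure P] {Y : ι → Ω → ℝ} (hind : iIndepFun Y P)
    (hY : ∀ q, Measurable (Y q)) {F : Finset ι} {b : ι} (hb : b ∉ F) :
    P.map (∑ q ∈ insert b F, Y q) = P.map (Y b) ∗ P.map (∑ q ∈ F, Y q) := by
  rw [Finset.sum_insert hb]
  exact (hind.indepFun_finsetSum_of_notMem hY hb).symm.map_add_eq_map_conv_map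
    (by fun_prop) (by fun_prop)

theorem replacement_error_add_le {A C l σ V a : ℝ} (hA : 0 ≤ A) (hC : 0 ≤ C) (hl : 0 ≤ l)
    (hσ : 0 ≤ σ) :
    2 * A * C * σ * Real.exp (l ^ 2 * V / 2 + C * (l ^ 3 * σ)) *
        Real.exp (l ^ 2 * a ^ 2 / 2 + C * |l * a| ^ 3) +
      2 * A * C * |a| ^ 3 * Real.exp (l ^ 2 * V / 2) ≤
    2 * A * C * (|a| ^ 3 + σ) *
      Real.exp (l ^ 2 * (a ^ 2 + V) / 2 + C * (l ^ 3 * (|a| ^ 3 + σ))) := by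
  have hexp : Real.exp (l ^ 2 * V / 2) ≤
      Real.exp (l ^ 2 * (a ^ 2 + V) / 2 + C * (l ^ 3 * (|a| ^ 3 + σ))) := by
    have hcube : 0 ≤ C * (l ^ 3 * (|a| ^ 3 + σ)) := by positivity
    have hsq : 0 ≤ l ^ 2 * a ^ 2 := by positivity
    exact Real.exp_le_exp.2 (by linarith)
  calc _ = 2 * A * C * σ * Real.exp (l ^ 2 * (a ^ 2 + V) / 2 + C * (l ^ 3 * (|a| ^ 3 + σ))) +
        2 * A * C * |a| ^ 3 * Real.exp (l ^ 2 * V / 2) := by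
        rw [mul_assoc (2 * A * C * σ), ← Real.exp_add, abs_mul, abs_of_nonneg hl]
        ring_nf
    _ ≤ _ := by
        rw [mul_add (2 * A * C), add_mul, add_comm (_ * |a| ^ 3 * _)]
        gcongr

-- Lindeberg's replacement of the summands by Gaussian ones, one at a time.
theorem TaylorBound.shiftClose_map_sum {A l t K : ℝ} {g g₁ g₂ : ℝ → ℝ}
    (hg : TaylorBound A l g g₁ g₂) (hl0 : 0 ≤ l) (hG : IsStdSubexp t K (gaussianReal 0 1))
    {Ω ι : Type*} [MeasurableSpace Ω] {P : Measure Ω} [IsProbabilityMeasure P]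
    {Z : ι → Ω → ℝ} (hZ : ∀ q, Measurable (Z q)) (hind : iIndepFun Z P)
    (hlaw : ∀ q, IsStdSubexp t K (P.map (Z q))) (a : ι → ℝ) (ha : ∀ q, l * |a q| ≤ t / 2)
    (F : Finset ι) :
    ShiftClose g l
      (2 * A * (48 / t ^ 3 * K) * (∑ q ∈ F, |a q| ^ 3) *
        Real.exp (l ^ 2 * (∑ q ∈ F, a q ^ 2) / 2 + 48 / t ^ 3 * K * (l ^ 3 * ∑ q ∈ F, |a q| ^ 3)))
      (P.map (∑ q ∈ F, fun ω => a q * Z q ω))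
      (gaussianReal 0 (∑ q ∈ F, (a q ^ 2).toNNReal)) := by
  classical
  have hA := hg.A_nonneg
  have hC0 : 0 ≤ 48 / t ^ 3 * K := by have := hG.K_pos; have := hG.t_pos; positivity
  induction F using Finset.induction_on with
  | empty =>
    intro s
    simp [show P.map (0 : Ω → ℝ) = Measure.dirac 0 from (Measure.map_const P 0).trans (by simp)]
  | insert b F hb ih =>
    have hW : ((∑ q ∈ F, (a q ^ 2).toNNReal : NNReal) : ℝ) = ∑ q ∈ F, a q ^ 2 := by
      rw [NNReal.coe_sum]
      exact Finset.sum_congr rfl fun q _ => Real.coe_toNNReal _ (sq_nonneg _)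
    have hind' : iIndepFun (fun q ω => a q * Z q ω) P :=
      hind.comp (fun q x => a q * x) fun q => by fun_prop
    have hmap : P.map (fun ω => a b * Z b ω) = (P.map (Z b)).map (a b * ·) := by
      rw [Measure.map_map (by fun_prop) (hZ b)]
      rfl
    have hlab : |l * a b| ≤ t / 2 := by
      rw [abs_mul, abs_of_nonneg hl0]
      exact ha b
    rw [map_sum_insert_of_iIndepFun hind' (fun q => by fun_prop) hb, hmap]
    simp only [Finset.sum_insert hb]
    refine (hg.shiftClose_conv hG (hlaw b) hlab (by positivity) ih).mono ?_
    rw [hW]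
    exact replacement_error_add_le hA hC0 hl0 (Finset.sum_nonneg fun q _ => by positivity)

theorem eventuallyEq_const_smoothTransition {x : ℝ} (hx : x ∉ Set.Icc (0 : ℝ) 1) :
    ∃ c : ℝ, Real.smoothTransition =ᶠ[𝓝 x] fun _ => c := by
  simp only [Set.mem_Icc, not_and_or, not_le] at hx
  rcases hx with hx | hx
  · exact ⟨0, by
      filter_upwards [Iio_mem_nhds hx] with y hy
      exact Real.smoothTransition.zero_of_nonpos (le_of_lt hy)⟩
  · exact ⟨1, by
      filter_upwards [Ioi_mem_nhds hx] with y hy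
      exact Real.smoothTransition.one_of_one_le (le_of_lt hy)⟩

theorem exists_abs_iteratedDeriv_smoothTransition_le (k : ℕ) :
    ∃ B : ℝ, ∀ x, |iteratedDeriv (k + 1) Real.smoothTransition x| ≤ B := by
  have hcont : Continuous (iteratedDeriv (k + 1) Real.smoothTransition) :=
    (Real.smoothTransition.contDiff (n := (k + 1 : ℕ))).continuous_iteratedDeriv _ le_rfl
  obtain ⟨B, hB⟩ := (isCompact_Icc (a := (0 : ℝ)) (b := 1)).exists_bound_of_continuousOn
    hcont.continuousOn
  refine ⟨max B 0, fun x => ?_⟩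
  by_cases hx : x ∈ Set.Icc (0 : ℝ) 1
  · exact (hB x hx).trans (le_max_left _ _)
  · obtain ⟨c, hc⟩ := eventuallyEq_const_smoothTransition hx
    simp [hc.iteratedDeriv_eq (k + 1), iteratedDeriv_const]

theorem abs_sub_taylor_two_le {f : ℝ → ℝ} (hf : ContDiff ℝ 3 f) {B : ℝ}
    (hB : ∀ x, |iteratedDeriv 3 f x| ≤ B) (s y : ℝ) :
    |f (s + y) - (f s + iteratedDeriv 1 f s * y + iteratedDeriv 2 f s * (y ^ 2 / 2))| ≤
      B * |y| ^ 3 := by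
  rcases eq_or_ne y 0 with rfl | hy
  · simp
  have hne : s ≠ s + y := by simpa [eq_comm] using hy
  obtain ⟨z, -, hz⟩ := taylor_mean_remainder_lagrange_iteratedDeriv (n := 2) hne
    (hf.contDiffOn (s := Set.uIcc s (s + y)))
  have hderiv : ∀ k : ℕ, k ≤ 3 →
      iteratedDerivWithin k f (Set.uIcc s (s + y)) s = iteratedDeriv k f s := fun k hk =>
    iteratedDerivWithin_eq_iteratedDeriv (uniqueDiffOn_uIcc hne)
      ((hf.of_le (by exact_mod_cast hk)).contDiffAt) Set.left_mem_uIcc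
  have hremainder :
      f (s + y) - (f s + iteratedDeriv 1 f s * y + iteratedDeriv 2 f s * (y ^ 2 / 2)) =
        iteratedDeriv 3 f z * y ^ 3 / 6 := by
    simp only [taylor_within_apply, Finset.sum_range_succ, Finset.range_zero, Finset.sum_empty,
      hderiv 0 (by norm_num), hderiv 1 (by norm_num), hderiv 2 (by norm_num),
      iteratedDeriv_zero] at hz
    norm_num [Nat.factorial] at hz
    rw [← hz, iteratedDeriv_one]
    ring
  have hle : |iteratedDeriv 3 f z| * |y| ^ 3 ≤ B * |y| ^ 3 := by
    gcongr
    exact hB z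
  rw [hremainder, abs_div, abs_mul, abs_pow, abs_of_pos (by norm_num : (0 : ℝ) < 6)]
  linarith [show 0 ≤ |iteratedDeriv 3 f z| * |y| ^ 3 by positivity]

/-- A smooth step, `0` to the left of `x` and `1` to the right of `x + 1 / c`. -/
noncomputable def smoothStep (c x s : ℝ) : ℝ := Real.smoothTransition (c * (s - x))

section SmoothStep

variable {c x : ℝ}

theorem measurable_smoothStep : Measurable (smoothStep c x) :=
  Real.smoothTransition.continuous.measurable.comp (by fun_prop)

theorem abs_smoothStep_le_one (s : ℝ) : |smoothStep c x s| ≤ 1 := by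
  rw [smoothStep, abs_of_nonneg (Real.smoothTransition.nonneg _)]
  exact Real.smoothTransition.le_one _

theorem integral_smoothStep_le (hc : 0 ≤ c) (ρ : Measure ℝ) [IsFiniteMeasure ρ] :
    ∫ y, smoothStep c x y ∂ρ ≤ ρ.real (Set.Ici x) := by
  rw [← integral_indicator_one measurableSet_Ici]
  refine integral_mono
    (integrable_comp_of_abs_le_one measurable_smoothStep abs_smoothStep_le_one measurable_id)
    ((integrable_const 1).indicator measurableSet_Ici) fun y => ?_
  by_cases hy : y ∈ Set.Ici x
  · rw [Set.indicator_of_mem hy]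
    exact Real.smoothTransition.le_one _
  · rw [Set.indicator_of_notMem hy]
    rw [Set.mem_Ici, not_le] at hy
    exact (Real.smoothTransition.zero_of_nonpos
      (mul_nonpos_of_nonneg_of_nonpos hc (by linarith))).le

theorem measureReal_Ici_le_integral_smoothStep (hc : 0 < c) (ρ : Measure ℝ) [IsFiniteMeasure ρ] :
    ρ.real (Set.Ici (x + 1 / c)) ≤ ∫ y, smoothStep c x y ∂ρ := by
  rw [← integral_indicator_one measurableSet_Ici]
  refine integral_mono ((integrable_const 1).indicator measurableSet_Ici)
    (integrable_comp_of_abs_le_one measurable_smoothStep abs_smoothStep_le_one measurable_id)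
    fun y => ?_
  by_cases hy : y ∈ Set.Ici (x + 1 / c)
  · rw [Set.indicator_of_mem hy]
    rw [Set.mem_Ici, ← le_sub_iff_add_le', div_le_iff₀' hc] at hy
    exact (Real.smoothTransition.one_of_one_le hy).ge
  · rw [Set.indicator_of_notMem hy]
    exact Real.smoothTransition.nonneg _

theorem taylorBound_smoothStep {B l : ℝ}
    (hB : ∀ x, |iteratedDeriv 3 Real.smoothTransition x| ≤ B) (hc : 0 < c) (hl : 0 ≤ l) :
    TaylorBound (B * c ^ 3 * Real.exp (-l * x)) l (smoothStep c x)
      (fun s => c * iteratedDeriv 1 Real.smoothTransition (c * (s - x)))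
      (fun s => c ^ 2 * iteratedDeriv 2 Real.smoothTransition (c * (s - x))) := by
  have hB0 : 0 ≤ B := (abs_nonneg _).trans (hB 0)
  refine ⟨measurable_smoothStep, abs_smoothStep_le_one, fun s y => ?_⟩
  unfold smoothStep
  by_cases hleft : s < x ∧ s + y < x
  · have hs : c * (s - x) < 0 := mul_neg_of_pos_of_neg hc (by linarith)
    have hsy : c * (s + y - x) < 0 := mul_neg_of_pos_of_neg hc (by linarith)
    have hzero : Real.smoothTransition =ᶠ[𝓝 (c * (s - x))] fun _ => 0 := by
      filter_upwards [Iio_mem_nhds hs] with y hy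
      exact Real.smoothTransition.zero_of_nonpos (le_of_lt hy)
    rw [hzero.iteratedDeriv_eq 1, hzero.iteratedDeriv_eq 2,
      Real.smoothTransition.zero_of_nonpos hs.le, Real.smoothTransition.zero_of_nonpos hsy.le]
    simp only [iteratedDeriv_const, one_ne_zero, OfNat.ofNat_ne_zero, if_false, mul_zero, zero_mul,
      add_zero, sub_zero, abs_zero]
    positivity
  · have hright : 0 ≤ s + |y| - x := by
      rw [not_and_or, not_lt, not_lt] at hleft
      rcases hleft with h | h
      · linarith [abs_nonneg y]
      · linarith [le_abs_self y]
    have htaylor := abs_sub_taylor_two_le (Real.smoothTransition.contDiff (n := 3)) hB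
      (c * (s - x)) (c * y)
    have hexp : 1 ≤ Real.exp (l * (s + |y| - x)) := Real.one_le_exp (by positivity)
    calc _ ≤ B * |c * y| ^ 3 := by
          refine (le_of_eq ?_).trans htaylor
          rw [show c * (s + y - x) = c * (s - x) + c * y by ring]
          ring_nf
      _ ≤ B * |c * y| ^ 3 * Real.exp (l * (s + |y| - x)) :=
          le_mul_of_one_le_right (by positivity) hexp
      _ = _ := by
          rw [abs_mul, abs_of_pos hc,
            show l * (s + |y| - x) = -l * x + l * (s + |y|) by ring, Real.exp_add]
          ring

end SmoothStep

section ModerateDeviation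

variable {Ω ι : Type*} [MeasurableSpace Ω] [Fintype ι] {P : Measure Ω} [IsProbabilityMeasure P]
  {Z : ι → Ω → ℝ} {t K : ℝ}

theorem sum_abs_pow_three_le {a : ι → ℝ} {b : ℝ} (hab : ∀ q, |a q| ≤ b) (ha : ∑ q, a q ^ 2 = 1) :
    ∑ q, |a q| ^ 3 ≤ b := by
  calc ∑ q, |a q| ^ 3 ≤ ∑ q, b * a q ^ 2 := by
        refine Finset.sum_le_sum fun q _ => ?_
        rw [← sq_abs (a q), pow_succ']
        gcongr
        exact hab q
    _ = b := by rw [← Finset.mul_sum, ha, mul_one]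

-- Lindeberg's method for the smooth step between `x - d` and `x`, with exponential weight `x`.
theorem prob_sum_ge_le_gaussTail_add {B : ℝ}
    (hB : ∀ x, |iteratedDeriv 3 Real.smoothTransition x| ≤ B)
    (hG : IsStdSubexp t K (gaussianReal 0 1)) (hZ : ∀ q, Measurable (Z q)) (hind : iIndepFun Z P)
    (hlaw : ∀ q, IsStdSubexp t K (P.map (Z q))) {a : ι → ℝ} {b x d : ℝ} (hab : ∀ q, |a q| ≤ b)
    (ha : ∑ q, a q ^ 2 = 1) (hx : 0 ≤ x) (hxb : x * b ≤ t / 2) (hd : 0 < d) :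
    P.real {ω | x ≤ ∑ q, a q * Z q ω} ≤ gaussTail (x - d) +
      2 * (B * (1 / d) ^ 3 * Real.exp (-x * (x - d))) * (48 / t ^ 3 * K) * b *
        Real.exp (x ^ 2 / 2 + 48 / t ^ 3 * K * (x ^ 3 * b)) := by
  have hB0 : 0 ≤ B := (abs_nonneg _).trans (hB 0)
  have hC0 : 0 ≤ 48 / t ^ 3 * K := by have := hG.K_pos; have := hG.t_pos; positivity
  have hcube := sum_abs_pow_three_le hab ha
  have hb : 0 ≤ b := (Finset.sum_nonneg fun q _ => by positivity).trans hcube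
  have hlindeberg := (taylorBound_smoothStep (x := x - d) hB (one_div_pos.2 hd)
    hx).shiftClose_map_sum hx hG hZ hind hlaw a
      (fun q => (mul_le_mul_of_nonneg_left (hab q) hx).trans hxb) Finset.univ 0
  rw [← Real.toNNReal_sum_of_nonneg (fun q _ => sq_nonneg _), ha, Real.toNNReal_one] at hlindeberg
  simp only [zero_add, mul_zero, Real.exp_zero, mul_one] at hlindeberg
  have hmap : P.real {ω | x ≤ ∑ q, a q * Z q ω} =
      (P.map (∑ q, fun ω => a q * Z q ω)).real (Set.Ici (x - d + 1 / (1 / d))) := by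
    rw [map_measureReal_apply (by fun_prop) measurableSet_Ici, one_div_one_div, sub_add_cancel]
    simp only [Set.preimage, Set.mem_Ici, Finset.sum_apply]
  have hgauss := integral_smoothStep_le (x := x - d) (one_div_pos.2 hd).le (gaussianReal 0 1)
  rw [gaussianReal_Ici] at hgauss
  calc P.real {ω | x ≤ ∑ q, a q * Z q ω}
      ≤ ∫ y, smoothStep (1 / d) (x - d) y ∂(P.map (∑ q, fun ω => a q * Z q ω)) := by
        rw [hmap]
        exact measureReal_Ici_le_integral_smoothStep (one_div_pos.2 hd) _
    _ ≤ ∫ y, smoothStep (1 / d) (x - d) y ∂(gaussianReal 0 1) + _ :=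
        sub_le_iff_le_add'.1 ((le_abs_self _).trans hlindeberg)
    _ ≤ _ := by gcongr

theorem lindeberg_error_le {B C b x d δ : ℝ} (hB : 0 ≤ B) (hC : 0 ≤ C) (hb : 0 ≤ b) (hx : 0 ≤ x)
    (hd : 0 < d) (hxd : x * d ≤ 1) (hCb : C * (x ^ 3 * b) ≤ 1)
    (hδ : (1 + x) * (1 / d) ^ 3 * b ≤ δ) :
    2 * (B * (1 / d) ^ 3 * Real.exp (-x * (x - d))) * C * b *
      Real.exp (x ^ 2 / 2 + C * (x ^ 3 * b)) ≤
    6 * B * C * Real.exp (7 / 2) * δ * gaussTail x := by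
  have hexp : Real.exp (-x * (x - d)) * Real.exp (x ^ 2 / 2 + C * (x ^ 3 * b)) ≤
      3 * (Real.exp (7 / 2) * (1 + x) * gaussTail x) := by
    have hsqrt : √(2 * Real.pi) ≤ 3 := by
      rw [Real.sqrt_le_iff]
      constructor <;> linarith [Real.pi_lt_d2]
    calc Real.exp (-x * (x - d)) * Real.exp (x ^ 2 / 2 + C * (x ^ 3 * b))
        ≤ Real.exp 2 * Real.exp (-x ^ 2 / 2) := by
          rw [← Real.exp_add, ← Real.exp_add, Real.exp_le_exp]
          linarith
      _ = Real.exp 2 * (√(2 * Real.pi) * gaussianPDFReal 0 1 x) := by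
          rw [gaussianPDFReal_std]
          field_simp
      _ ≤ Real.exp 2 * (3 * (Real.exp (3 / 2) * (1 + x) * gaussTail x)) := by
          gcongr
          · exact gaussianPDFReal_nonneg _ _ _
          · exact gaussianPDFReal_le_gaussTail hx
      _ = _ := by
          rw [show (7 / 2 : ℝ) = 2 + 3 / 2 by norm_num, Real.exp_add]
          ring
  have htail := gaussTail_pos x
  calc _ = 2 * B * C * ((1 / d) ^ 3 * b) *
        (Real.exp (-x * (x - d)) * Real.exp (x ^ 2 / 2 + C * (x ^ 3 * b))) := by ring
    _ ≤ 2 * B * C * ((1 / d) ^ 3 * b) *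
        (3 * (Real.exp (7 / 2) * (1 + x) * gaussTail x)) := by gcongr
    _ = 6 * B * C * Real.exp (7 / 2) * ((1 + x) * (1 / d) ^ 3 * b) * gaussTail x := by ring
    _ ≤ _ := by gcongr

-- The smoothing width is `η / (1 + x)`.
theorem prob_sum_ge_le_mul_gaussTail {B η : ℝ}
    (hB : ∀ x, |iteratedDeriv 3 Real.smoothTransition x| ≤ B)
    (hG : IsStdSubexp t K (gaussianReal 0 1)) (hZ : ∀ q, Measurable (Z q)) (hind : iIndepFun Z P)
    (hlaw : ∀ q, IsStdSubexp t K (P.map (Z q))) {a : ι → ℝ} {b x : ℝ} (hab : ∀ q, |a q| ≤ b)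
    (ha : ∑ q, a q ^ 2 = 1) (hx : 0 ≤ x) (hxb : x * b ≤ t / 2)
    (hCb : 48 / t ^ 3 * K * (x ^ 3 * b) ≤ 1) (hη : 0 < η) (hη₁ : η ≤ 1) :
    P.real {ω | x ≤ ∑ q, a q * Z q ω} ≤ (1 + Real.exp (5 / 2) * η +
      6 * B * (48 / t ^ 3 * K) * Real.exp (7 / 2) / η ^ 3 * ((1 + x) ^ 4 * b)) * gaussTail x := by
  have hC : 0 ≤ 48 / t ^ 3 * K := by have := hG.K_pos; have := hG.t_pos; positivity
  have hb : 0 ≤ b :=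
    (Finset.sum_nonneg fun q _ => by positivity).trans (sum_abs_pow_three_le hab ha)
  have hd : 0 < η / (1 + x) := by positivity
  have hxd : x * (η / (1 + x)) ≤ 1 := by
    rw [mul_div_assoc', div_le_one (by positivity)]
    nlinarith
  calc _ ≤ _ := prob_sum_ge_le_gaussTail_add hB hG hZ hind hlaw hab ha hx hxb hd
    _ ≤ (1 + Real.exp (5 / 2) * η) * gaussTail x + 6 * B * (48 / t ^ 3 * K) * Real.exp (7 / 2) *
          ((1 + x) * (1 / (η / (1 + x))) ^ 3 * b) * gaussTail x :=
        add_le_add (gaussTail_sub_le hx hη₁ hd.le (div_mul_cancel₀ _ (by positivity)).le)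
          (lindeberg_error_le ((abs_nonneg _).trans (hB 0)) hC hb hx hd hxd hCb le_rfl)
    _ = _ := by field_simp

end ModerateDeviation

-- Upper half of a Cramér type moderate deviation theorem.
theorem exists_prob_sum_ge_le.{u, w} {t ε : ℝ} (K : ℝ) (ht : 0 < t) (hε : 0 < ε) :
    ∃ δ > 0, ∀ {Ω : Type u} {ι : Type w} [MeasurableSpace Ω] [Fintype ι] {P : Measure Ω}
      [IsProbabilityMeasure P] {Z : ι → Ω → ℝ}, (∀ q, Measurable (Z q)) → iIndepFun Z P →
      (∀ q, IsStdSubexp t K (P.map (Z q))) → ∀ (a : ι → ℝ) (b x : ℝ), (∀ q, |a q| ≤ b) →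
      ∑ q, a q ^ 2 = 1 → 0 ≤ x → (1 + x) ^ 4 * b ≤ δ →
      P.real {ω | x ≤ ∑ q, a q * Z q ω} ≤ (1 + ε) * gaussTail x := by
  obtain ⟨B, hB⟩ := exists_abs_iteratedDeriv_smoothTransition_le 2
  have hB0 : 0 ≤ B := (abs_nonneg _).trans (hB 0)
  set K' := max K (2 * Real.exp (t ^ 2 / 2))
  have hG : IsStdSubexp t K' (gaussianReal 0 1) :=
    (isStdSubexp_gaussianReal ht).mono (le_max_right _ _)
  set C := 48 / t ^ 3 * K'
  have hC0 : 0 < C := by have := hG.K_pos; positivity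
  obtain ⟨η, hη0, hη1, hη⟩ : ∃ η > 0, η ≤ 1 ∧ Real.exp (5 / 2) * η ≤ ε / 2 := by
    refine ⟨min 1 (ε / 2 / Real.exp (5 / 2)), by positivity, min_le_left _ _, ?_⟩
    rw [mul_comm, ← le_div_iff₀ (by positivity)]
    exact min_le_right _ _
  set D := 6 * B * C * Real.exp (7 / 2) / η ^ 3
  have hD0 : 0 ≤ D := by positivity
  refine ⟨min (t / 2) (min (1 / C) (ε / 2 / (D + 1))), by positivity, ?_⟩
  intro Ω ι _ _ P _ Z hZ hind hlaw a b x hab ha hx hδ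
  simp only [le_min_iff] at hδ
  obtain ⟨hδt, hδC, hδD⟩ := hδ
  have hb : 0 ≤ b :=
    (Finset.sum_nonneg fun q _ => by positivity).trans (sum_abs_pow_three_le hab ha)
  have hpow : ∀ k ≤ 4, x ^ k * b ≤ (1 + x) ^ 4 * b := fun k hk => by
    gcongr
    exact (pow_le_pow_left₀ hx (by linarith) k).trans (pow_le_pow_right₀ (by linarith) hk)
  have hxb : x * b ≤ t / 2 := by simpa only [pow_one] using (hpow 1 (by norm_num)).trans hδt
  have hCb : C * (x ^ 3 * b) ≤ 1 := (le_div_iff₀' hC0).1 ((hpow 3 (by norm_num)).trans hδC)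
  have herror : D * ((1 + x) ^ 4 * b) ≤ ε / 2 := by
    calc _ ≤ (D + 1) * (ε / 2 / (D + 1)) := by gcongr; linarith
      _ = ε / 2 := by field_simp
  refine (prob_sum_ge_le_mul_gaussTail hB hG hZ hind (fun q => (hlaw q).mono (le_max_left _ _))
    hab ha hx hxb hCb hη0 hη1).trans ?_
  exact mul_le_mul_of_nonneg_right (by linarith) (gaussTail_pos x).le

namespace TwoSample

variable {m : ℕ} {Ω : Type*} [MeasurableSpace Ω] {P : Measure Ω} (D : TwoSample m P)

/-- Standard deviation of the difference of the sample means of coordinate `i`. -/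
noncomputable def diffSD (i : Fin m) : ℝ := √(D.var 0 i / D.n 0 + D.var 1 i / D.n 1)

/-- Standardised observations of coordinate `i`, with both samples in one family. -/
noncomputable def stdObs (i : Fin m) (q : Σ j : Fin 2, Fin (D.n j)) (ω : Ω) : ℝ :=
  (D.X q.1 q.2 ω i - D.mean q.1 i) / √(D.var q.1 i)

/-- Coefficients of the standardised observations in the standardised difference of the sample
means; the second sample enters with a minus sign. -/
noncomputable def weight (i : Fin m) (q : Σ j : Fin 2, Fin (D.n j)) : ℝ :=
  (if q.1 = 0 then 1 else -1) * (√(D.var q.1 i) / (D.n q.1 * D.diffSD i))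

/-- The centred difference of the sample means, divided by its standard deviation. -/
noncomputable def stdDiff (i : Fin m) (ω : Ω) : ℝ := ∑ q, D.weight i q * D.stdObs i q ω

/-- Empirical variance, normalised by the sample size, relative to the population variance. -/
noncomputable def relVar (j : Fin 2) (i : Fin m) (ω : Ω) : ℝ :=
  D.sumSqDev j i ω / (D.n j * D.var j i)

/-- The estimator of the variance of the difference of the sample means which the respective
version of the `t` statistic uses. -/
noncomputable def diffVarEst : VarianceCase → Fin m → Ω → ℝ
  | .equal, i, ω => D.pooledVar i ω * (1 / D.n 0 + 1 / D.n 1)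
  | .unequal, i, ω => D.sampleVar 0 i ω / D.n 0 + D.sampleVar 1 i ω / D.n 1

/-- The variance estimate in the denominator of the `t` statistic, relative to the true variance. -/
noncomputable def relVarEst (v : VarianceCase) (i : Fin m) (ω : Ω) : ℝ :=
  D.diffVarEst v i ω / D.diffSD i ^ 2

/-- The regularity under which the tails of the `t` statistics are controlled: measurable
observations (the laws alone only give almost everywhere measurability), positive variances, a
uniform exponential moment of the standardised coordinates, and samples of size at least `N`. -/
structure Regular (t K N : ℝ) : Prop where
  t_pos : 0 < t
  K_pos : 0 < K
  two_le : 2 ≤ N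
  measurable : ∀ j k, Measurable (D.X j k)
  var_pos : ∀ j i, 0 < D.var j i
  exp_le : ∀ j i, ∫⁻ x, ENNReal.ofReal
    (Real.exp (t * |x i - D.mean j i| / √(D.var j i))) ∂(D.pop j) ≤ ENNReal.ofReal K
  le_size : ∀ j, N ≤ D.n j

variable {D}

theorem tStat_eq_div_sqrt (v : VarianceCase) (i : Fin m) (ω : Ω)
    (hn : ∀ j, (D.n j : ℝ) ≠ 0) :
    D.tStat v i ω = (D.sampleMean 0 i ω - D.sampleMean 1 i ω) / √(D.diffVarEst v i ω) := by
  cases v with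
  | unequal => rfl
  | equal =>
    have hn0 := hn 0
    have hn1 := hn 1
    have hratio : (D.n 0 * D.n 1 : ℝ) / ((D.n 0 + D.n 1 : ℝ) * D.pooledVar i ω) =
        (D.pooledVar i ω * (1 / D.n 0 + 1 / D.n 1))⁻¹ := by
      rw [one_div_add_one_div hn0 hn1, mul_div_assoc', inv_div, mul_comm (D.pooledVar i ω)]
    simp only [tStat, diffVarEst]
    rw [hratio, Real.sqrt_inv, inv_mul_eq_div]

theorem sumSqDev_eq (j : Fin 2) (i : Fin m) (ω : Ω) (hn : (D.n j : ℝ) ≠ 0) :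
    D.sumSqDev j i ω = ∑ k, D.X j k ω i ^ 2 - (∑ k, D.X j k ω i) ^ 2 / D.n j := by
  unfold sumSqDev sampleMean
  set S := ∑ k, D.X j k ω i with hS
  have hcross : ∑ k, 2 * D.X j k ω i * (1 / (D.n j : ℝ) * S) = 2 * S ^ 2 / D.n j := by
    rw [← Finset.sum_mul, ← Finset.mul_sum, ← hS]
    ring
  simp only [sub_sq, Finset.sum_add_distrib, Finset.sum_sub_distrib, Finset.sum_const,
    Finset.card_univ, Fintype.card_fin, nsmul_eq_mul, hcross]
  field_simp
  ring

theorem sum_stdObs (j : Fin 2) (i : Fin m) (ω : Ω) :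
    ∑ k, D.stdObs i ⟨j, k⟩ ω = (∑ k, D.X j k ω i - D.n j * D.mean j i) / √(D.var j i) := by
  simp only [stdObs, ← Finset.sum_div, Finset.sum_sub_distrib, Finset.sum_const,
    Finset.card_univ, Fintype.card_fin, nsmul_eq_mul]

theorem sum_stdObs_sq (j : Fin 2) (i : Fin m) (ω : Ω) (hvar : 0 ≤ D.var j i) :
    ∑ k, D.stdObs i ⟨j, k⟩ ω ^ 2 = (∑ k, D.X j k ω i ^ 2 -
      2 * D.mean j i * ∑ k, D.X j k ω i + D.n j * D.mean j i ^ 2) / D.var j i := by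
  simp only [stdObs, div_pow, Real.sq_sqrt hvar, ← Finset.sum_div, sub_sq,
    Finset.sum_add_distrib, Finset.sum_sub_distrib, Finset.sum_const, Finset.card_univ,
    Fintype.card_fin, nsmul_eq_mul, Finset.mul_sum]
  simp only [mul_right_comm]

theorem iIndepFun_stdObs (i : Fin m) : iIndepFun (D.stdObs i) P :=
  D.indep.comp (fun q x => (x i - D.mean q.1 i) / √(D.var q.1 i)) (fun _ => by fun_prop)

theorem iIndepFun_stdObs_sample (i : Fin m) (j : Fin 2) :
    iIndepFun (fun k : Fin (D.n j) => D.stdObs i ⟨j, k⟩) P :=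
  (iIndepFun_stdObs i).precomp sigma_mk_injective

namespace Regular

variable {t K N : ℝ}

theorem two_le_size (h : D.Regular t K N) (j : Fin 2) : 2 ≤ (D.n j : ℝ) :=
  h.two_le.trans (h.le_size j)

theorem size_pos (h : D.Regular t K N) (j : Fin 2) : 0 < (D.n j : ℝ) := by
  linarith [h.two_le_size j]

theorem diffSD_sq (h : D.Regular t K N) (i : Fin m) :
    D.diffSD i ^ 2 = D.var 0 i / D.n 0 + D.var 1 i / D.n 1 := by
  have hvar₀ := h.var_pos 0 i
  have hvar₁ := h.var_pos 1 i
  exact Real.sq_sqrt (by positivity)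

theorem diffSD_pos (h : D.Regular t K N) (i : Fin m) : 0 < D.diffSD i :=
  Real.sqrt_pos.2 <| add_pos (div_pos (h.var_pos 0 i) (h.size_pos 0))
    (div_pos (h.var_pos 1 i) (h.size_pos 1))

theorem measurable_apply (h : D.Regular t K N) (j : Fin 2) (k : Fin (D.n j)) (i : Fin m) :
    Measurable fun ω => D.X j k ω i := (measurable_pi_apply i).comp (h.measurable j k)

theorem measurable_stdObs (h : D.Regular t K N) (i : Fin m) (q) : Measurable (D.stdObs i q) :=
  ((h.measurable_apply q.1 q.2 i).sub_const _).div_const _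

theorem isStdSubexp_stdObs (h : D.Regular t K N) (i : Fin m) (q) :
    IsStdSubexp t K (P.map (D.stdObs i q)) := by
  have := D.isProbabilityMeasure_pop q.1
  set f : (Fin m → ℝ) → ℝ := fun x => (x i - D.mean q.1 i) / √(D.var q.1 i) with hf
  have hfm : Measurable f := by fun_prop
  have hvar := h.var_pos q.1 i
  have hmap : P.map (D.stdObs i q) = (D.pop q.1).map f := by
    rw [← (D.hasLaw q.1 q.2).map_eq, Measure.map_map hfm (h.measurable q.1 q.2)]
    rfl
  have habs : ∀ x, t * |x i - D.mean q.1 i| / √(D.var q.1 i) = t * |f x| := fun x => by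
    rw [hf, abs_div, abs_of_nonneg (Real.sqrt_nonneg _), mul_div_assoc]
  have hexp := h.exp_le q.1 i
  simp only [habs] at hexp
  have hpos : 0 ≤ᵐ[D.pop q.1] fun x => Real.exp (t * |f x|) :=
    ae_of_all _ fun x => (Real.exp_pos _).le
  rw [hmap]
  refine ⟨h.t_pos, Measure.isProbabilityMeasure_map hfm.aemeasurable, ?_, ?_, ?_, ?_⟩
  · rw [integral_map hfm.aemeasurable (by fun_prop), hf, integral_div,
      integral_sub ((D.memLp_two q.1 i).integrable one_le_two) (integrable_const _)]
    simp [TwoSample.mean]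
  · rw [integral_map hfm.aemeasurable (by fun_prop), hf]
    simp only [div_pow, Real.sq_sqrt hvar.le]
    rw [integral_div, div_eq_one_iff_eq hvar.ne']
    exact (variance_eq_integral (measurable_pi_apply i).aemeasurable).symm
  · rw [integrable_map_measure (by fun_prop) hfm.aemeasurable]
    exact ⟨by fun_prop, (hasFiniteIntegral_iff_ofReal hpos).2
      (hexp.trans_lt ENNReal.ofReal_lt_top)⟩
  · rw [integral_map hfm.aemeasurable (by fun_prop),
      integral_eq_lintegral_of_nonneg_ae hpos (by fun_prop)]
    exact ENNReal.toReal_le_of_le_ofReal h.K_pos.le hexp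

theorem weight_sq (h : D.Regular t K N) (i : Fin m) (q) :
    D.weight i q ^ 2 = D.var q.1 i / (D.n q.1 ^ 2 * D.diffSD i ^ 2) := by
  have hsign : (if q.1 = 0 then (1 : ℝ) else -1) ^ 2 = 1 := by split_ifs <;> norm_num
  rw [weight, mul_pow, hsign, one_mul, div_pow, mul_pow, Real.sq_sqrt (h.var_pos _ _).le]

theorem sum_weight_sq (h : D.Regular t K N) (i : Fin m) : ∑ q, D.weight i q ^ 2 = 1 := by
  have hn₀ := h.size_pos 0
  have hn₁ := h.size_pos 1
  have hsd := h.diffSD_pos i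
  simp only [h.weight_sq i, Fintype.sum_sigma, Finset.sum_const, Finset.card_univ,
    Fintype.card_fin, Fin.sum_univ_two, nsmul_eq_mul]
  calc _ = (D.var 0 i / D.n 0 + D.var 1 i / D.n 1) / D.diffSD i ^ 2 := by field_simp
    _ = 1 := by rw [← h.diffSD_sq i, div_self (by positivity)]

theorem var_div_size_le (h : D.Regular t K N) (j : Fin 2) (i : Fin m) :
    D.var j i / D.n j ≤ D.diffSD i ^ 2 := by
  rw [h.diffSD_sq]
  have hpos₀ := div_pos (h.var_pos 0 i) (h.size_pos 0)
  have hpos₁ := div_pos (h.var_pos 1 i) (h.size_pos 1)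
  fin_cases j
  · exact le_add_of_nonneg_right hpos₁.le
  · exact le_add_of_nonneg_left hpos₀.le

theorem abs_weight_le (h : D.Regular t K N) (i : Fin m) (q) : |D.weight i q| ≤ 1 / √N := by
  have hsd := h.diffSD_pos i
  have hN : 0 < N := by linarith [h.two_le]
  have hn := h.size_pos q.1
  refine abs_le_of_sq_le_sq ?_ (by positivity)
  rw [h.weight_sq, div_pow, Real.sq_sqrt hN.le, one_pow]
  calc D.var q.1 i / (D.n q.1 ^ 2 * D.diffSD i ^ 2)
      = D.var q.1 i / D.n q.1 / D.diffSD i ^ 2 / D.n q.1 := by field_simp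
    _ ≤ 1 / (D.n q.1 : ℝ) := by
        gcongr
        exact div_le_one_of_le₀ (h.var_div_size_le _ i) (by positivity)
    _ ≤ 1 / N := by
        gcongr
        exact h.le_size q.1

theorem stdDiff_eq (h : D.Regular t K N) (i : Fin m) (ω : Ω) :
    D.stdDiff i ω = ((D.sampleMean 0 i ω - D.sampleMean 1 i ω) - (D.mean 0 i - D.mean 1 i)) /
      D.diffSD i := by
  have hsd := h.diffSD_pos i
  have hn₀ := h.size_pos 0
  have hn₁ := h.size_pos 1
  have hterm : ∀ q, D.weight i q * D.stdObs i q ω =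
      (if q.1 = 0 then 1 else -1) *
        ((D.X q.1 q.2 ω i - D.mean q.1 i) / (D.n q.1 * D.diffSD i)) := fun q => by
    have hsqrt := Real.sqrt_pos.2 (h.var_pos q.1 i)
    have hn := h.size_pos q.1
    unfold weight stdObs
    field_simp
  simp only [stdDiff, hterm, Fintype.sum_sigma, Fin.sum_univ_two, if_true, one_ne_zero, if_false,
    ← Finset.mul_sum, ← Finset.sum_div, Finset.sum_sub_distrib, Finset.sum_const,
    Finset.card_univ, Fintype.card_fin, nsmul_eq_mul, sampleMean]
  field_simp
  ring

theorem relVar_eq (h : D.Regular t K N) (j : Fin 2) (i : Fin m) (ω : Ω) :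
    D.relVar j i ω = (∑ k, D.stdObs i ⟨j, k⟩ ω ^ 2) / D.n j -
      ((∑ k, D.stdObs i ⟨j, k⟩ ω) / D.n j) ^ 2 := by
  have hvar := h.var_pos j i
  have hn := h.size_pos j
  rw [relVar, sumSqDev_eq j i ω hn.ne', sum_stdObs, sum_stdObs_sq j i ω hvar.le, div_div,
    div_pow, div_pow _ (√_), Real.sq_sqrt hvar.le]
  field_simp
  ring

theorem sumSqDev_eq_mul_relVar (h : D.Regular t K N) (j : Fin 2) (i : Fin m) (ω : Ω) :
    D.sumSqDev j i ω = D.n j * D.var j i * D.relVar j i ω :=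
  (mul_div_cancel₀ _ (mul_pos (h.size_pos j) (h.var_pos j i)).ne').symm

theorem tStat_eq (h : D.Regular t K N) (v : VarianceCase) (i : Fin m) (ω : Ω) :
    D.tStat v i ω =
      (D.stdDiff i ω + (D.mean 0 i - D.mean 1 i) / D.diffSD i) / √(D.relVarEst v i ω) := by
  have hsd := h.diffSD_pos i
  rw [tStat_eq_div_sqrt v i ω fun j => (h.size_pos j).ne', h.stdDiff_eq, ← add_div,
    sub_add_cancel, relVarEst, Real.sqrt_div' _ (sq_nonneg _), Real.sqrt_sq hsd.le,
    div_div_div_cancel_right₀ hsd.ne']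

theorem relVarEst_unequal (h : D.Regular t K N) (i : Fin m) (ω : Ω) :
    D.relVarEst .unequal i ω =
      (D.n 0 / (D.n 0 - 1) * D.relVar 0 i ω * (D.var 0 i / D.n 0) +
        D.n 1 / (D.n 1 - 1) * D.relVar 1 i ω * (D.var 1 i / D.n 1)) / D.diffSD i ^ 2 := by
  simp only [relVarEst, diffVarEst, sampleVar, h.sumSqDev_eq_mul_relVar]
  congr 1
  ring

theorem relVarEst_equal (h : D.Regular t K N) (i : Fin m) (hvar : D.var 0 i = D.var 1 i) (ω : Ω) :
    D.relVarEst .equal i ω =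
      (D.n 0 * D.relVar 0 i ω + D.n 1 * D.relVar 1 i ω) / (D.n 0 + D.n 1 - 2) := by
  have hn₀ := h.size_pos 0
  have hn₁ := h.size_pos 1
  have hvar₁ := h.var_pos 1 i
  simp only [relVarEst, diffVarEst, pooledVar, h.sumSqDev_eq_mul_relVar, h.diffSD_sq, hvar]
  field_simp

theorem le_relVarEst (h : D.Regular t K N) {v : VarianceCase} {i : Fin m}
    (hv : v = VarianceCase.equal → D.var 0 i = D.var 1 i) {ω : Ω} {r : ℝ} (hr : 0 ≤ r)
    (hle : ∀ j, r ≤ D.relVar j i ω) : r ≤ D.relVarEst v i ω := by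
  have hn := h.two_le_size
  have hsd := h.diffSD_pos i
  cases v with
  | equal =>
    rw [h.relVarEst_equal i (hv rfl), le_div_iff₀ (by linarith [hn 0, hn 1])]
    nlinarith [hle 0, hle 1, hn 0, hn 1]
  | unequal =>
    have hterm : ∀ j, r * (D.var j i / D.n j) ≤
        D.n j / (D.n j - 1) * D.relVar j i ω * (D.var j i / D.n j) := fun j => by
      have hpos := div_pos (h.var_pos j i) (h.size_pos j)
      gcongr
      have hone : 1 ≤ (D.n j : ℝ) / (D.n j - 1) := by
        rw [one_le_div (by linarith [hn j])]
        linarith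
      nlinarith [hle j]
    rw [h.relVarEst_unequal, le_div_iff₀ (by positivity), h.diffSD_sq, mul_add]
    exact add_le_add (hterm 0) (hterm 1)

theorem relVarEst_le (h : D.Regular t K N) {v : VarianceCase} {i : Fin m}
    (hv : v = VarianceCase.equal → D.var 0 i = D.var 1 i) {ω : Ω} {u ρ : ℝ} (hu : 0 ≤ u)
    (hle : ∀ j, D.relVar j i ω ≤ u) (hρ : ∀ j, (D.n j : ℝ) ≤ ρ * (D.n j - 1)) :
    D.relVarEst v i ω ≤ ρ * u := by
  have hn := h.two_le_size
  have hsd := h.diffSD_pos i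
  cases v with
  | equal =>
    rw [h.relVarEst_equal i (hv rfl), div_le_iff₀ (by linarith [hn 0, hn 1])]
    calc (D.n 0 : ℝ) * D.relVar 0 i ω + D.n 1 * D.relVar 1 i ω ≤ D.n 0 * u + D.n 1 * u := by
          gcongr
          exacts [hle 0, hle 1]
      _ ≤ ρ * (D.n 0 - 1) * u + ρ * (D.n 1 - 1) * u := by
          gcongr
          exacts [hρ 0, hρ 1]
      _ = ρ * u * (D.n 0 + D.n 1 - 2) := by ring
  | unequal =>
    have hterm : ∀ j, D.n j / (D.n j - 1) * D.relVar j i ω * (D.var j i / D.n j) ≤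
        ρ * u * (D.var j i / D.n j) := fun j => by
      have hpos := div_pos (h.var_pos j i) (h.size_pos j)
      have hn' : 0 < (D.n j : ℝ) - 1 := by linarith [hn j]
      gcongr ?_ * _
      calc D.n j / (D.n j - 1) * D.relVar j i ω ≤ D.n j / (D.n j - 1) * u := by
            gcongr
            exact hle j
        _ ≤ ρ * u := by
            gcongr
            exact (div_le_iff₀ hn').2 (hρ j)
    rw [h.relVarEst_unequal, div_le_iff₀ (by positivity), h.diffSD_sq, mul_add]
    exact add_le_add (hterm 0) (hterm 1)

theorem one_sub_le_relVar (h : D.Regular t K N) {ε : ℝ} {j : Fin 2} {i : Fin m} {ω : Ω}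
    (hsq : D.n j * (1 - ε / 2) ≤ ∑ k, D.stdObs i ⟨j, k⟩ ω ^ 2)
    (hsum : |∑ k, D.stdObs i ⟨j, k⟩ ω| ≤ D.n j * √(ε / 2)) (hε : 0 ≤ ε) :
    1 - ε ≤ D.relVar j i ω := by
  have hn := h.size_pos j
  have hmeansq : 1 - ε / 2 ≤ (∑ k, D.stdObs i ⟨j, k⟩ ω ^ 2) / D.n j := by
    rwa [le_div_iff₀' hn]
  have hmean : ((∑ k, D.stdObs i ⟨j, k⟩ ω) / D.n j) ^ 2 ≤ ε / 2 := by
    rw [← Real.sq_sqrt (show 0 ≤ ε / 2 by positivity)]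
    refine sq_le_sq.2 ?_
    rwa [abs_div, abs_of_pos hn, abs_of_nonneg (Real.sqrt_nonneg _), div_le_iff₀' hn]
  rw [h.relVar_eq]
  linarith

theorem relVar_lower_tail [IsProbabilityMeasure P] (h : D.Regular t K N) {ε : ℝ} (hε : 0 ≤ ε)
    (hεt : √(ε / 2) ≤ t / 2) (hεK : 48 / t ^ 3 * K * √(ε / 2) ≤ 1 / 4) (j : Fin 2) (i : Fin m) :
    P.real {ω | D.relVar j i ω < 1 - ε} ≤
      Real.exp (-(N * ε ^ 2 * t ^ 4 / (192 * K))) + 2 * Real.exp (-(N * ε / 8)) := by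
  have hK := h.K_pos
  have hle := h.le_size j
  have hind := iIndepFun_stdObs_sample (D := D) i j
  have hm := fun k : Fin (D.n j) => h.measurable_stdObs i ⟨j, k⟩
  have hlaw := fun k : Fin (D.n j) => h.isStdSubexp_stdObs i ⟨j, k⟩
  have hsq := sum_sq_lower_tail hm hind hlaw h.t_pos hK (show 0 ≤ ε / 2 by positivity)
  have habs := abs_sum_tail hm hind hlaw (Real.sqrt_nonneg (ε / 2)) hεt hεK
  rw [Fintype.card_fin] at hsq habs
  rw [Real.sq_sqrt (by positivity)] at habs
  have hsub : {ω | D.relVar j i ω < 1 - ε} ⊆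
      {ω | ∑ k, D.stdObs i ⟨j, k⟩ ω ^ 2 ≤ D.n j * (1 - ε / 2)} ∪
      {ω | D.n j * √(ε / 2) ≤ |∑ k, D.stdObs i ⟨j, k⟩ ω|} := fun ω hω => by
    by_contra hcon
    simp only [Set.mem_ofPred_eq, Set.mem_union, not_or, not_le] at hω hcon
    exact hω.not_ge (h.one_sub_le_relVar hcon.1.le hcon.2.le hε)
  calc P.real {ω | D.relVar j i ω < 1 - ε}
      ≤ _ := (measureReal_mono hsub).trans (measureReal_union_le _ _)
    _ ≤ Real.exp (-(D.n j * (ε / 2) ^ 2 * t ^ 4 / (48 * K))) +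
        2 * Real.exp (-(D.n j * (ε / 2) / 4)) := add_le_add hsq habs
    _ = Real.exp (-(D.n j * ε ^ 2 * t ^ 4 / (192 * K))) + 2 * Real.exp (-(D.n j * ε / 8)) := by
      ring_nf
    _ ≤ _ := by gcongr

end Regular

end TwoSample

theorem one_add_sq_le {L x : ℝ} (hL : 1 ≤ L) (hx : 0 ≤ x) (hxL : x ≤ √(2 * L)) :
    (1 + x) ^ 2 ≤ 6 * L := by
  have hsq : x ^ 2 ≤ 2 * L := (Real.le_sqrt hx (by positivity)).1 hxL
  nlinarith [sq_nonneg (x - 1)]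

namespace TwoSample

section

variable {m : ℕ} {Ω : Type*} [MeasurableSpace Ω] {P : Measure Ω} {D : TwoSample m P}

theorem abs_standardized_mean_sub (i : Fin m) :
    |(D.mean 0 i - D.mean 1 i) / D.diffSD i| = D.signalSize i := by
  rw [abs_div, diffSD, abs_of_nonneg (Real.sqrt_nonneg _), signalSize]

end

namespace Regular

section

variable {m : ℕ} {Ω : Type*} [MeasurableSpace Ω] {P : Measure Ω} {D : TwoSample m P} {t K N : ℝ}

theorem stdDiff_tail [IsProbabilityMeasure P] (h : D.Regular t K N) (i : Fin m) {r : ℝ}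
    (hr : 0 < r) : P.real {ω | r ≤ |D.stdDiff i ω|} ≤ 1 / r ^ 2 := by
  have hlaw := h.isStdSubexp_stdObs i
  have hm := h.measurable_stdObs i
  have hcheb := chebyshev_weighted_sum (μ := 0) (M := 1)
    (fun q => by simpa only [pow_one] using (hlaw q).memLp_comp_pow (hm q) 1) (iIndepFun_stdObs i)
    (fun q => (hlaw q).integral_comp (hm q)) (fun q => ((hlaw q).variance_comp (hm q)).le)
    (D.weight i) hr
  simpa only [stdDiff, zero_mul, sub_zero, h.sum_weight_sq i, mul_one] using hcheb

theorem mean_stdObs_sq_tail [IsProbabilityMeasure P] (h : D.Regular t K N) (j : Fin 2)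
    (i : Fin m) {r : ℝ} (hr : 0 < r) :
    P.real {ω | r ≤ |(∑ k, D.stdObs i ⟨j, k⟩ ω ^ 2) / D.n j - 1|} ≤
      24 / t ^ 4 * K / (N * r ^ 2) := by
  have hn := h.size_pos j
  have hle := h.le_size j
  have hN := h.two_le
  have hK := h.K_pos
  have ht := h.t_pos
  have hlaw := fun k : Fin (D.n j) => h.isStdSubexp_stdObs i ⟨j, k⟩
  have hm := fun k : Fin (D.n j) => h.measurable_stdObs i ⟨j, k⟩
  have hind : iIndepFun (fun (k : Fin (D.n j)) ω => D.stdObs i ⟨j, k⟩ ω ^ 2) P :=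
    (iIndepFun_stdObs_sample i j).comp (fun _ x => x ^ 2) (fun _ => by fun_prop)
  have hcheb := chebyshev_weighted_sum (μ := 1) (M := 24 / t ^ 4 * K)
    (fun k => (hlaw k).memLp_comp_pow (hm k) 2) hind
    (fun k => (hlaw k).integral_comp_sq (hm k)) (fun k => (hlaw k).variance_comp_sq_le (hm k))
    (fun _ => (D.n j : ℝ)⁻¹) hr
  simp only [inv_mul_eq_div, ← Finset.sum_div, Finset.sum_const, Finset.card_univ,
    Fintype.card_fin, nsmul_eq_mul, mul_inv_cancel₀ hn.ne', mul_one] at hcheb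
  calc _ ≤ _ := hcheb
    _ = 24 / t ^ 4 * K / (D.n j * r ^ 2) := by field_simp
    _ ≤ _ := by gcongr

theorem mean_stdObs_tail [IsProbabilityMeasure P] (h : D.Regular t K N) (j : Fin 2)
    (i : Fin m) {r : ℝ} (hr : 0 < r) :
    P.real {ω | r ≤ |(∑ k, D.stdObs i ⟨j, k⟩ ω) / D.n j|} ≤ 1 / (N * r ^ 2) := by
  have hn := h.size_pos j
  have hle := h.le_size j
  have hN := h.two_le
  have hlaw := fun k : Fin (D.n j) => h.isStdSubexp_stdObs i ⟨j, k⟩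
  have hm := fun k : Fin (D.n j) => h.measurable_stdObs i ⟨j, k⟩
  have hcheb := chebyshev_weighted_sum (μ := 0) (M := 1)
    (fun k => by simpa only [pow_one] using (hlaw k).memLp_comp_pow (hm k) 1)
    (iIndepFun_stdObs_sample i j) (fun k => (hlaw k).integral_comp (hm k))
    (fun k => ((hlaw k).variance_comp (hm k)).le) (fun _ => (D.n j : ℝ)⁻¹) hr
  simp only [inv_mul_eq_div, ← Finset.sum_div, Finset.sum_const, Finset.card_univ,
    Fintype.card_fin, nsmul_eq_mul, zero_mul, sub_zero, one_mul] at hcheb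
  calc _ ≤ _ := hcheb
    _ = 1 / (D.n j * r ^ 2) := by field_simp
    _ ≤ _ := by gcongr

theorem relVar_tail [IsProbabilityMeasure P] (h : D.Regular t K N) (j : Fin 2) (i : Fin m) {r : ℝ}
    (hr : 0 < r) (hr₁ : r ≤ 1) :
    P.real {ω | 2 * r ≤ |D.relVar j i ω - 1|} ≤ (24 / t ^ 4 * K + 1) / (N * r ^ 2) := by
  have hsub : {ω | 2 * r ≤ |D.relVar j i ω - 1|} ⊆
      {ω | r ≤ |(∑ k, D.stdObs i ⟨j, k⟩ ω ^ 2) / D.n j - 1|} ∪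
      {ω | r ≤ |(∑ k, D.stdObs i ⟨j, k⟩ ω) / D.n j|} := fun ω hω => by
    by_contra hcon
    simp only [Set.mem_ofPred_eq, Set.mem_union, not_or, not_le] at hω hcon
    have hmean := sq_lt_sq' (neg_lt_of_abs_lt hcon.2) (lt_of_abs_lt hcon.2)
    have hsq := abs_lt.1 hcon.1
    refine hω.not_gt ?_
    rw [h.relVar_eq, abs_lt]
    constructor <;> nlinarith [sq_nonneg ((∑ k, D.stdObs i ⟨j, k⟩ ω) / D.n j)]
  calc _ ≤ _ := (measureReal_mono hsub).trans (measureReal_union_le _ _)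
    _ ≤ 24 / t ^ 4 * K / (N * r ^ 2) + 1 / (N * r ^ 2) :=
        add_le_add (h.mean_stdObs_sq_tail j i hr) (h.mean_stdObs_tail j i hr)
    _ = _ := (add_div _ _ _).symm

theorem abs_relVarEst_sub_one_lt (h : D.Regular t K N) {v : VarianceCase} {i : Fin m}
    (hv : v = VarianceCase.equal → D.var 0 i = D.var 1 i) {ω : Ω} {ε : ℝ} (hε : ε ≤ 1)
    (hN : 4 + ε ≤ ε * N) (hrel : ∀ j, |D.relVar j i ω - 1| < ε / 4) :
    |D.relVarEst v i ω - 1| < ε := by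
  have hε₀ : 0 < ε := by linarith [(abs_nonneg _).trans_lt (hrel 0)]
  have hsize : ∀ j, (D.n j : ℝ) ≤ (1 + ε / 4) * (D.n j - 1) := fun j => by
    nlinarith [h.le_size j]
  have hlower : 1 - ε / 4 ≤ D.relVarEst v i ω :=
    h.le_relVarEst hv (by linarith) fun j => by linarith [(abs_lt.1 (hrel j)).1]
  have hupper : D.relVarEst v i ω ≤ (1 + ε / 4) * (1 + ε / 4) :=
    h.relVarEst_le hv (by linarith) (fun j => by linarith [(abs_lt.1 (hrel j)).2]) hsize
  rw [abs_lt]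
  constructor <;> nlinarith

theorem abs_tStat_mul_sqrt_le (h : D.Regular t K N) (v : VarianceCase) (i : Fin m) (ω : Ω) :
    |D.tStat v i ω| * √(D.relVarEst v i ω) ≤ |D.stdDiff i ω| + D.signalSize i := by
  rw [h.tStat_eq, abs_div, abs_of_nonneg (Real.sqrt_nonneg _), ← abs_standardized_mean_sub]
  exact (mul_le_of_le_div₀ (abs_nonneg _) (Real.sqrt_nonneg _) le_rfl).trans (abs_add_le _ _)

theorem signalSize_le (h : D.Regular t K N) {v : VarianceCase} {i : Fin m} {ω : Ω}
    (hvar : 0 < D.relVarEst v i ω) :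
    D.signalSize i ≤ |D.tStat v i ω| * √(D.relVarEst v i ω) + |D.stdDiff i ω| := by
  have hsqrt := Real.sqrt_pos.2 hvar
  rw [h.tStat_eq, abs_div, abs_of_pos hsqrt, div_mul_cancel₀ _ hsqrt.ne',
    ← abs_standardized_mean_sub]
  simpa only [add_sub_cancel_left] using
    abs_sub (D.stdDiff i ω + (D.mean 0 i - D.mean 1 i) / D.diffSD i) (D.stdDiff i ω)

theorem abs_tStat_mul_le_abs_stdDiff (h : D.Regular t K N) {v : VarianceCase} {i : Fin m} {ω : Ω}
    (hmean : D.mean 0 i = D.mean 1 i) {r : ℝ} (hr : 0 ≤ r) (hr₁ : r ≤ 1)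
    (hvar : r ≤ D.relVarEst v i ω) : |D.tStat v i ω| * r ≤ |D.stdDiff i ω| := by
  have hsignal : D.signalSize i = 0 := by
    rw [signalSize, hmean, sub_self, abs_zero, zero_div]
  calc |D.tStat v i ω| * r ≤ |D.tStat v i ω| * √(D.relVarEst v i ω) := by
        gcongr
        exact Real.le_sqrt_of_sq_le (by nlinarith)
    _ ≤ |D.stdDiff i ω| := by simpa only [hsignal, add_zero] using h.abs_tStat_mul_sqrt_le v i ω

theorem prob_le_abs_tStat_le [IsProbabilityMeasure P] (h : D.Regular t K N) {v : VarianceCase}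
    {i : Fin m} (hv : v = VarianceCase.equal → D.var 0 i = D.var 1 i)
    (hmean : D.mean 0 i = D.mean 1 i) {x e : ℝ} (he : 0 ≤ e) (he₁ : e ≤ 1) :
    P.real {ω | x ≤ |D.tStat v i ω|} ≤ P.real {ω | x * (1 - e) ≤ |D.stdDiff i ω|} +
      (P.real {ω | D.relVar 0 i ω < 1 - e} + P.real {ω | D.relVar 1 i ω < 1 - e}) := by
  have hsub : {ω | x ≤ |D.tStat v i ω|} ⊆ {ω | x * (1 - e) ≤ |D.stdDiff i ω|} ∪
      ({ω | D.relVar 0 i ω < 1 - e} ∪ {ω | D.relVar 1 i ω < 1 - e}) := fun ω hω => by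
    by_contra hcon
    simp only [Set.mem_ofPred_eq, Set.mem_union, not_or, not_le, not_lt] at hω hcon
    have hest : 1 - e ≤ D.relVarEst v i ω := h.le_relVarEst hv (by linarith) fun j => by
      fin_cases j
      exacts [hcon.2.1, hcon.2.2]
    refine hcon.1.not_ge (le_trans ?_
      (h.abs_tStat_mul_le_abs_stdDiff hmean (by linarith) (by linarith) hest))
    exact mul_le_mul_of_nonneg_right hω (by linarith)
  exact (measureReal_mono hsub).trans <| (measureReal_union_le _ _).trans <|
    add_le_add_right (measureReal_union_le _ _) _

end

theorem exists_prob_relVarEst_le.{u} {t K ε ρ : ℝ} (hε : 0 < ε) (hε₁ : ε ≤ 1) (hρ : 0 < ρ) :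
    ∃ R : ℝ, ∀ {N : ℝ} {m : ℕ} {Ω : Type u} [MeasurableSpace Ω] {P : Measure Ω}
      [IsProbabilityMeasure P] {D : TwoSample m P}, R ≤ N → D.Regular t K N →
      ∀ (v : VarianceCase) (i : Fin m), (v = VarianceCase.equal → D.var 0 i = D.var 1 i) →
      P.real {ω | ε ≤ |D.relVarEst v i ω - 1|} ≤ ρ := by
  set C := 24 / t ^ 4 * K + 1
  refine ⟨max ((4 + ε) / ε) (2 * C / (ρ * (ε / 8) ^ 2)), fun {N} m Ω _ P _ D hR h v i hv => ?_⟩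
  have hN := h.two_le
  have hεN := (div_le_iff₀' hε).1 ((le_max_left _ _).trans hR)
  have hCN := (div_le_iff₀' (by positivity)).1 ((le_max_right _ _).trans hR)
  have hsub : {ω | ε ≤ |D.relVarEst v i ω - 1|} ⊆
      {ω | 2 * (ε / 8) ≤ |D.relVar 0 i ω - 1|} ∪ {ω | 2 * (ε / 8) ≤ |D.relVar 1 i ω - 1|} :=
    fun ω hω => by
      by_contra hcon
      simp only [Set.mem_ofPred_eq, Set.mem_union, not_or, not_le] at hω hcon
      refine hω.not_gt (h.abs_relVarEst_sub_one_lt hv hε₁ hεN fun j => ?_)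
      fin_cases j
      · exact hcon.1.trans_eq (by ring)
      · exact hcon.2.trans_eq (by ring)
  have hrel := fun j => h.relVar_tail j i (r := ε / 8) (by positivity) (by linarith)
  calc _ ≤ _ := (measureReal_mono hsub).trans (measureReal_union_le _ _)
    _ ≤ C / (N * (ε / 8) ^ 2) + C / (N * (ε / 8) ^ 2) := add_le_add (hrel 0) (hrel 1)
    _ = 2 * C / (N * (ε / 8) ^ 2) := by ring
    _ ≤ ρ := by
      rw [div_le_iff₀ (by positivity)]
      linarith

theorem exists_prob_mul_sqrt_le_stdDiff_le.{u} {s ρ : ℝ} (hs : 0 < s) (hρ : 0 < ρ) :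
    ∃ R : ℝ, ∀ {L t K N : ℝ} {m : ℕ} {Ω : Type u} [MeasurableSpace Ω] {P : Measure Ω}
      [IsProbabilityMeasure P] {D : TwoSample m P}, R ≤ L → D.Regular t K N → ∀ i,
      P.real {ω | s * √L ≤ |D.stdDiff i ω|} ≤ ρ := by
  refine ⟨max 1 (1 / (ρ * s ^ 2)), fun {L} _ _ _ m Ω _ P _ D hR h i => ?_⟩
  have hL : 0 < L := one_pos.trans_le ((le_max_left _ _).trans hR)
  have hsL := (div_le_iff₀' (by positivity)).1 ((le_max_right _ _).trans hR)
  refine (h.stdDiff_tail i (by positivity)).trans ?_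
  rw [div_le_iff₀ (by positivity), mul_pow, Real.sq_sqrt hL.le]
  linarith

theorem exists_prob_le_tStat_le.{u} {t K θ τ ρ : ℝ} (hτ : 0 < τ) (hθ : θ < τ) (hρ : 0 < ρ) :
    ∃ R : ℝ, ∀ {L N : ℝ} {m : ℕ} {Ω : Type u} [MeasurableSpace Ω] {P : Measure Ω}
      [IsProbabilityMeasure P] {D : TwoSample m P}, R ≤ L → R ≤ N → D.Regular t K N →
      ∀ (v : VarianceCase) (i : Fin m), (v = VarianceCase.equal → D.var 0 i = D.var 1 i) →
      D.signalSize i ≤ θ * √L → P.real {ω | τ * √L ≤ |D.tStat v i ω|} ≤ ρ := by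
  obtain ⟨r, hθr, hr₁⟩ := exists_between (max_lt ((div_lt_one hτ).2 hθ) one_pos)
  obtain ⟨hθr, hr₀⟩ := max_lt_iff.1 hθr
  rw [div_lt_iff₀' hτ] at hθr
  obtain ⟨R₁, hR₁⟩ := exists_prob_relVarEst_le.{u} (t := t) (K := K) (sub_pos.2 hr₁)
    (by linarith) (half_pos hρ)
  obtain ⟨R₂, hR₂⟩ := exists_prob_mul_sqrt_le_stdDiff_le.{u} (sub_pos.2 hθr) (half_pos hρ)
  refine ⟨max R₁ R₂, fun {L N} m Ω _ P _ D hL hN h v i hv hsignal => ?_⟩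
  have hsub : {ω | τ * √L ≤ |D.tStat v i ω|} ⊆
      {ω | 1 - r ≤ |D.relVarEst v i ω - 1|} ∪ {ω | (τ * r - θ) * √L ≤ |D.stdDiff i ω|} :=
    fun ω hω => by
      by_contra hcon
      simp only [Set.mem_ofPred_eq, Set.mem_union, not_or, not_le] at hω hcon
      have hvar : r ≤ D.relVarEst v i ω := by linarith [(abs_lt.1 hcon.1).1]
      have hsqrt : r ≤ √(D.relVarEst v i ω) := Real.le_sqrt_of_sq_le (by nlinarith)
      have hle := calc τ * √L * r ≤ |D.tStat v i ω| * √(D.relVarEst v i ω) := by gcongr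
        _ ≤ |D.stdDiff i ω| + D.signalSize i := h.abs_tStat_mul_sqrt_le v i ω
      linarith
  calc _ ≤ _ := (measureReal_mono hsub).trans (measureReal_union_le _ _)
    _ ≤ ρ / 2 + ρ / 2 := add_le_add (hR₁ ((le_max_left _ _).trans hN) h v i hv)
        (hR₂ ((le_max_right _ _).trans hL) h i)
    _ = ρ := add_halves ρ

theorem exists_prob_tStat_le_le.{u} {t K θ τ ρ : ℝ} (hτ : 0 < τ) (hθ : τ < θ) (hρ : 0 < ρ) :
    ∃ R : ℝ, ∀ {L N : ℝ} {m : ℕ} {Ω : Type u} [MeasurableSpace Ω] {P : Measure Ω}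
      [IsProbabilityMeasure P] {D : TwoSample m P}, R ≤ L → R ≤ N → D.Regular t K N →
      ∀ (v : VarianceCase) (i : Fin m), (v = VarianceCase.equal → D.var 0 i = D.var 1 i) →
      θ * √L ≤ D.signalSize i → P.real {ω | |D.tStat v i ω| ≤ τ * √L} ≤ ρ := by
  obtain ⟨r, hr₁, hrθ⟩ := exists_between (lt_min ((one_lt_div hτ).2 hθ) one_lt_two)
  obtain ⟨hrθ, hr₂⟩ := lt_min_iff.1 hrθ
  rw [lt_div_iff₀' hτ] at hrθ
  obtain ⟨R₁, hR₁⟩ := exists_prob_relVarEst_le.{u} (t := t) (K := K) (sub_pos.2 hr₁)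
    (by linarith) (half_pos hρ)
  obtain ⟨R₂, hR₂⟩ := exists_prob_mul_sqrt_le_stdDiff_le.{u} (sub_pos.2 hrθ) (half_pos hρ)
  refine ⟨max R₁ R₂, fun {L N} m Ω _ P _ D hL hN h v i hv hsignal => ?_⟩
  have hsub : {ω | |D.tStat v i ω| ≤ τ * √L} ⊆
      {ω | r - 1 ≤ |D.relVarEst v i ω - 1|} ∪ {ω | (θ - τ * r) * √L ≤ |D.stdDiff i ω|} :=
    fun ω hω => by
      by_contra hcon
      simp only [Set.mem_ofPred_eq, Set.mem_union, not_or, not_le] at hω hcon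
      have hvar : 0 < D.relVarEst v i ω := by linarith [(abs_lt.1 hcon.1).1]
      have hsqrt : √(D.relVarEst v i ω) ≤ r :=
        Real.sqrt_le_iff.2 ⟨by linarith, by nlinarith [(abs_lt.1 hcon.1).2]⟩
      have hle : D.signalSize i ≤ τ * √L * r + |D.stdDiff i ω| :=
        (h.signalSize_le hvar).trans (by gcongr)
      linarith
  calc _ ≤ _ := (measureReal_mono hsub).trans (measureReal_union_le _ _)
    _ ≤ ρ / 2 + ρ / 2 := add_le_add (hR₁ ((le_max_left _ _).trans hN) h v i hv)
        (hR₂ ((le_max_right _ _).trans hL) h i)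
    _ = ρ := add_halves ρ

end Regular

end TwoSample

theorem eventually_nhdsGT_le {f : ℝ → ℝ} {a b : ℝ} (hf : Continuous f) (h : f a < b) :
    ∀ᶠ x in 𝓝[>] a, f x ≤ b :=
  ((hf.tendsto a).mono_left nhdsWithin_le_nhds).eventually_le_const h

theorem exists_one_add_pow_le {ε : ℝ} (hε : 0 < ε) (k : ℕ) : ∃ δ > 0, (1 + δ) ^ k ≤ 1 + ε :=
  ((eventually_nhdsGT_le (f := fun x => (1 + x) ^ k) (by fun_prop) (by simpa using hε)).and
    self_mem_nhdsWithin).exists.imp fun _ hδ => hδ.symm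

theorem gaussTail_mul_one_sub_le {η x : ℝ} (hη : 0 ≤ η) (hη₁ : η ≤ 1) (hx : 0 ≤ x) :
    gaussTail (x * (1 - η / (1 + x) ^ 2)) ≤ (1 + Real.exp (5 / 2) * η) * gaussTail x := by
  rw [mul_one_sub]
  refine gaussTail_sub_le hx hη₁ (by positivity) ?_
  calc x * (η / (1 + x) ^ 2) * (1 + x) = x / (1 + x) * η := by field_simp
    _ ≤ 1 * η := by
        gcongr
        exact div_le_one_of_le₀ (by linarith) (by positivity)
    _ = η := one_mul η

theorem one_add_pow_four_le_mul_sqrt {δ L N x : ℝ} (hδ : 0 < δ) (hL : 1 ≤ L) (hx : 0 ≤ x)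
    (hxL : x ≤ √(2 * L)) (hN : (36 / δ) ^ 2 * L ^ 4 ≤ N) : (1 + x) ^ 4 ≤ δ * √N := by
  have hsqrt : 36 / δ * L ^ 2 ≤ √N :=
    Real.le_sqrt_of_sq_le ((by ring : (36 / δ * L ^ 2) ^ 2 = _).trans_le hN)
  calc (1 + x) ^ 4 = ((1 + x) ^ 2) ^ 2 := by ring
    _ ≤ (6 * L) ^ 2 := by
        gcongr
        exact one_add_sq_le hL hx hxL
    _ = δ * (36 / δ * L ^ 2) := by
        field_simp
        norm_num
    _ ≤ δ * √N := by gcongr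

namespace TwoSample.Regular

theorem exists_prob_relVar_lt_le.{u} {t K η : ℝ} (hη : 0 < η) (hηt : √(η / 2) ≤ t / 2)
    (hηK : 48 / t ^ 3 * K * √(η / 2) ≤ 1 / 4) :
    ∃ R : ℝ, ∀ {L N e : ℝ} {m : ℕ} {Ω : Type u} [MeasurableSpace Ω] {P : Measure Ω}
      [IsProbabilityMeasure P] {D : TwoSample m P}, 1 ≤ L → R * L ^ 4 ≤ N → D.Regular t K N →
      η ≤ 6 * L * e → e ≤ η → ∀ j i,
      P.real {ω | D.relVar j i ω < 1 - e} ≤ 3 * Real.exp (-L) := by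
  refine ⟨max (6912 * K / (η ^ 2 * t ^ 4)) (48 / η),
    fun {L N e} m Ω _ P _ D hL hN h hLe he j i => ?_⟩
  have ht := h.t_pos
  have hK := h.K_pos
  have he₀ : 0 < e := pos_of_mul_pos_right (hη.trans_le hLe) (by positivity)
  have hN₀ : 0 ≤ N := zero_le_two.trans h.two_le
  have hsq : L ≤ N * e ^ 2 * t ^ 4 / (192 * K) := by
    rw [le_div_iff₀ (by positivity)]
    refine le_of_mul_le_mul_left ?_ (show 0 < 36 * L ^ 2 by positivity)
    calc 36 * L ^ 2 * (L * (192 * K)) = 6912 * K * L ^ 3 := by ring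
      _ ≤ 6912 * K * L ^ 4 := by
          gcongr
          norm_num
      _ = 6912 * K / (η ^ 2 * t ^ 4) * L ^ 4 * η ^ 2 * t ^ 4 := by field_simp
      _ ≤ N * (6 * L * e) ^ 2 * t ^ 4 := by
          gcongr
          exact (mul_le_mul_of_nonneg_right (le_max_left _ _) (by positivity)).trans hN
      _ = 36 * L ^ 2 * (N * e ^ 2 * t ^ 4) := by ring
  have hlin : L ≤ N * e / 8 := by
    rw [le_div_iff₀ (by norm_num)]
    refine le_of_mul_le_mul_left ?_ (show 0 < 6 * L by positivity)
    calc 6 * L * (L * 8) = 48 * L ^ 2 := by ring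
      _ ≤ 48 * L ^ 4 := by
          gcongr
          norm_num
      _ = 48 / η * L ^ 4 * η := by field_simp
      _ ≤ N * (6 * L * e) := by
          gcongr
          exact (mul_le_mul_of_nonneg_right (le_max_right _ _) (by positivity)).trans hN
      _ = 6 * L * (N * e) := by ring
  have hsqrt : √(e / 2) ≤ √(η / 2) := by gcongr
  calc _ ≤ _ := h.relVar_lower_tail he₀.le (hsqrt.trans hηt)
        ((mul_le_mul_of_nonneg_left hsqrt (by positivity)).trans hηK) j i
    _ ≤ Real.exp (-L) + 2 * Real.exp (-L) := by gcongr
    _ = 3 * Real.exp (-L) := by ring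

theorem exists_prob_le_abs_stdDiff_le.{u} {t ε : ℝ} (K : ℝ) (ht : 0 < t) (hε : 0 < ε) :
    ∃ δ > 0, ∀ {N x : ℝ} {m : ℕ} {Ω : Type u} [MeasurableSpace Ω] {P : Measure Ω}
      [IsProbabilityMeasure P] {D : TwoSample m P}, D.Regular t K N → 0 ≤ x →
      (1 + x) ^ 4 ≤ δ * √N → ∀ i,
      P.real {ω | x ≤ |D.stdDiff i ω|} ≤ (1 + ε) * (2 * gaussTail x) := by
  obtain ⟨δ, hδ, hdev⟩ := exists_prob_sum_ge_le.{u, 0} K ht hε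
  refine ⟨δ, hδ, fun {N x} m Ω _ P _ D h hx hxN i => ?_⟩
  have hN : 0 < √N := Real.sqrt_pos.2 (by linarith [h.two_le])
  have hside : ∀ s : ℝ, |s| = 1 →
      P.real {ω | x ≤ s * D.stdDiff i ω} ≤ (1 + ε) * gaussTail x := fun s hs => by
    have hs₂ : s ^ 2 = 1 := by rw [← sq_abs, hs, one_pow]
    have hprob := hdev (h.measurable_stdObs i) (iIndepFun_stdObs i) (h.isStdSubexp_stdObs i)
      (fun q => s * D.weight i q) (1 / √N) x
      (fun q => by simpa only [abs_mul, hs, one_mul] using h.abs_weight_le i q)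
      (by simpa only [mul_pow, hs₂, one_mul] using h.sum_weight_sq i) hx
      (by rwa [mul_one_div, div_le_iff₀ hN])
    simpa only [stdDiff, Finset.mul_sum, mul_assoc] using hprob
  have hsub : {ω | x ≤ |D.stdDiff i ω|} ⊆
      {ω | x ≤ 1 * D.stdDiff i ω} ∪ {ω | x ≤ -1 * D.stdDiff i ω} := fun ω hω => by
    simpa only [Set.mem_union, Set.mem_ofPred_eq, one_mul, neg_one_mul] using le_abs.1 hω
  calc _ ≤ _ := (measureReal_mono hsub).trans (measureReal_union_le _ _)
    _ ≤ (1 + ε) * gaussTail x + (1 + ε) * gaussTail x :=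
        add_le_add (hside 1 abs_one) (hside (-1) (by rw [abs_neg, abs_one]))
    _ = _ := by ring

theorem exists_prob_le_tStat_le_gaussTail.{u} {t ε : ℝ} (K : ℝ) (ht : 0 < t) (hε : 0 < ε) :
    ∃ R : ℝ, ∀ {L N x : ℝ} {m : ℕ} {Ω : Type u} [MeasurableSpace Ω] {P : Measure Ω}
      [IsProbabilityMeasure P] {D : TwoSample m P}, 1 ≤ L → R * L ^ 4 ≤ N → D.Regular t K N →
      ∀ {v : VarianceCase} {i : Fin m}, (v = VarianceCase.equal → D.var 0 i = D.var 1 i) →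
      D.mean 0 i = D.mean 1 i → 0 ≤ x → x ≤ √(2 * L) →
      P.real {ω | x ≤ |D.tStat v i ω|} ≤ (1 + ε) * (2 * gaussTail x) + 6 * Real.exp (-L) := by
  obtain ⟨ε₁, hε₁, hεle⟩ := exists_one_add_pow_le hε 2
  obtain ⟨δ, hδ, hdev⟩ := exists_prob_le_abs_stdDiff_le.{u} K ht hε₁
  obtain ⟨η, hη₁, hηε, hηt, hηK, hη⟩ : ∃ η ≤ 1, Real.exp (5 / 2) * η ≤ ε₁ ∧ √(η / 2) ≤ t / 2 ∧
      48 / t ^ 3 * K * √(η / 2) ≤ 1 / 4 ∧ 0 < η :=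
    ((eventually_nhdsGT_le continuous_id (by norm_num)).and <|
      (eventually_nhdsGT_le (by fun_prop) (by simpa using hε₁)).and <|
      (eventually_nhdsGT_le (by fun_prop) (by simpa using ht)).and <|
      (eventually_nhdsGT_le (by fun_prop) (by norm_num)).and self_mem_nhdsWithin).exists
  obtain ⟨R, hR⟩ := exists_prob_relVar_lt_le.{u} hη hηt hηK
  refine ⟨max R ((36 / δ) ^ 2), fun {L N x} m Ω _ P _ D hL hN h v i hv hmean hx hxL => ?_⟩
  have hxsq := one_add_sq_le hL hx hxL
  set e := η / (1 + x) ^ 2 with he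
  have he₀ : 0 < e := by positivity
  have heη : e ≤ η := div_le_self hη.le (by nlinarith)
  have hLe : η ≤ 6 * L * e := by
    rw [he, mul_div_assoc', le_div_iff₀ (by positivity)]
    nlinarith
  have hvar := hR hL ((mul_le_mul_of_nonneg_right (le_max_left _ _) (by positivity)).trans hN) h
    hLe heη
  have hx' : 0 ≤ x * (1 - e) := mul_nonneg hx (by linarith)
  have hdiff := hdev h hx' ((pow_le_pow_left₀ (by linarith)
    (by linarith [mul_nonneg hx he₀.le]) 4).trans (one_add_pow_four_le_mul_sqrt hδ hL hx hxL
      ((mul_le_mul_of_nonneg_right (le_max_right _ _) (by positivity)).trans hN))) i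
  have hshift : gaussTail (x * (1 - e)) ≤ (1 + ε₁) * gaussTail x :=
    (gaussTail_mul_one_sub_le hη.le hη₁ hx).trans (by gcongr; exact (gaussTail_pos x).le)
  calc _ ≤ _ := h.prob_le_abs_tStat_le hv hmean he₀.le (heη.trans hη₁)
    _ ≤ (1 + ε₁) * (2 * ((1 + ε₁) * gaussTail x)) + (3 * Real.exp (-L) + 3 * Real.exp (-L)) := by
        gcongr
        exacts [hdiff.trans (by gcongr), hvar 0 i, hvar 1 i]
    _ = (1 + ε₁) ^ 2 * (2 * gaussTail x) + 6 * Real.exp (-L) := by ring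
    _ ≤ _ := by
        gcongr
        exact (mul_pos two_pos (gaussTail_pos x)).le

theorem exists_prob_le_tStat_le_studentTail.{u} {t ε : ℝ} (K : ℝ) (ht : 0 < t) (hε : 0 < ε) :
    ∃ R : ℝ, ∀ {L N x : ℝ} {m : ℕ} {Ω : Type u} [MeasurableSpace Ω] {P : Measure Ω}
      [IsProbabilityMeasure P] {D : TwoSample m P}, 1 ≤ L → R * L ^ 4 ≤ N → D.Regular t K N →
      ∀ {v : VarianceCase} {i : Fin m}, (v = VarianceCase.equal → D.var 0 i = D.var 1 i) →
      D.mean 0 i = D.mean 1 i → 0 ≤ x → x ≤ √(2 * L) →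
      P.real {ω | x ≤ |D.tStat v i ω|} ≤
        (1 + ε) * studentTail ((D.n 0 : ℝ) + D.n 1 - 2) x + 6 * Real.exp (-L) := by
  obtain ⟨ε₁, hε₁, hεle⟩ := exists_one_add_pow_le hε 2
  obtain ⟨R, hR⟩ := exists_prob_le_tStat_le_gaussTail.{u} K ht hε₁
  obtain ⟨δ, hδ, hstudent⟩ := exists_gaussTail_le_studentTail hε₁
  refine ⟨max R (6 / δ), fun {L N x} m Ω _ P _ D hL hN h v i hv hmean hx hxL => ?_⟩
  set ν : ℝ := (D.n 0 : ℝ) + D.n 1 - 2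
  have hνN : N ≤ ν := by linarith [h.le_size 0, h.two_le_size 1]
  have hx_le : (1 + x) ^ 2 ≤ δ * ν := calc
    (1 + x) ^ 2 ≤ 6 * L := one_add_sq_le hL hx hxL
    _ ≤ 6 * L ^ 4 := by
        gcongr
        exact le_self_pow₀ hL (by norm_num)
    _ = δ * (6 / δ * L ^ 4) := by field_simp
    _ ≤ δ * ν := by
        gcongr
        exact (mul_le_mul_of_nonneg_right (le_max_right _ _) (by positivity)).trans (hN.trans hνN)
  have htail := hstudent ν x (h.two_le.trans hνN) hx hx_le
  have hpos : 0 ≤ studentTail ν x := nonneg_of_mul_nonneg_right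
    ((mul_pos two_pos (gaussTail_pos x)).le.trans htail) (by positivity)
  calc _ ≤ (1 + ε₁) * (2 * gaussTail x) + 6 * Real.exp (-L) :=
        hR hL ((mul_le_mul_of_nonneg_right (le_max_left _ _) (by positivity)).trans hN) h hv
          hmean hx hxL
    _ ≤ (1 + ε₁) * ((1 + ε₁) * studentTail ν x) + 6 * Real.exp (-L) := by gcongr
    _ = (1 + ε₁) ^ 2 * studentTail ν x + 6 * Real.exp (-L) := by ring
    _ ≤ _ := by gcongr

end TwoSample.Regular

open scoped Finset

theorem orderStat_le_iff {m : ℕ} (p : Fin m → ℝ) (k : Fin m) (x : ℝ) :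
    orderStat p k ≤ x ↔ (k : ℕ) < #{i | p i ≤ x} := by
  have hcard : #{i | p i ≤ x} = #{l | (p ∘ Tuple.sort p) l ≤ x} :=
    (Finset.card_bijective _ (Tuple.sort p).bijective (by simp)).symm
  rw [hcard, Tuple.lt_card_le_iff_apply_le_of_monotone (Tuple.monotone_sort p)]
  rfl

theorem mem_bhRejections_iff {m : ℕ} {α : ℝ} (hα : 0 ≤ α) {p : Fin m → ℝ} {i : Fin m} :
    i ∈ bhRejections α p ↔ ∃ k : ℕ, 1 ≤ k ∧ p i ≤ α * k / m ∧ k ≤ #{l | p l ≤ α * k / m} := by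
  set B := {l : Fin m | orderStat p l ≤ α * ((l : ℝ) + 1) / m} with hB
  constructor
  · rintro ⟨k, ⟨hk, -⟩, hik⟩
    refine ⟨k + 1, by omega, ?_, Nat.succ_le_of_lt ?_⟩
    · exact_mod_cast hik.trans hk
    · rw [← orderStat_le_iff]
      exact_mod_cast hk
  · rintro ⟨k, hk, hik, hcard⟩
    have hkm : k - 1 < m := by
      have hle := hcard.trans (Finset.card_le_univ _)
      rw [Fintype.card_fin] at hle
      omega
    have hcast : ((k - 1 : ℕ) : ℝ) + 1 = k := by exact_mod_cast Nat.sub_add_cancel hk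
    have hmem : (⟨k - 1, hkm⟩ : Fin m) ∈ B := by
      simp only [hB, Set.mem_ofPred_eq, orderStat_le_iff, hcast]
      omega
    obtain ⟨l, hl, hmax⟩ := B.toFinite.exists_maximal ⟨_, hmem⟩
    have hgreatest : IsGreatest B l := ⟨hl, fun a ha => (le_total a l).elim id (hmax ha)⟩
    refine ⟨l, hgreatest, ?_⟩
    have hrank : orderStat p ((Tuple.sort p).symm i) = p i := by simp [orderStat]
    rw [← hrank]
    refine Tuple.monotone_sort p (not_lt.1 fun hlt => hlt.not_ge (hgreatest.2 ?_))
    -- if the rank of `p i` exceeded `l ≥ k - 1`, it would satisfy the defining inequality of `B`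
    have hle : (k : ℝ) ≤ ((Tuple.sort p).symm i : ℕ) + 1 := by
      rw [← hcast]
      have := (Fin.le_def.1 (hgreatest.2 hmem)).trans (Fin.le_def.1 hlt.le)
      gcongr
    simp only [hB, Set.mem_ofPred_eq, hrank]
    exact hik.trans (by gcongr)

open Classical in
theorem sum_indicator_one_eq_card {Ω ι : Type*} (s : Finset ι) (A : ι → Set Ω) (ω : Ω) :
    ∑ i ∈ s, (A i).indicator (fun _ => (1 : ℝ)) ω = #{i ∈ s | ω ∈ A i} := by
  simp [Set.indicator_apply]

theorem hasSum_inv_one_add_pow {δ : ℝ} (hδ : 0 < δ) :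
    HasSum (fun l : ℕ => (1 + δ)⁻¹ ^ l) ((1 + δ) / δ) := by
  have hinv : 1 - (1 + δ)⁻¹ = δ / (1 + δ) := by
    field_simp
    ring
  rw [← inv_div, ← hinv]
  exact hasSum_geometric_of_lt_one (by positivity) (inv_lt_one_of_one_lt₀ (by linarith))

theorem exists_mul_one_add_pow_mem_Icc {δ u₀ u : ℝ} (hδ : 0 < δ) (hu₀ : 0 < u₀) (hu : u₀ ≤ u) :
    ∃ l : ℕ, u₀ * (1 + δ) ^ l ∈ Set.Icc u ((1 + δ) * u) := by
  obtain ⟨n, hn, hn'⟩ := exists_nat_pow_near ((one_le_div hu₀).2 hu) (lt_add_of_pos_right 1 hδ)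
  rw [le_div_iff₀' hu₀] at hn
  rw [div_lt_iff₀' hu₀] at hn'
  refine ⟨n + 1, hn'.le, ?_⟩
  rw [pow_succ', mul_left_comm]
  gcongr

section CountingEvents

variable {Ω ι : Type*} [MeasurableSpace Ω] {P : Measure Ω} [IsProbabilityMeasure P]
  {s : Finset ι} {A : ι → Set Ω} {b : ℝ}

theorem memLp_indicator_one {B : Set Ω} (hB : MeasurableSet B) :
    MemLp (B.indicator fun _ => (1 : ℝ)) 2 P := (memLp_const 1).indicator hB

theorem integral_sum_indicator_one_le (hA : ∀ i ∈ s, MeasurableSet (A i))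
    (hb : ∀ i ∈ s, P.real (A i) ≤ b) :
    ∫ ω, ∑ i ∈ s, (A i).indicator (fun _ => (1 : ℝ)) ω ∂P ≤ #s * b := by
  rw [integral_finsetSum _ fun i hi => (memLp_indicator_one (hA i hi)).integrable one_le_two,
    ← nsmul_eq_mul]
  exact Finset.sum_le_card_nsmul _ _ _ fun i hi =>
    (integral_indicator_one (hA i hi)).trans_le (hb i hi)

theorem covariance_indicator_one {B C : Set Ω} (hB : MeasurableSet B) (hC : MeasurableSet C) :
    cov[B.indicator fun _ => (1 : ℝ), C.indicator fun _ => 1; P] =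
      P.real (B ∩ C) - P.real B * P.real C := by
  have hmul : ((B.indicator fun _ => (1 : ℝ)) * C.indicator fun _ => 1) =
      (B ∩ C).indicator fun _ => 1 := by
    ext ω
    rw [Pi.mul_apply, ← Set.inter_indicator_mul, mul_one]
  rw [covariance_eq_sub (memLp_indicator_one hB) (memLp_indicator_one hC), hmul]
  exact congr_arg₂ _ (integral_indicator_one (hB.inter hC))
    (congr_arg₂ _ (integral_indicator_one hB) (integral_indicator_one hC))

theorem sum_covariance_indicator_one_le (hA : ∀ i ∈ s, MeasurableSet (A i))
    (hb : ∀ i ∈ s, P.real (A i) ≤ b) {i : ι} (hi : i ∈ s) {M : Finset ι} (hM : M ⊆ s)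
    (hind : ∀ l ∈ M, P.real (A i ∩ A l) = P.real (A i) * P.real (A l)) :
    ∑ l ∈ s, cov[(A i).indicator fun _ => (1 : ℝ), (A l).indicator fun _ => 1; P] ≤
      (#s - #M) * b := by
  classical
  have hzero : ∀ l ∈ M,
      cov[(A i).indicator fun _ => (1 : ℝ), (A l).indicator fun _ => 1; P] = 0 := fun l hl => by
    rw [covariance_indicator_one (hA i hi) (hA l (hM hl)), hind l hl, sub_self]
  rw [← Finset.sum_sdiff hM, Finset.sum_eq_zero hzero, add_zero, ← Finset.cast_card_sdiff hM,
    ← nsmul_eq_mul]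
  refine Finset.sum_le_card_nsmul _ _ _ fun l hl => ?_
  rw [covariance_indicator_one (hA i hi) (hA l (Finset.mem_sdiff.1 hl).1)]
  have hprod : 0 ≤ P.real (A i) * P.real (A l) := by positivity
  have hinter : P.real (A i ∩ A l) ≤ P.real (A i) := measureReal_mono Set.inter_subset_left
  linarith [hb i hi]

theorem variance_sum_indicator_one_le (hA : ∀ i ∈ s, MeasurableSet (A i))
    (hb : ∀ i ∈ s, P.real (A i) ≤ b) {K : ℝ}
    (hdep : ∀ i ∈ s, ∃ M ⊆ s, (#s : ℝ) - K ≤ #M ∧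
      ∀ l ∈ M, P.real (A i ∩ A l) = P.real (A i) * P.real (A l)) :
    Var[∑ i ∈ s, (A i).indicator fun _ => (1 : ℝ); P] ≤ K * (#s * b) := by
  rw [variance_sum' fun i hi => memLp_indicator_one (hA i hi), mul_left_comm, ← nsmul_eq_mul]
  refine Finset.sum_le_card_nsmul _ _ _ fun i hi => ?_
  obtain ⟨M, hM, hcard, hind⟩ := hdep i hi
  have hb₀ : 0 ≤ b := measureReal_nonneg.trans (hb i hi)
  refine (sum_covariance_indicator_one_le hA hb hi hM hind).trans ?_
  gcongr
  linarith

open Classical in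
theorem prob_card_ge_le_chebyshev (hA : ∀ i ∈ s, MeasurableSet (A i))
    (hb : ∀ i ∈ s, P.real (A i) ≤ b) {K r : ℝ} (hr : 0 < r)
    (hdep : ∀ i ∈ s, ∃ M ⊆ s, (#s : ℝ) - K ≤ #M ∧
      ∀ l ∈ M, P.real (A i ∩ A l) = P.real (A i) * P.real (A l)) :
    P.real {ω | #s * b + r ≤ #{i ∈ s | ω ∈ A i}} ≤ K * (#s * b) / r ^ 2 := by
  set Y : Ω → ℝ := ∑ i ∈ s, (A i).indicator fun _ => (1 : ℝ) with hY
  have hYω : ∀ ω, Y ω = #{i ∈ s | ω ∈ A i} := fun ω => by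
    rw [hY, Finset.sum_apply, sum_indicator_one_eq_card]
  have hmean : ∫ ω, Y ω ∂P ≤ #s * b := by
    simpa only [hY, Finset.sum_apply] using integral_sum_indicator_one_le hA hb
  have hvar : Var[Y; P] ≤ K * (#s * b) := variance_sum_indicator_one_le hA hb hdep
  have hsub : {ω | #s * b + r ≤ #{i ∈ s | ω ∈ A i}} ⊆ {ω | r ≤ |Y ω - ∫ ω, Y ω ∂P|} :=
    fun ω hω => by
      rw [Set.mem_ofPred_eq, ← hYω] at hω
      exact (show r ≤ Y ω - ∫ ω, Y ω ∂P by linarith).trans (le_abs_self _)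
  have hcheb := meas_ge_le_variance_div_sq
    (memLp_finsetSum' s fun i hi => memLp_indicator_one (P := P) (hA i hi)) hr
  refine (measureReal_mono hsub).trans (ENNReal.toReal_le_of_le_ofReal ?_
    (hcheb.trans (ENNReal.ofReal_le_ofReal (by gcongr))))
  have := (variance_nonneg _ _).trans hvar
  positivity

open Classical in
theorem prob_card_ge_le_markov (hs : s.Nonempty) (hA : ∀ i ∈ s, MeasurableSet (A i))
    (hb : ∀ i ∈ s, P.real (A i) ≤ b) {ε : ℝ} (hε : 0 < ε) :
    P.real {ω | ε * #s ≤ #{i ∈ s | ω ∈ A i}} ≤ b / ε := by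
  have hcard : 0 < (#s : ℝ) := by exact_mod_cast hs.card_pos
  have hmarkov := mul_meas_ge_le_integral_of_nonneg
    (f := fun ω => ∑ i ∈ s, (A i).indicator (fun _ => (1 : ℝ)) ω)
    (ae_of_all P fun ω => Finset.sum_nonneg fun i _ => Set.indicator_nonneg (by simp) _)
    (integrable_finsetSum _ fun i hi => (memLp_indicator_one (hA i hi)).integrable one_le_two)
    (ε * #s)
  simp only [sum_indicator_one_eq_card] at hmarkov
  have hmean := integral_sum_indicator_one_le (P := P) hA hb
  simp only [sum_indicator_one_eq_card] at hmean
  rw [le_div_iff₀ hε]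
  refine le_of_mul_le_mul_left ?_ hcard
  calc #s * (P.real {ω | ε * #s ≤ #{i ∈ s | ω ∈ A i}} * ε)
      = ε * #s * P.real {ω | ε * #s ≤ #{i ∈ s | ω ∈ A i}} := by ring
    _ ≤ #s * b := hmarkov.trans hmean

-- union bound over the grid `u₀ (1 + δ) ^ l`
theorem exists_uniform_lt_of_monotone {N : ℝ → Ω → ℝ} (hN : ∀ ω, Monotone fun u => N u ω)
    {a C δ u₀ : ℝ} (ha : 0 < a) (hC : 0 ≤ C) (hδ : 0 < δ) (hu₀ : 0 < u₀)
    (h : ∀ u, u₀ ≤ u → P.real {ω | a * u ≤ N u ω} ≤ C / u) :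
    ∃ B : Set Ω, P.real B ≤ C / u₀ * ((1 + δ) / δ) ∧
      ∀ ω ∉ B, ∀ u, u₀ ≤ u → N u ω < a * ((1 + δ) * u) := by
  set g : ℕ → ℝ := fun l => u₀ * (1 + δ) ^ l with hg
  have hbound : ∀ l, P.real {ω | a * g l ≤ N (g l) ω} ≤ C / u₀ * (1 + δ)⁻¹ ^ l := fun l => by
    refine (h (g l) (le_mul_of_one_le_right hu₀.le (one_le_pow₀ (by linarith)))).trans_eq ?_
    rw [hg, inv_pow]
    field_simp
  have hsum := (hasSum_inv_one_add_pow hδ).mul_left (C / u₀)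
  refine ⟨⋃ l, {ω | a * g l ≤ N (g l) ω}, ?_, fun ω hω u hu => ?_⟩
  · refine ENNReal.toReal_le_of_le_ofReal (by positivity) ?_
    calc P (⋃ l, {ω | a * g l ≤ N (g l) ω})
        ≤ ∑' l, P {ω | a * g l ≤ N (g l) ω} := measure_iUnion_le _
      _ ≤ ∑' l, ENNReal.ofReal (C / u₀ * (1 + δ)⁻¹ ^ l) :=
          ENNReal.tsum_le_tsum fun l => ENNReal.le_ofReal_iff_toReal_le (measure_ne_top _ _)
            (by positivity) |>.2 (hbound l)
      _ = ENNReal.ofReal (C / u₀ * ((1 + δ) / δ)) := by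
          rw [← ENNReal.ofReal_tsum_of_nonneg (fun l => by positivity) hsum.summable,
            hsum.tsum_eq]
  · obtain ⟨l, hle, hge⟩ := exists_mul_one_add_pow_mem_Icc hδ hu₀ hu
    have hnot : N (g l) ω < a * g l := by
      simpa only [Set.mem_iUnion, Set.mem_ofPred_eq, not_exists, not_le] using
        not_exists.1 (mt Set.mem_iUnion.2 hω) l
    calc N u ω ≤ N (g l) ω := hN ω hle
      _ < a * g l := hnot
      _ ≤ a * ((1 + δ) * u) := by gcongr

end CountingEvents

theorem indepFun_pi_of_iIndepFun {Ω κ : Type*} [MeasurableSpace Ω] [Finite κ] {P : Measure Ω}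
    [IsProbabilityMeasure P] {U V : κ → Ω → ℝ} (hU : ∀ q, Measurable (U q))
    (hV : ∀ q, Measurable (V q)) (h : iIndepFun (fun q ω => (U q ω, V q ω)) P)
    (hUV : ∀ q, IndepFun (U q) (V q) P) :
    IndepFun (fun ω q => U q ω) (fun ω q => V q ω) P := by
  cases nonempty_fintype κ
  have hmapU := (h.comp (fun _ x => x.1) fun _ => measurable_fst).map_fun_eq_pi_map
    fun q => (hU q).aemeasurable
  have hmapV := (h.comp (fun _ x => x.2) fun _ => measurable_snd).map_fun_eq_pi_map
    fun q => (hV q).aemeasurable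
  have hpair : ∀ q, P.map (fun ω => (U q ω, V q ω)) = (P.map (U q)).prod (P.map (V q)) :=
    fun q => (hUV q).map_prod_eq_prod_map_map (hU q).aemeasurable (hV q).aemeasurable
  have hmap := h.map_fun_eq_pi_map fun q => ((hU q).prodMk (hV q)).aemeasurable
  have := fun q => Measure.isProbabilityMeasure_map (μ := P) (hU q).aemeasurable
  have := fun q => Measure.isProbabilityMeasure_map (μ := P) (hV q).aemeasurable
  have hswap := measurePreserving_arrowProdEquivProdArrow ℝ ℝ κ (fun q => P.map (U q))
    (fun q => P.map (V q))
  simp_rw [hpair] at hmap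
  rw [indepFun_iff_map_prod_eq_prod_map_map (by fun_prop) (by fun_prop)]
  erw [hmapU, hmapV]
  rw [← hswap.map_eq, ← hmap, Measure.map_map (MeasurableEquiv.measurable _) (by fun_prop)]
  rfl

theorem indepFun_comp_iff_of_measurePreserving {Ω Ω' : Type*} [MeasurableSpace Ω]
    [MeasurableSpace Ω'] {P : Measure Ω} [IsFiniteMeasure P] {Q : Measure Ω'} {Z : Ω → Ω'}
    (hZ : MeasurePreserving Z P Q) {U V : Ω' → ℝ} (hU : Measurable U) (hV : Measurable V) :
    IndepFun (U ∘ Z) (V ∘ Z) P ↔ IndepFun U V Q := by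
  obtain ⟨hZm, rfl⟩ := hZ
  rw [indepFun_iff_map_prod_eq_prod_map_map hU.aemeasurable hV.aemeasurable,
    indepFun_iff_map_prod_eq_prod_map_map (by fun_prop) (by fun_prop),
    Measure.map_map hU hZm, Measure.map_map hV hZm, Measure.map_map (by fun_prop) hZm]
  rfl

/-- The two-sample `t` statistic as a function of the observations `x ⟨j, k⟩` of one coordinate. -/
noncomputable def tOfData (n : Fin 2 → ℕ) :
    VarianceCase → ((Σ j : Fin 2, Fin (n j)) → ℝ) → ℝ
  | v, x =>
    let mean : Fin 2 → ℝ := fun j => (1 / (n j : ℝ)) * ∑ k, x ⟨j, k⟩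
    let ss : Fin 2 → ℝ := fun j => ∑ k, (x ⟨j, k⟩ - mean j) ^ 2
    match v with
    | .equal => √((n 0 * n 1 : ℝ) / ((n 0 + n 1 : ℝ) *
        ((1 / ((n 0 : ℝ) + n 1 - 2)) * (ss 0 + ss 1)))) * (mean 0 - mean 1)
    | .unequal => (mean 0 - mean 1) /
        √((1 / ((n 0 : ℝ) - 1)) * ss 0 / n 0 + (1 / ((n 1 : ℝ) - 1)) * ss 1 / n 1)

theorem measurable_tOfData (n : Fin 2 → ℕ) (v : VarianceCase) : Measurable (tOfData n v) := by
  cases v <;> unfold tOfData <;> fun_prop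

namespace TwoSample

variable {m : ℕ} {Ω : Type*} [MeasurableSpace Ω] {P : Measure Ω} {D : TwoSample m P}

theorem tStat_eq_tOfData (v : VarianceCase) (i : Fin m) :
    D.tStat v i = fun ω => tOfData D.n v fun q => D.X q.1 q.2 ω i := by
  cases v <;> rfl

theorem measurable_tStat (hX : ∀ j k, Measurable (D.X j k)) (v : VarianceCase) (i : Fin m) :
    Measurable (D.tStat v i) := by
  rw [tStat_eq_tOfData]
  exact (measurable_tOfData D.n v).comp
    (measurable_pi_lambda _ fun q => (measurable_pi_apply i).comp (hX q.1 q.2))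

theorem indepFun_pop {i l : Fin m}
    (h : IndepFun (fun x : (Fin m → ℝ) × (Fin m → ℝ) => (x.1 l, x.2 l))
      (fun x => (x.1 i, x.2 i)) ((D.pop 0).prod (D.pop 1))) (j : Fin 2) :
    IndepFun (fun x : Fin m → ℝ => x l) (fun x => x i) (D.pop j) := by
  have := D.isProbabilityMeasure_pop
  fin_cases j
  · exact (indepFun_comp_iff_of_measurePreserving measurePreserving_fst (measurable_pi_apply l)
      (measurable_pi_apply i)).1 (h.comp measurable_fst measurable_fst)
  · exact (indepFun_comp_iff_of_measurePreserving measurePreserving_snd (measurable_pi_apply l)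
      (measurable_pi_apply i)).1 (h.comp measurable_snd measurable_snd)

theorem indepFun_tStat [IsProbabilityMeasure P] (hX : ∀ j k, Measurable (D.X j k))
    (v : VarianceCase) {i l : Fin m}
    (h : IndepFun (fun x : (Fin m → ℝ) × (Fin m → ℝ) => (x.1 l, x.2 l))
      (fun x => (x.1 i, x.2 i)) ((D.pop 0).prod (D.pop 1))) :
    IndepFun (D.tStat v l) (D.tStat v i) P := by
  have hcoord : ∀ (i : Fin m) (q : Σ j, Fin (D.n j)), Measurable fun ω => D.X q.1 q.2 ω i :=
    fun i q => (measurable_pi_apply i).comp (hX q.1 q.2)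
  have hobs : iIndepFun (fun (q : Σ j, Fin (D.n j)) ω => (D.X q.1 q.2 ω l, D.X q.1 q.2 ω i)) P :=
    D.indep.comp (fun _ x => (x l, x i)) fun _ => by fun_prop
  have hpair : ∀ q : Σ j, Fin (D.n j),
      IndepFun (fun ω => D.X q.1 q.2 ω l) (fun ω => D.X q.1 q.2 ω i) P := fun q =>
    (indepFun_comp_iff_of_measurePreserving ⟨hX q.1 q.2, (D.hasLaw q.1 q.2).map_eq⟩
      (measurable_pi_apply l) (measurable_pi_apply i)).2 (indepFun_pop h q.1)
  rw [tStat_eq_tOfData, tStat_eq_tOfData]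
  exact (indepFun_pi_of_iIndepFun (hcoord l) (hcoord i) hobs hpair).comp
    (measurable_tOfData D.n v) (measurable_tOfData D.n v)

end TwoSample

theorem exp_neg_le_gaussTail {x : ℝ} (hx : 0 ≤ x) :
    Real.exp (-(x ^ 2 / 2 + x + 3)) ≤ gaussTail x := by
  have hpi : √(2 * Real.pi) ≤ Real.exp (3 / 2) := by
    refine Real.sqrt_le_iff.2 ⟨(Real.exp_pos _).le, ?_⟩
    have hexp : Real.exp (3 / 2) ^ 2 = Real.exp 1 ^ 3 := by
      rw [← Real.exp_nat_mul, ← Real.exp_nat_mul]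
      norm_num
    have hcube := pow_le_pow_left₀ zero_le_two (Real.exp_one_gt_two.le) 3
    linarith [Real.pi_lt_four]
  have hpi₀ : 0 < √(2 * Real.pi) := Real.sqrt_pos.2 (by positivity)
  have hmills := gaussianPDFReal_le_gaussTail hx
  rw [gaussianPDFReal_std, inv_mul_le_iff₀ hpi₀] at hmills
  have hlin : 1 + x ≤ Real.exp x := (add_comm _ _).trans_le (Real.add_one_le_exp x)
  have hbound : Real.exp (-x ^ 2 / 2) ≤ Real.exp (3 + x) * gaussTail x := by
    refine hmills.trans ?_
    have hpos := gaussTail_pos x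
    calc _ ≤ Real.exp (3 / 2) * (Real.exp (3 / 2) * Real.exp x * gaussTail x) := by gcongr
      _ = Real.exp (3 + x) * gaussTail x := by
        rw [show (3 : ℝ) + x = 3 / 2 + (3 / 2 + x) by ring, Real.exp_add, Real.exp_add]
        ring
  rw [← inv_mul_le_iff₀ (Real.exp_pos _), ← Real.exp_neg, ← Real.exp_add] at hbound
  rwa [show -(x ^ 2 / 2 + x + 3) = -(3 + x) + -x ^ 2 / 2 by ring]

theorem exists_studentTail_le_exp_neg {τ s : ℝ} (hτ : 0 < τ) (hs : s < τ ^ 2 / 2) :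
    ∃ R, ∀ L ν, R ≤ L → 2 ≤ ν → R * L ≤ ν → studentTail ν (τ * √L) ≤ Real.exp (-s * L) := by
  have hgap : 0 < τ ^ 2 / 2 - s := sub_pos.2 hs
  refine ⟨max (max 1 (4 / τ ^ 2)) ((τ ^ 2 / 2 + τ ^ 4 / 4) / (τ ^ 2 / 2 - s)),
    fun L ν hL hν hLν => ?_⟩
  have hL₁ : 1 ≤ L := ((le_max_left _ _).trans (le_max_left _ _)).trans hL
  have hL₂ : 4 ≤ τ ^ 2 * L :=
    (div_le_iff₀' (by positivity)).1 (((le_max_right _ _).trans (le_max_left _ _)).trans hL)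
  have hν₁ : (τ ^ 2 / 2 + τ ^ 4 / 4) * L / ν ≤ τ ^ 2 / 2 - s := by
    have hmax := (mul_le_mul_of_nonneg_right (le_max_right (max 1 (4 / τ ^ 2)) _)
      (zero_le_one.trans hL₁)).trans hLν
    rw [div_mul_eq_mul_div, div_le_iff₀ hgap] at hmax
    exact (div_le_iff₀' (by linarith)).2 hmax
  have hsq : (τ * √L) ^ 2 = τ ^ 2 * L := by rw [mul_pow, Real.sq_sqrt (by linarith)]
  have ht : 2 ≤ τ * √L := abs_le_of_sq_le_sq' (by linarith) (by positivity) |>.2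
  refine (studentTail_le hν (by linarith)).trans ?_
  have hexp : -(τ * √L) ^ 2 / 2 + (τ * √L) ^ 2 / (2 * ν) + (τ * √L) ^ 4 / (4 * ν) ≤ -s * L :=
    calc _ = -(τ ^ 2 * L) / 2 + (τ ^ 2 / 2 + τ ^ 4 / 4 * L) / ν * L := by
          rw [show (τ * √L) ^ 4 = ((τ * √L) ^ 2) ^ 2 by ring, hsq]
          field_simp
          ring
      _ ≤ -(τ ^ 2 * L) / 2 + (τ ^ 2 / 2 + τ ^ 4 / 4) * L / ν * L := by
          gcongr
          nlinarith [sq_nonneg τ]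
      _ ≤ -(τ ^ 2 * L) / 2 + (τ ^ 2 / 2 - s) * L := by gcongr
      _ = -s * L := by ring
  calc _ ≤ 1 * Real.exp (-s * L) := by
        gcongr
        exact div_le_one_of_le₀ ht (by linarith)
    _ = _ := one_mul _

theorem exists_exp_neg_le_studentTail {τ s : ℝ} (hτ : 0 ≤ τ) (hs : τ ^ 2 / 2 < s) :
    ∃ R, ∀ L ν, R ≤ L → 2 ≤ ν → R * L ≤ ν → Real.exp (-s * L) ≤ studentTail ν (τ * √L) := by
  obtain ⟨δ, hδ, hstudent⟩ := exists_gaussTail_le_studentTail one_pos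
  have hgap : 0 < s - τ ^ 2 / 2 := sub_pos.2 hs
  refine ⟨max (max 1 (((τ + 3) / (s - τ ^ 2 / 2)) ^ 2)) ((2 + 2 * τ ^ 2) / δ),
    fun L ν hL hν hLν => ?_⟩
  have hL₁ : 1 ≤ L := ((le_max_left _ _).trans (le_max_left _ _)).trans hL
  have hL₂ : τ + 3 ≤ (s - τ ^ 2 / 2) * √L :=
    (div_le_iff₀' hgap).1 <| Real.le_sqrt_of_sq_le <|
      ((le_max_right _ _).trans (le_max_left _ _)).trans hL
  have hsq : √L ^ 2 = L := Real.sq_sqrt (by linarith)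
  have hsqrt : 1 ≤ √L := Real.one_le_sqrt.2 hL₁
  have hcond : (1 + τ * √L) ^ 2 ≤ δ * ν := by
    have hmax := (mul_le_mul_of_nonneg_right (le_max_right (max 1 _) _)
      (zero_le_one.trans hL₁)).trans hLν
    rw [div_mul_eq_mul_div, div_le_iff₀' hδ] at hmax
    calc (1 + τ * √L) ^ 2 ≤ 2 * 1 + 2 * τ ^ 2 * √L ^ 2 := by
          linarith [sq_nonneg (τ * √L - 1)]
      _ ≤ (2 + 2 * τ ^ 2) * L := by
          rw [hsq]
          linarith
      _ ≤ δ * ν := hmax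
  have hgauss : Real.exp (-s * L) ≤ gaussTail (τ * √L) := by
    refine le_trans (Real.exp_le_exp.2 ?_) (exp_neg_le_gaussTail (by positivity))
    have hlin : τ * √L + 3 ≤ (s - τ ^ 2 / 2) * L :=
      calc τ * √L + 3 ≤ (τ + 3) * √L := by linarith
        _ ≤ (s - τ ^ 2 / 2) * √L * √L := by gcongr
        _ = (s - τ ^ 2 / 2) * L := by rw [mul_assoc, ← sq, hsq]
    rw [mul_pow, hsq]
    linarith
  linarith [hstudent ν _ hν (by positivity) hcond]

namespace TwoSample

variable {m : ℕ} {Ω : Type*} [MeasurableSpace Ω] {P : Measure Ω} {D : TwoSample m P}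

/-- The degrees of freedom of the `t` distribution to which the statistics are compared. -/
noncomputable def df (D : TwoSample m P) : ℝ := (D.n 0 : ℝ) + D.n 1 - 2

namespace Regular

variable {t K N : ℝ}

theorem le_df (h : D.Regular t K N) : N ≤ D.df := by
  unfold df
  linarith [h.le_size 0, h.two_le_size 1]

theorem df_pos (h : D.Regular t K N) : 0 < D.df := by linarith [h.le_df, h.two_le]

theorem measurable_pValue (h : D.Regular t K N) (v : VarianceCase) (i : Fin m) :
    Measurable fun ω => D.pValue v ω i :=
  (continuous_studentTail h.df_pos).measurable.comp (measurable_tStat h.measurable v i).abs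

theorem indepFun_pValue [IsProbabilityMeasure P] (h : D.Regular t K N) (v : VarianceCase)
    {i l : Fin m}
    (hil : IndepFun (fun x : (Fin m → ℝ) × (Fin m → ℝ) => (x.1 l, x.2 l))
      (fun x => (x.1 i, x.2 i)) ((D.pop 0).prod (D.pop 1))) :
    IndepFun (fun ω => D.pValue v ω l) (fun ω => D.pValue v ω i) P :=
  have hmeas : Measurable fun x => studentTail D.df |x| :=
    ((continuous_studentTail h.df_pos).comp continuous_abs).measurable
  (indepFun_tStat h.measurable v hil).comp hmeas hmeas

theorem pValue_lt_studentTail_iff (h : D.Regular t K N) {v : VarianceCase} {ω : Ω} {i : Fin m}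
    {x : ℝ} : D.pValue v ω i < studentTail D.df x ↔ x < |D.tStat v i ω| :=
  (studentTail_strictAnti h.df_pos).lt_iff_gt

theorem pValue_le_studentTail_iff (h : D.Regular t K N) {v : VarianceCase} {ω : Ω} {i : Fin m}
    {x : ℝ} : D.pValue v ω i ≤ studentTail D.df x ↔ x ≤ |D.tStat v i ω| :=
  (studentTail_strictAnti h.df_pos).le_iff_ge

theorem exists_prob_pValue_lt_le.{u} {t K θ s ρ : ℝ} (hs : 0 < s) (hθ : θ < √(2 * s))
    (hρ : 0 < ρ) :
    ∃ R, ∀ {L N : ℝ} {m : ℕ} {Ω : Type u} [MeasurableSpace Ω] {P : Measure Ω}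
      [IsProbabilityMeasure P] {D : TwoSample m P}, R ≤ L → R * L ≤ N → D.Regular t K N →
      ∀ {v : VarianceCase} {i : Fin m}, (v = .equal → D.var 0 i = D.var 1 i) →
      D.signalSize i ≤ θ * √L → P.real {ω | D.pValue v ω i < Real.exp (-s * L)} ≤ ρ := by
  obtain ⟨τ, hτ, hτs⟩ := exists_between (max_lt hθ (Real.sqrt_pos.2 (by positivity : 0 < 2 * s)))
  obtain ⟨hθτ, hτ₀⟩ := max_lt_iff.1 hτ
  obtain ⟨R₁, hR₁⟩ := exists_prob_le_tStat_le.{u} (t := t) (K := K) hτ₀ hθτ hρ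
  obtain ⟨R₂, hR₂⟩ := exists_exp_neg_le_studentTail hτ₀.le
    (by linarith [(Real.lt_sqrt hτ₀.le).1 hτs] : τ ^ 2 / 2 < s)
  refine ⟨max 1 (max R₁ R₂), fun {L N m Ω _ P _ D} hL hN h v i hv hsize => ?_⟩
  obtain ⟨hL₁, hL₂⟩ := max_le_iff.1 hL
  obtain ⟨hL₂, hL₃⟩ := max_le_iff.1 hL₂
  have hRN : max 1 (max R₁ R₂) ≤ N := (le_mul_of_one_le_right (by positivity) hL₁).trans hN
  have hstudent := hR₂ L D.df hL₃ (h.two_le.trans h.le_df) <|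
    ((mul_le_mul_of_nonneg_right ((le_max_right _ _).trans (le_max_right _ _))
      (by linarith)).trans hN).trans h.le_df
  refine (measureReal_mono fun ω hω => ?_).trans
    (hR₁ hL₂ (((le_max_left _ _).trans (le_max_right _ _)).trans hRN) h v i hv hsize)
  exact (h.pValue_lt_studentTail_iff.1 (lt_of_lt_of_le hω hstudent)).le

theorem exists_prob_lt_pValue_le.{u} {t K θ s ρ : ℝ} (hθ : √(2 * s) < θ) (hρ : 0 < ρ) :
    ∃ R, ∀ {L N : ℝ} {m : ℕ} {Ω : Type u} [MeasurableSpace Ω] {P : Measure Ω}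
      [IsProbabilityMeasure P] {D : TwoSample m P}, R ≤ L → R * L ≤ N → D.Regular t K N →
      ∀ {v : VarianceCase} {i : Fin m}, (v = .equal → D.var 0 i = D.var 1 i) →
      θ * √L ≤ D.signalSize i → P.real {ω | Real.exp (-s * L) < D.pValue v ω i} ≤ ρ := by
  obtain ⟨τ, hτs, hτθ⟩ := exists_between hθ
  have hτ₀ : 0 < τ := (Real.sqrt_nonneg _).trans_lt hτs
  obtain ⟨R₁, hR₁⟩ := exists_prob_tStat_le_le.{u} (t := t) (K := K) hτ₀ hτθ hρ
  obtain ⟨R₂, hR₂⟩ := exists_studentTail_le_exp_neg hτ₀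
    (by linarith [(Real.sqrt_lt' hτ₀).1 hτs] : s < τ ^ 2 / 2)
  refine ⟨max 1 (max R₁ R₂), fun {L N m Ω _ P _ D} hL hN h v i hv hsize => ?_⟩
  obtain ⟨hL₁, hL₂⟩ := max_le_iff.1 hL
  obtain ⟨hL₂, hL₃⟩ := max_le_iff.1 hL₂
  have hRN : max 1 (max R₁ R₂) ≤ N := (le_mul_of_one_le_right (by positivity) hL₁).trans hN
  have hstudent := hR₂ L D.df hL₃ (h.two_le.trans h.le_df) <|
    ((mul_le_mul_of_nonneg_right ((le_max_right _ _).trans (le_max_right _ _))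
      (by linarith)).trans hN).trans h.le_df
  refine (measureReal_mono fun ω hω => ?_).trans
    (hR₁ hL₂ (((le_max_left _ _).trans (le_max_right _ _)).trans hRN) h v i hv hsize)
  exact (not_le.1 fun hle => (hstudent.trans_lt hω).not_ge (h.pValue_le_studentTail_iff.2 hle)).le

theorem exists_prob_pValue_le_le.{u} {t s ε : ℝ} (K : ℝ) (ht : 0 < t) (hs : s < 1) (hε : 0 < ε) :
    ∃ R, ∀ {L N u : ℝ} {m : ℕ} {Ω : Type u} [MeasurableSpace Ω] {P : Measure Ω}
      [IsProbabilityMeasure P] {D : TwoSample m P}, R ≤ L → R * L ^ 4 ≤ N → D.Regular t K N →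
      ∀ {v : VarianceCase} {i : Fin m}, (v = .equal → D.var 0 i = D.var 1 i) →
      D.mean 0 i = D.mean 1 i → Real.exp (-s * L) ≤ u →
      P.real {ω | D.pValue v ω i ≤ u} ≤ (1 + ε) * u := by
  obtain ⟨R₁, hR₁⟩ := exists_prob_le_tStat_le_studentTail.{u} K ht (half_pos hε)
  obtain ⟨R₂, hR₂⟩ := exists_studentTail_le_exp_neg (Real.sqrt_pos.2 zero_lt_two)
    (by rwa [Real.sq_sqrt zero_le_two, div_self two_ne_zero] : s < √2 ^ 2 / 2)
  refine ⟨max (max 1 R₁) (max R₂ (Real.log (12 / ε) / (1 - s))),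
    fun {L N u m Ω _ P _ D} hL hN h v i hv hmean hu => ?_⟩
  obtain ⟨⟨hL₁, -⟩, hL₂, hL₃⟩ := (max_le_iff.1 hL).imp max_le_iff.1 max_le_iff.1
  have hu₀ : 0 < u := (Real.exp_pos _).trans_le hu
  rcases le_or_gt 1 u with hu₁ | hu₁
  · nlinarith [measureReal_le_one (μ := P) (s := {ω | D.pValue v ω i ≤ u})]
  have hN₁ : R₁ * L ^ 4 ≤ N :=
    (mul_le_mul_of_nonneg_right ((le_max_right _ _).trans (le_max_left _ _))
      (by positivity)).trans hN
  have hstudent : studentTail D.df √(2 * L) ≤ Real.exp (-s * L) := by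
    rw [Real.sqrt_mul zero_le_two]
    refine hR₂ L D.df hL₂ (h.two_le.trans h.le_df) (le_trans ?_ (hN.trans h.le_df))
    exact mul_le_mul ((le_max_left _ _).trans (le_max_right _ _))
      (le_self_pow₀ hL₁ (by norm_num)) (by linarith) (by positivity)
  obtain ⟨x, ⟨hx₀, hxL⟩, hxu⟩ := intermediate_value_Icc' (Real.sqrt_nonneg (2 * L))
    (continuous_studentTail h.df_pos).continuousOn
    ⟨hstudent.trans hu, hu₁.le.trans_eq (studentTail_zero h.df_pos).symm⟩
  have hsmall : 6 * Real.exp (-L) ≤ ε / 2 * u := by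
    rw [div_le_iff₀' (sub_pos.2 hs), Real.log_le_iff_le_exp (by positivity), div_le_iff₀ hε] at hL₃
    have hexp : Real.exp (-L) * Real.exp ((1 - s) * L) = Real.exp (-s * L) := by
      rw [← Real.exp_add]
      ring_nf
    nlinarith [mul_le_mul_of_nonneg_left hL₃ (Real.exp_pos (-L)).le]
  simp only [← hxu, h.pValue_le_studentTail_iff]
  have hprob := hR₁ hL₁ hN₁ h hv hmean hx₀ hxL
  rw [← df, hxu] at hprob
  rw [hxu]
  linarith

end Regular

end TwoSample

section BenjaminiHochberg

variable {m : ℕ} {α : ℝ} {p : Fin m → ℝ}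

theorem mem_bhRejections_of_le (hα : 0 ≤ α) {x : ℝ} (hx : x ≤ α * #{l | p l ≤ x} / m) {i : Fin m}
    (hi : p i ≤ x) : i ∈ bhRejections α p := by
  refine (mem_bhRejections_iff hα).2
    ⟨#{l | p l ≤ x}, Finset.card_pos.2 ⟨i, by simpa using hi⟩, hi.trans hx, ?_⟩
  exact Finset.card_le_card fun l hl => by
    simp only [Finset.mem_filter_univ] at hl ⊢
    exact hl.trans hx

theorem lt_of_mem_bhRejections (hα : 0 ≤ α) {s : Finset (Fin m)} {a b u₀ : ℝ} (hb : 0 ≤ b)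
    (hcompl : ∀ u, u₀ ≤ u → #{i ∈ sᶜ | p i ≤ u} < a * u) (hs : #s ≤ b * u₀)
    (hab : (a + b) * α ≤ m) {i : Fin m} (hi : i ∈ bhRejections α p) : p i < u₀ := by
  obtain ⟨k, -, hik, hcard⟩ := (mem_bhRejections_iff hα).1 hi
  by_contra! hu₀
  have hm : 0 < (m : ℝ) := by exact_mod_cast i.pos
  set u := α * k / m with hu
  have hsplit : (#{l | p l ≤ u} : ℝ) ≤ #{l ∈ sᶜ | p l ≤ u} + #s := by
    have hsub : ({l | p l ≤ u} : Finset (Fin m)) ⊆ {l ∈ sᶜ | p l ≤ u} ∪ s := fun l hl => by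
      simp only [Finset.mem_union, Finset.mem_filter, Finset.mem_compl] at hl ⊢
      tauto
    exact_mod_cast (Finset.card_le_card hsub).trans (Finset.card_union_le _ _)
  have hlt : (k : ℝ) < k :=
    calc (k : ℝ) ≤ #{l ∈ sᶜ | p l ≤ u} + #s := (Nat.cast_le.2 hcard).trans hsplit
      _ < a * u + b * u₀ := add_lt_add_of_lt_of_le (hcompl u (hu₀.trans hik)) hs
      _ ≤ (a + b) * u := by
        rw [add_mul]
        gcongr
        exact hu₀.trans hik
      _ = (a + b) * α * k / m := by rw [hu, ← mul_div_assoc, mul_assoc]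
      _ ≤ k := by
        rw [div_le_iff₀' hm]
        gcongr
  exact hlt.false

end BenjaminiHochberg

namespace TwoSample

variable {m : ℕ} {Ω : Type*} [MeasurableSpace Ω] {P : Measure Ω} {D : TwoSample m P}
  {v : VarianceCase} {α ε : ℝ}

theorem mem_nulls {i : Fin m} : i ∈ D.nulls ↔ D.mean 0 i = D.mean 1 i :=
  Finset.mem_filter_univ i

theorem compl_signals : D.signalsᶜ = D.nulls := by
  ext i
  simp [nulls, signals]

theorem powerBH_nonneg (v : VarianceCase) (α : ℝ) (ω : Ω) : 0 ≤ D.powerBH v α ω := by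
  unfold powerBH
  positivity

theorem powerBH_le_one (v : VarianceCase) (α : ℝ) (ω : Ω) : D.powerBH v α ω ≤ 1 := by
  classical
  exact div_le_one_of_le₀ (Nat.cast_le.2 (Finset.card_filter_le _ _)) (by positivity)

theorem one_sub_lt_powerBH {x : ℝ} {ω : Ω} (hα : 0 ≤ α)
    (hx : x ≤ α * ((1 - ε) * #D.signals) / m)
    (hmiss : #{i ∈ D.signals | x < D.pValue v ω i} < ε * #D.signals) :
    1 - ε < D.powerBH v α ω := by
  classical
  have hcard : 0 < (#D.signals : ℝ) := by
    refine lt_of_le_of_ne (by positivity) fun h => ?_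
    rw [← h, mul_zero] at hmiss
    exact hmiss.not_ge (by positivity)
  have hhit : (1 - ε) * #D.signals < #{i ∈ D.signals | ¬x < D.pValue v ω i} := by
    have hsplit : (#{i ∈ D.signals | x < D.pValue v ω i} : ℝ) +
        #{i ∈ D.signals | ¬x < D.pValue v ω i} = #D.signals := by
      exact_mod_cast Finset.card_filter_add_card_filter_not _
    linarith
  have hcount : (#{i ∈ D.signals | ¬x < D.pValue v ω i} : ℝ) ≤ #{i | D.pValue v ω i ≤ x} := by
    simp only [not_lt]
    exact Nat.cast_le.2 (Finset.card_le_card (Finset.filter_subset_filter _ (Finset.subset_univ _)))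
  have hx' : x ≤ α * #{i | D.pValue v ω i ≤ x} / m := by
    refine hx.trans ?_
    gcongr
    exact hhit.le.trans hcount
  rw [powerBH, lt_div_iff₀ hcard]
  refine hhit.trans_le (Nat.cast_le.2 (Finset.card_le_card ?_))
  exact Finset.monotone_filter_right _ fun i _ hi => mem_bhRejections_of_le hα hx' (not_lt.1 hi)

theorem powerBH_lt {a b u₀ : ℝ} {ω : Ω} (hα : 0 ≤ α) (hb : 0 ≤ b)
    (hnull : ∀ u, u₀ ≤ u → #{i ∈ D.nulls | D.pValue v ω i ≤ u} < a * u)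
    (hsig : #D.signals ≤ b * u₀) (hab : (a + b) * α ≤ m)
    (hhit : #{i ∈ D.signals | D.pValue v ω i < u₀} < ε * #D.signals) :
    D.powerBH v α ω < ε := by
  classical
  have hcard : 0 < (#D.signals : ℝ) := by
    refine lt_of_le_of_ne (by positivity) fun h => ?_
    rw [← h, mul_zero] at hhit
    exact hhit.not_ge (by positivity)
  rw [← compl_signals] at hnull
  rw [powerBH, div_lt_iff₀ hcard]
  refine lt_of_le_of_lt (Nat.cast_le.2 (Finset.card_le_card ?_)) hhit
  exact Finset.monotone_filter_right _ fun i _ hi =>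
    lt_of_mem_bhRejections hα hb hnull hsig hab hi

namespace Regular

variable [IsProbabilityMeasure P] {t K N : ℝ}

theorem prob_le_abs_powerBH_sub_one_le (h : D.Regular t K N) {x b : ℝ} (hα : 0 ≤ α) (hε : 0 < ε)
    (hsig : D.signals.Nonempty) (hx : x ≤ α * ((1 - ε) * #D.signals) / m)
    (hb : ∀ i ∈ D.signals, P.real {ω | x < D.pValue v ω i} ≤ b) :
    P.real {ω | ε ≤ |D.powerBH v α ω - 1|} ≤ b / ε := by
  refine le_trans (measureReal_mono fun ω hω => ?_) (prob_card_ge_le_markov hsig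
    (fun i _ => measurableSet_lt measurable_const (h.measurable_pValue v i)) hb hε)
  by_contra hmiss
  rw [Set.mem_ofPred_eq, not_le] at hmiss
  rw [Set.mem_ofPred_eq, abs_of_nonpos (sub_nonpos.2 (powerBH_le_one v α ω))] at hω
  have hpower := one_sub_lt_powerBH (v := v) (ω := ω) hα hx (lt_of_eq_of_lt (by congr!) hmiss)
  linarith

variable {κ δ u₀ : ℝ}

theorem prob_card_nulls_ge_le (h : D.Regular t K N) {u : ℝ} (hm : 0 < m) (hκ : 0 ≤ κ)
    (hδ : 0 < δ) (hu : 0 < u)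
    (hdep : ∀ i ∈ D.nulls, ∃ M ⊆ D.nulls, (#D.nulls : ℝ) - κ ≤ #M ∧
      IndepFun (fun (x : (Fin m → ℝ) × (Fin m → ℝ)) (l : M) => (x.1 l, x.2 l))
        (fun x => (x.1 i, x.2 i)) ((D.pop 0).prod (D.pop 1)))
    (hprob : ∀ i ∈ D.nulls, P.real {ω | D.pValue v ω i ≤ u} ≤ (1 + δ) * u) :
    P.real {ω | (1 + 2 * δ) * m * u ≤ #{i ∈ D.nulls | D.pValue v ω i ≤ u}} ≤
      κ * (1 + δ) / (δ ^ 2 * m) / u := by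
  have : 0 < (m : ℝ) := by exact_mod_cast hm
  have hcard : (#D.nulls : ℝ) ≤ m := by exact_mod_cast card_finset_fin_le D.nulls
  have hcheb := prob_card_ge_le_chebyshev (r := δ * m * u)
    (fun i _ => measurableSet_le (h.measurable_pValue v i) measurable_const) hprob
    (by positivity) fun i hi => by
      obtain ⟨M, hM, hMcard, hind⟩ := hdep i hi
      refine ⟨M, hM, hMcard, fun l hl => ?_⟩
      have hpair := hind.comp (measurable_pi_apply (⟨l, hl⟩ : M)) measurable_id
      have hmul := (h.indepFun_pValue v hpair).symm.measure_inter_preimage_eq_mul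
        (Set.Iic u) (Set.Iic u) measurableSet_Iic measurableSet_Iic
      simp only [measureReal_def, ← ENNReal.toReal_mul]
      exact congrArg ENNReal.toReal hmul
  refine le_trans (measureReal_mono fun ω hω => ?_) (hcheb.trans ?_)
  · rw [Set.mem_ofPred_eq] at hω ⊢
    refine le_trans ?_ (hω.trans_eq (by congr!))
    calc #D.nulls * ((1 + δ) * u) + δ * m * u ≤ m * ((1 + δ) * u) + δ * m * u := by gcongr
      _ = (1 + 2 * δ) * m * u := by ring
  · calc κ * (#D.nulls * ((1 + δ) * u)) / (δ * m * u) ^ 2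
        ≤ κ * (m * ((1 + δ) * u)) / (δ * m * u) ^ 2 := by gcongr
      _ = κ * (1 + δ) / (δ ^ 2 * m) / u := by field_simp

theorem prob_le_powerBH_le (h : D.Regular t K N) {b : ℝ} (hα : 0 ≤ α) (hε : 0 < ε) (hκ : 0 ≤ κ)
    (hδ : 0 < δ) (hδα : ((1 + 2 * δ) * (1 + δ) + δ) * α ≤ 1) (hu₀ : 0 < u₀)
    (hdep : ∀ i ∈ D.nulls, ∃ M ⊆ D.nulls, (#D.nulls : ℝ) - κ ≤ #M ∧
      IndepFun (fun (x : (Fin m → ℝ) × (Fin m → ℝ)) (l : M) => (x.1 l, x.2 l))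
        (fun x => (x.1 i, x.2 i)) ((D.pop 0).prod (D.pop 1)))
    (hnull : ∀ i ∈ D.nulls, ∀ u, u₀ ≤ u → P.real {ω | D.pValue v ω i ≤ u} ≤ (1 + δ) * u)
    (hne : D.signals.Nonempty) (hcard : #D.signals ≤ δ * (m * u₀))
    (hb : ∀ i ∈ D.signals, P.real {ω | D.pValue v ω i < u₀} ≤ b) :
    P.real {ω | ε ≤ D.powerBH v α ω} ≤
      κ * (1 + δ) / (δ ^ 2 * m) / u₀ * ((1 + δ) / δ) + b / ε := by
  classical
  have hm : 0 < m := hne.choose.pos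
  obtain ⟨B, hB, hBnull⟩ := exists_uniform_lt_of_monotone
    (N := fun u ω => (#{i ∈ D.nulls | D.pValue v ω i ≤ u} : ℝ)) (a := (1 + 2 * δ) * m)
    (fun ω u u' huu' => Nat.cast_le.2 <| Finset.card_le_card <|
      Finset.monotone_filter_right _ fun i _ hi => hi.trans huu')
    (by positivity) (by positivity) hδ hu₀ fun u hu =>
      h.prob_card_nulls_ge_le hm hκ hδ (hu₀.trans_le hu) hdep fun i hi => hnull i hi u hu
  have hsignal := prob_card_ge_le_markov hne
    (fun i _ => measurableSet_lt (h.measurable_pValue v i) measurable_const) hb hε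
  refine le_trans (measureReal_mono fun ω hω => ?_)
    ((measureReal_union_le _ _).trans (add_le_add hB hsignal))
  by_contra! hgood
  simp only [Set.mem_union, Set.mem_ofPred_eq, not_or, not_le] at hgood hω
  refine hω.not_gt (powerBH_lt (a := (1 + 2 * δ) * m * (1 + δ)) (b := δ * m) hα (by positivity)
    (fun u hu => ?_) (by rwa [mul_assoc]) ?_ ?_)
  · rw [mul_assoc]
    exact hBnull ω hgood.1 u hu
  · calc _ = ((1 + 2 * δ) * (1 + δ) + δ) * α * m := by ring
      _ ≤ 1 * m := by gcongr
      _ = m := one_mul _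
  · convert hgood.2

end Regular

end TwoSample

section Growth

variable {ι : Type*} {l : Filter ι} {f g : ι → ℝ}

theorem eventually_const_mul_le_of_isLittleO (h : f =o[l] g) (hg : ∀ᶠ x in l, 0 ≤ g x) (R : ℝ) :
    ∀ᶠ x in l, R * f x ≤ g x := by
  filter_upwards [(h.const_mul_left R).bound one_pos, hg] with x hx hgx
  rw [one_mul, Real.norm_of_nonneg hgx] at hx
  exact (le_abs_self _).trans hx

theorem isLittleO_natCast_rpow_rpow {a b : ℝ} (hab : a < b) :
    (fun m : ℕ => (m : ℝ) ^ a) =o[atTop] fun m : ℕ => (m : ℝ) ^ b := by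
  refine (Asymptotics.isLittleO_of_tendsto' ?_ ?_ :
    (fun x : ℝ => x ^ a) =o[atTop] fun x => x ^ b).comp_tendsto tendsto_natCast_atTop_atTop
  · filter_upwards [eventually_gt_atTop 0] with x hx hxb
    exact absurd hxb (Real.rpow_pos_of_pos hx b).ne'
  · refine (tendsto_rpow_neg_atTop (sub_pos.2 hab)).congr' ?_
    filter_upwards [eventually_gt_atTop 0] with x hx
    rw [neg_sub, Real.rpow_sub hx]

theorem tendsto_log_natCast_atTop : Tendsto (fun m : ℕ => Real.log m) atTop atTop :=
  Real.tendsto_log_atTop.comp tendsto_natCast_atTop_atTop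

theorem isLittleO_log_natCast_pow_pow {k l : ℕ} (hkl : k < l) :
    (fun m : ℕ => Real.log m ^ k) =o[atTop] fun m : ℕ => Real.log m ^ l :=
  (Asymptotics.isLittleO_pow_pow_atTop_of_lt hkl).comp_tendsto tendsto_log_natCast_atTop

theorem isLittleO_log_natCast_pow {k : ℕ} (hk : 1 < k) :
    (fun m : ℕ => Real.log m) =o[atTop] fun m : ℕ => Real.log m ^ k := by
  simpa only [pow_one] using isLittleO_log_natCast_pow_pow hk

theorem mul_exp_neg_mul_log {x : ℝ} (hx : 0 < x) (s : ℝ) :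
    x * Real.exp (-s * Real.log x) = x ^ (1 - s) := by
  nth_rw 1 [← Real.exp_log hx]
  rw [← Real.exp_add, Real.rpow_def_of_pos hx]
  ring_nf

theorem eventually_div_mul_exp_neg_mul_log_le {s ε : ℝ} (hs : s < 1) (hε : 0 < ε) (c : ℝ) :
    ∀ᶠ m : ℕ in atTop, c / (m * Real.exp (-s * Real.log m)) ≤ ε := by
  filter_upwards [(((tendsto_rpow_atTop (sub_pos.2 hs)).comp
    tendsto_natCast_atTop_atTop).const_div_atTop c).eventually_le_const hε,
    eventually_gt_atTop 0] with m hm hm₀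
  rwa [mul_exp_neg_mul_log (by exact_mod_cast hm₀)]

theorem exists_lt_sqrt_two_mul {b θ : ℝ} (hb : 0 < b) (hθ : θ < √(2 * b)) :
    ∃ s, 0 < s ∧ s < b ∧ θ < √(2 * s) := by
  obtain ⟨τ, hτ, hτb⟩ := exists_between (max_lt hθ (Real.sqrt_pos.2 (by positivity : 0 < 2 * b)))
  obtain ⟨hθτ, hτ₀⟩ := max_lt_iff.1 hτ
  refine ⟨τ ^ 2 / 2, by positivity, by linarith [(Real.lt_sqrt hτ₀.le).1 hτb], ?_⟩
  rwa [mul_div_cancel₀ _ two_ne_zero, Real.sqrt_sq hτ₀.le]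

theorem exists_sqrt_two_mul_lt {b θ : ℝ} (hθ : √(2 * b) < θ) : ∃ s, b < s ∧ √(2 * s) < θ := by
  have hθ₀ : 0 < θ := (Real.sqrt_nonneg _).trans_lt hθ
  obtain ⟨s, hbs, hs⟩ := exists_between (show b < θ ^ 2 / 2 by
    linarith [(Real.sqrt_lt' hθ₀).1 hθ])
  exact ⟨s, hbs, (Real.sqrt_lt' hθ₀).2 (by linarith)⟩

end Growth

section Power

variable {Ω : ℕ → Type*} [∀ m, MeasurableSpace (Ω m)] {P : ∀ m, Measure (Ω m)}

theorem TendstoInProbability.of_forall_eventually_le [∀ m, IsFiniteMeasure (P m)]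
    {Y : ∀ m, Ω m → ℝ} {a : ℝ}
    (h : ∀ ε > 0, ∀ ρ > 0, ∀ᶠ m in atTop, (P m).real {ω | ε ≤ |Y m ω - a|} ≤ ρ) :
    TendstoInProbability P Y a := fun ε hε => by
  refine (ENNReal.tendsto_toReal_iff (fun _ => measure_ne_top _ _) ENNReal.zero_ne_top).1 ?_
  rw [ENNReal.toReal_zero]
  refine tendsto_order.2 ⟨fun b hb => Eventually.of_forall fun m => hb.trans_le measureReal_nonneg,
    fun ρ hρ => ?_⟩
  filter_upwards [h ε hε (ρ / 2) (half_pos hρ)] with m hm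
  exact hm.trans_lt (half_lt_self hρ)

theorem TendstoInProbability.congr_ae {Y Y' : ∀ m, Ω m → ℝ} {a : ℝ}
    (h : TendstoInProbability P Y a) (hY : ∀ m, Y m =ᵐ[P m] Y' m) :
    TendstoInProbability P Y' a := fun ε hε => by
  refine (h ε hε).congr fun m => measure_congr ?_
  filter_upwards [hY m] with ω hω
  exact congrArg (fun y => ε ≤ |y - a|) hω

variable {D : ∀ m, TwoSample m (P m)} {v : VarianceCase} {α β θ t K : ℝ} {N : ℕ → ℝ}

theorem eventually_nonempty_signals
    (hcard : (fun m : ℕ => (m : ℝ) ^ β) =O[atTop] fun m => (#(D m).signals : ℝ)) :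
    ∀ᶠ m in atTop, (D m).signals.Nonempty := by
  filter_upwards [hcard.eq_zero_imp, eventually_gt_atTop 0] with m hzero hm
  refine Finset.nonempty_iff_ne_empty.2 fun hempty => ?_
  exact (Real.rpow_pos_of_pos (Nat.cast_pos.2 hm) β).ne' (hzero (by simp [hempty]))

variable [∀ m, IsProbabilityMeasure (P m)]

theorem tendstoInProbability_powerBH_one (hα : 0 < α)
    (hreg : ∀ᶠ m in atTop, (D m).Regular t K (N m))
    (hN : (fun m : ℕ => Real.log m) =o[atTop] N)
    (hv : v = .equal → ∀ᶠ m in atTop, ∀ i, (D m).var 0 i = (D m).var 1 i)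
    (hcard : (fun m : ℕ => (m : ℝ) ^ β) =O[atTop] fun m => (#(D m).signals : ℝ))
    (hsize : ∀ᶠ m in atTop, ∀ i ∈ (D m).signals, θ * √(Real.log m) ≤ (D m).signalSize i)
    (hθ : √(2 * (1 - β)) < θ) : TendstoInProbability P (fun m => (D m).powerBH v α) 1 := by
  obtain ⟨s, hβs, hs⟩ := exists_sqrt_two_mul_lt hθ
  refine .of_forall_eventually_le fun ε₀ hε₀ ρ hρ => ?_
  set ε := min ε₀ (1 / 2)
  have hε : 0 < ε := by positivity
  have hε₁ : 0 < 1 - ε := by linarith [min_le_right ε₀ (1 / 2)]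
  obtain ⟨R, hR⟩ := TwoSample.Regular.exists_prob_lt_pValue_le hs (mul_pos hρ hε)
  filter_upwards [hreg, eventually_imp_distrib_left.2 hv, hsize,
    tendsto_log_natCast_atTop.eventually_ge_atTop R,
    eventually_const_mul_le_of_isLittleO hN (hreg.mono fun m h => zero_le_two.trans h.two_le) R,
    eventually_const_mul_le_of_isLittleO
      ((isLittleO_natCast_rpow_rpow (by linarith : 1 - s < β)).trans_isBigO hcard)
      (.of_forall fun m => by positivity) (α * (1 - ε))⁻¹,
    eventually_nonempty_signals hcard, eventually_gt_atTop 0]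
    with m hreg hv hsize hL hRN hsig hne hm
  have hm' : 0 < (m : ℝ) := by exact_mod_cast hm
  have hx : Real.exp (-s * Real.log m) ≤ α * ((1 - ε) * #(D m).signals) / m := by
    rwa [le_div_iff₀' hm', mul_exp_neg_mul_log hm', ← mul_assoc, ← inv_mul_le_iff₀ (by positivity)]
  have hprob := hreg.prob_le_abs_powerBH_sub_one_le (v := v) hα.le hε hne hx fun i hi =>
    hR hL hRN hreg (fun h => hv h i) (hsize i hi)
  rw [mul_div_cancel_right₀ _ hε.ne'] at hprob
  exact (measureReal_mono fun ω (hω : ε₀ ≤ _) => (min_le_left _ _).trans hω).trans hprob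

theorem tendstoInProbability_powerBH_zero (hα₀ : 0 ≤ α) (hα₁ : α < 1)
    (hreg : ∀ᶠ m in atTop, (D m).Regular t K (N m))
    (hN : (fun m : ℕ => Real.log m ^ 4) =o[atTop] N) (hdep : WeakDependence D)
    (hv : v = .equal → ∀ᶠ m in atTop, ∀ i, (D m).var 0 i = (D m).var 1 i)
    (hcard : (fun m : ℕ => (#(D m).signals : ℝ)) =Θ[atTop] fun m : ℕ => (m : ℝ) ^ β)
    (hβ₀ : 0 ≤ β) (hβ₁ : β < 1)
    (hsize : ∀ᶠ m in atTop, ∀ i ∈ (D m).signals, (D m).signalSize i ≤ θ * √(Real.log m))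
    (hθ : θ < √(2 * (1 - β))) : TendstoInProbability P (fun m => (D m).powerBH v α) 0 := by
  obtain ⟨κ, hκ, hdep⟩ := hdep
  have hN₀ : ∀ᶠ m in atTop, 0 ≤ N m := hreg.mono fun m h => zero_le_two.trans h.two_le
  obtain ⟨s, hs₀, hsβ, hs⟩ := exists_lt_sqrt_two_mul (sub_pos.2 hβ₁) hθ
  obtain ⟨δ, hδα, hδ⟩ : ∃ δ : ℝ, ((1 + 2 * δ) * (1 + δ) + δ) * α ≤ 1 ∧ 0 < δ :=
    ((eventually_nhdsGT_le (by fun_prop) (by simpa)).and self_mem_nhdsWithin).exists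
  refine .of_forall_eventually_le fun ε hε ρ hρ => ?_
  obtain ⟨R₁, hR₁⟩ := TwoSample.Regular.exists_prob_pValue_lt_le hs₀ hs
    (mul_pos (half_pos hρ) hε)
  obtain ⟨R₂, hR₂⟩ := TwoSample.Regular.exists_prob_pValue_le_le K hreg.exists.choose_spec.t_pos
    (by linarith : s < 1) hδ
  filter_upwards [hreg, eventually_imp_distrib_left.2 hv, hsize, hdep,
    tendsto_log_natCast_atTop.eventually_ge_atTop R₁,
    tendsto_log_natCast_atTop.eventually_ge_atTop R₂,
    eventually_const_mul_le_of_isLittleO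
      ((isLittleO_log_natCast_pow (by norm_num)).trans hN) hN₀ R₁,
    eventually_const_mul_le_of_isLittleO hN hN₀ R₂,
    eventually_const_mul_le_of_isLittleO
      (hcard.1.trans_isLittleO (isLittleO_natCast_rpow_rpow (by linarith : β < 1 - s)))
      (.of_forall fun m => by positivity) δ⁻¹,
    eventually_nonempty_signals hcard.2,
    eventually_div_mul_exp_neg_mul_log_le (by linarith : s < 1) (half_pos hρ)
      (κ * (1 + δ) ^ 2 / δ ^ 3),
    eventually_gt_atTop 0] with m hreg hv hsize hdep hL₁ hL₂ hN₁ hN₂ hsig hne hκm hm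
  have hm' : 0 < (m : ℝ) := by exact_mod_cast hm
  have hprob := hreg.prob_le_powerBH_le (v := v) hα₀ hε hκ.le hδ hδα (Real.exp_pos _) hdep
    (fun i hi u hu => hR₂ hL₂ hN₂ hreg (fun h => hv h i) (TwoSample.mem_nulls.1 hi) hu)
    hne (by rwa [mul_exp_neg_mul_log hm', ← inv_mul_le_iff₀ hδ])
    fun i hi => hR₁ hL₁ hN₁ hreg (fun h => hv h i) (hsize i hi)
  have hfalse : κ * (1 + δ) / (δ ^ 2 * m) / Real.exp (-s * Real.log m) * ((1 + δ) / δ) ≤ ρ / 2 :=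
    hκm.trans_eq' (by field_simp)
  rw [mul_div_cancel_right₀ _ hε.ne'] at hprob
  simp only [sub_zero, abs_of_nonneg (TwoSample.powerBH_nonneg v α _)]
  linarith

end Power

namespace TwoSample

variable {m : ℕ} {Ω : Type*} [MeasurableSpace Ω] {P : Measure Ω} (D : TwoSample m P)

/-- The size of the smaller of the two samples. -/
def minSize : ℕ := min (D.n 0) (D.n 1)

/-- The same two samples with the observations, which are only almost everywhere measurable,
replaced by measurable versions. -/
noncomputable def measurableVersion : TwoSample m P where
  n := D.n
  pop := D.pop
  isProbabilityMeasure_pop := D.isProbabilityMeasure_pop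
  memLp_two := D.memLp_two
  X j k := (D.hasLaw j k).aemeasurable.mk
  hasLaw j k := (D.hasLaw j k).congr (D.hasLaw j k).aemeasurable.ae_eq_mk.symm
  indep := D.indep.congr fun q => (D.hasLaw q.1 q.2).aemeasurable.ae_eq_mk

theorem powerBH_measurableVersion (v : VarianceCase) (α : ℝ) :
    D.measurableVersion.powerBH v α =ᵐ[P] D.powerBH v α := by
  have h : ∀ᵐ ω ∂P, ∀ q : Σ j : Fin 2, Fin (D.n j),
      D.X q.1 q.2 ω = D.measurableVersion.X q.1 q.2 ω :=
    ae_all_iff.2 fun q => (D.hasLaw q.1 q.2).aemeasurable.ae_eq_mk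
  filter_upwards [h] with ω hω
  have hp : D.pValue v ω = D.measurableVersion.pValue v ω := by
    funext i
    simp only [pValue, tStat_eq_tOfData, hω]
    rfl
  unfold powerBH
  rw [hp]
  rfl

end TwoSample

section Main

variable {Ω : ℕ → Type*} [∀ m, MeasurableSpace (Ω m)] {P : ∀ m, Measure (Ω m)}
  {D : ∀ m, TwoSample m (P m)}

/-- The exponential moment part of `MomentCondition`: positive variances, and an exponential moment
of the standardised coordinates that is bounded uniformly in the coordinate and the dimension. -/
def ExponentialMoments (D : ∀ m, TwoSample m (P m)) : Prop :=
  ∃ t K : ℝ, 0 < t ∧ 0 < K ∧ ∀ᶠ m in atTop, ∀ j i, 0 < (D m).var j i ∧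
    ∫⁻ x, ENNReal.ofReal (Real.exp (t * |x i - (D m).mean j i| / √((D m).var j i)))
      ∂((D m).pop j) ≤ ENNReal.ofReal K

theorem ExponentialMoments.exists_regular_measurableVersion (h : ExponentialMoments D)
    (hn : (fun m : ℕ => Real.log m) =o[atTop] fun m => ((D m).minSize : ℝ)) :
    ∃ t K : ℝ, ∀ᶠ m in atTop, (D m).measurableVersion.Regular t K (D m).minSize := by
  obtain ⟨t, K, ht, hK, hexp⟩ := h
  refine ⟨t, K, ?_⟩
  filter_upwards [hexp,
    eventually_const_mul_le_of_isLittleO hn (.of_forall fun m => by positivity) 2,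
    tendsto_log_natCast_atTop.eventually_ge_atTop 1] with m hexp hn hlog
  exact {
    t_pos := ht
    K_pos := hK
    two_le := by linarith
    measurable := fun j k => ((D m).hasLaw j k).aemeasurable.measurable_mk
    var_pos := fun j i => (hexp j i).1
    exp_le := fun j i => (hexp j i).2
    le_size := Fin.forall_fin_two.2
      ⟨Nat.cast_le.2 (min_le_left _ _), Nat.cast_le.2 (min_le_right _ _)⟩ }

theorem MomentCondition.exponentialMoments (h : MomentCondition D) : ExponentialMoments D := by
  obtain ⟨K, t, _, _, _, _, hK, ht, _, _, _, _, hev⟩ := h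
  exact ⟨t, K, ht, hK, hev.mono fun m hm => hm.1⟩

theorem MomentCondition.isLittleO_log_pow_four (h : MomentCondition D) :
    (fun m : ℕ => Real.log m ^ 4) =o[atTop] fun m => ((D m).minSize : ℝ) := by
  obtain ⟨_, _, _, _, ζ, c, _, _, _, _, hζ, hc, hev⟩ := h
  refine (isLittleO_log_natCast_pow_pow (by norm_num : 4 < 5)).trans_isBigO (.of_bound c⁻¹ ?_)
  filter_upwards [hev, tendsto_log_natCast_atTop.eventually_ge_atTop 1] with m hm hlog
  rw [Real.norm_of_nonneg (by positivity), Real.norm_of_nonneg (by positivity),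
    le_inv_mul_iff₀ hc, ← Real.rpow_natCast]
  refine le_trans ?_ hm.2.2.2
  gcongr
  exact_mod_cast hζ.le

variable [∀ m, IsProbabilityMeasure (P m)]

theorem theorem3p3_general {v : VarianceCase} {α β θ : ℝ}
    (hv : v = .equal → ∀ᶠ m in atTop, ∀ i, (D m).var 0 i = (D m).var 1 i)
    (hα : 0 < α) (hexp : ExponentialMoments D)
    (hn : (fun m : ℕ => Real.log m) =o[atTop] fun m => ((D m).minSize : ℝ))
    (hcard : (fun m : ℕ => (m : ℝ) ^ β) =O[atTop] fun m => (#(D m).signals : ℝ)) :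
    (α < 1 → 0 ≤ β → β < 1 → WeakDependence D →
      (fun m : ℕ => Real.log m ^ 4) =o[atTop] (fun m => ((D m).minSize : ℝ)) →
      (fun m => (#(D m).signals : ℝ)) =O[atTop] (fun m : ℕ => (m : ℝ) ^ β) →
      (∀ᶠ m in atTop, ∀ i ∈ (D m).signals, (D m).signalSize i ≤ θ * √(Real.log m)) →
      θ < √(2 * (1 - β)) → TendstoInProbability P (fun m => (D m).powerBH v α) 0) ∧
    ((∀ᶠ m in atTop, ∀ i ∈ (D m).signals, θ * √(Real.log m) ≤ (D m).signalSize i) →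
      √(2 * (1 - β)) < θ → TendstoInProbability P (fun m => (D m).powerBH v α) 1) := by
  obtain ⟨t, K, hreg⟩ := hexp.exists_regular_measurableVersion hn
  have hae := fun m => (D m).powerBH_measurableVersion v α
  constructor
  · intro hα₁ hβ₀ hβ₁ hdep hn₄ hcard' hsize hθ
    exact (tendstoInProbability_powerBH_zero hα.le hα₁ hreg hn₄ hdep hv ⟨hcard', hcard⟩ hβ₀ hβ₁
      hsize hθ).congr_ae hae
  · intro hsize hθ
    exact (tendstoInProbability_powerBH_one hα hreg hn hv hcard hsize hθ).congr_ae hae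

end Main

theorem theorem3p3 {Ω : ℕ → Type*} [∀ m, MeasurableSpace (Ω m)]
    (P : ∀ m, Measure (Ω m)) [∀ m, IsProbabilityMeasure (P m)]
    (D : ∀ m, TwoSample m (P m))
    (v : VarianceCase)
    (hv : v = VarianceCase.equal → ∀ᶠ m in atTop, ∀ i, (D m).var 0 i = (D m).var 1 i)
    (α : ℝ) (hα₀ : 0 < α) (hα₁ : α < 1)
    (β : ℝ) (hβ₀ : 0 < β) (hβ₁ : β < 1)
    (θ : ℝ) (hθ : 0 < θ)
    (hC2 : MomentCondition D) (hC3 : WeakDependence D)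
    (hsize : ∀ᶠ m in atTop, ∀ i ∈ (D m).signals, (D m).signalSize i = θ * √(Real.log m))
    (hcount : Tendsto (fun m : ℕ => ((D m).signals.card : ℝ) / (m : ℝ) ^ β) atTop (𝓝 1)) :
    (θ < √(2 * (1 - β)) →
      TendstoInProbability P (fun m => (D m).powerBH v α) 0) ∧
    (√(2 * (1 - β)) < θ →
      TendstoInProbability P (fun m => (D m).powerBH v α) 1) := by
  have hn := hC2.isLittleO_log_pow_four
  have hcard := Asymptotics.isTheta_of_div_tendsto_nhds_ne_zero hcount one_ne_zero
  exact (theorem3p3_general hv hα₀ hC2.exponentialMoments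
    ((isLittleO_log_natCast_pow (by norm_num)).trans hn) hcard.1).imp
    (fun h => h hα₁ hβ₀.le hβ₁ hC3 hn hcard.2 (hsize.mono fun m h i hi => (h i hi).le))
    fun h => h (hsize.mono fun m h i hi => (h i hi).ge)
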